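/- Let $p_1,\dots,p_n\in\{0,1\}^d$, let $0<\delta<\tfrac12$, and write $\mathrm{ham}$ for the Hamming distance and $N=2nd$. For $c>0$ put $k=\lceil c\,\log N/\delta^2\rceil$ and $L=\lceil\log_{1+\delta}d\rceil$. For each threshold $t=(1+\delta)^\ell$, $\ell=0,\dots,L$, let $F_t$ be a random $k\times d$ 0-1 matrix whose entries equal $1$ with probability $\frac1{4t}$, all entries of all these matrices being independent; let $f_t(x)=F_tx^{\top}\bmod 2$ and $C_1(t)=\frac12\bigl(1-(1-\frac1{2t})^t\bigr)$. Define the approximate distances by $W_{ij}=0$ if $p_i=p_j$, and otherwise let $W_{ij}$ be the smallest threshold $t$ with $\mathrm{ham}(f_t(p_i),f_t(p_j))\le (C_1(t)+\frac{\delta}{30})k$ (the largest threshold if there is none). A tree $T_\delta$ is any tree returned by Prim's algorithm (any start vertex, any tie-breaking) on the clique on $\{1,\dots,n\}$ with edge weights $W_{ij}$. The cost of a tree is the sum of $\mathrm{ham}(p_i,p_j)$ over its edges $\{i,j\}$. **Theorem.** For every $\alpha\ge1$ there is a constant $c>0$ such that the following holds. 1. For all $n\ge1$, $d\ge1$, $\delta\in(0,\frac12)$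 and all $p_1,\dots,p_n\in\{0,1\}^d$, with probability at least $1-N^{-\alpha}$ every tree $T_\delta$ is a spanning tree whose cost is at most $(1+\delta)^2$ times the cost of a minimum spanning tree of $p_1,\dots,p_n$ in $\{0,1\}^d$. 2. There are a constant $C$ and one program for a randomized real RAM (unit-cost memory access; addition, truncated subtraction, halving and comparison of natural numbers; field operations, $\exp$, $\log$ and comparison of reals; tosses of a coin of given bias) such that for all $n\ge1$, $d\ge2$, $\delta\in(0,\frac12)$ and all $p_1,\dots,p_n\in\{0,1\}^d$ the program, on input $(n,d,\delta,p_1,\dots,p_n)$, always halts with a spanning tree of the clique on $\{1,\dots,n\}$ as output after at most $$C\cdot\frac{\log(nd)}{\delta^2}\bigl(nd\log_{1+\delta}d+n^2\log\log_{1+\delta}d\bigr)$$ elementary operations. Moreover, there are matrices $F_t$, which are functions of its randomness and have the above distribution, such that with probability at least $1-N^{-\alpha}$ the output is a tree $T_\delta$ for these $F_t$ and has cost at most $(1+\delta)^2$ times the cost of a minimum spanning tree of the points. -/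

import Mathlib

open MeasureTheory ProbabilityTheory

namespace HamMST

/-! ### Approximate Hamming distances by random projections modulo 2

A point of `{0,1}^d` is a vector `Fin d → Bool`; the Hamming distance is Mathlib's `hammingDist`. -/

/-- The number `k = ⌈c · log N / δ²⌉` of rows of each random matrix, where `N = 2nd` is the input
size of the all-pairs problem for an `n × d` matrix and its transpose. -/
noncomputable def sketchDim (c : ℝ) (n d : ℕ) (δ : ℝ) : ℕ :=
  ⌈c * Real.log (2 * n * d) / δ ^ 2⌉₊

/-- The index `⌈log_{1+δ} d⌉` of the last threshold; the thresholds are `(1+δ)^ℓ` for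
`ℓ = 0, …, ⌈log_{1+δ} d⌉`. -/
noncomputable def lastIdx (d : ℕ) (δ : ℝ) : ℕ := ⌈Real.logb (1 + δ) d⌉₊

/-- One 0-1 matrix of size `k × d` for each threshold. -/
abbrev Matrices (k d : ℕ) (δ : ℝ) : Type := Fin (lastIdx d δ + 1) → Fin k → Fin d → Bool

/-- The law of the random matrices: all entries are independent, and an entry of the matrix of the
threshold `t = (1+δ)^ℓ` equals `1` with probability `1/(4t)`. -/
noncomputable def matricesLaw (k d : ℕ) (δ : ℝ) : Measure (Matrices k d δ) :=
  Measure.pi fun l => Measure.pi fun _ => Measure.pi fun _ =>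
    bernoulliMeasure true false
      (Set.projIcc (0 : ℝ) 1 zero_le_one (1 / (4 * (1 + δ) ^ (l : ℕ))))

/-- The projection `x ↦ A xᵀ mod 2`. -/
def proj {k d : ℕ} (A : Fin k → Fin d → Bool) (x : Fin d → Bool) : Fin k → Bool :=
  fun r => decide (Odd (Finset.univ.filter fun j => A r j = true ∧ x j = true).card)

/-- The constant `C₁ = (1 - (1 - 1/(2t))^t)/2` belonging to the threshold `t`. -/
noncomputable def C₁ (t : ℝ) : ℝ := (1 - (1 - 1 / (2 * t)) ^ t) / 2

/-- The projections of `x` and `y` for the threshold `t = (1+δ)^ℓ` are within Hamming distance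
`(C₁ + δ/30) k`. -/
def Passes {k d : ℕ} {δ : ℝ} (F : Matrices k d δ) (l : Fin (lastIdx d δ + 1))
    (x y : Fin d → Bool) : Prop :=
  (hammingDist (proj (F l) x) (proj (F l) y) : ℝ) ≤ (C₁ ((1 + δ) ^ (l : ℕ)) + δ / 30) * k

open Classical in
/-- The approximate Hamming distance: `0` for identical points, and otherwise the smallest
threshold for which the two projections are close (the last threshold, if there is none). -/
noncomputable def approxHam {k d : ℕ} {δ : ℝ} (F : Matrices k d δ) (x y : Fin d → Bool) : ℝ :=
  if x = y then 0
  else (1 + δ) ^ sInf {m : ℕ | m = lastIdx d δ ∨ ∃ h : m < lastIdx d δ + 1, Passes F ⟨m, h⟩ x y}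

/-! ### Spanning trees of the weighted clique on `n` vertices -/

open Classical in
/-- The sum of the weights of the edges of `T` (each edge counted once). -/
noncomputable def cost {n : ℕ} (w : Fin n → Fin n → ℝ) (T : SimpleGraph (Fin n)) : ℝ :=
  ∑ e ∈ Finset.univ.filter (fun e : Fin n × Fin n => e.1 < e.2 ∧ T.Adj e.1 e.2), w e.1 e.2

/-- `U` is a minimum spanning tree of the clique with edge weights `w`. -/
def IsMinSpanningTree {n : ℕ} (w : Fin n → Fin n → ℝ) (U : SimpleGraph (Fin n)) : Prop :=
  U.IsTree ∧ ∀ T : SimpleGraph (Fin n), T.IsTree → cost w U ≤ cost w T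

/-- The configurations `(S, T)` that Prim's algorithm can reach on the clique with edge weights `w`:
start with one vertex, and repeatedly add an edge of minimum weight between the set `S` of
visited vertices and its complement. Start vertex and ties are left open. -/
inductive PrimReach {n : ℕ} (w : Fin n → Fin n → ℝ) :
    Finset (Fin n) → SimpleGraph (Fin n) → Prop
  | start (r : Fin n) : PrimReach w {r} ⊥
  | step (S : Finset (Fin n)) (T : SimpleGraph (Fin n)) (u v : Fin n)
      (h : PrimReach w S T) (hu : u ∈ S) (hv : v ∉ S)
      (hmin : ∀ a ∈ S, ∀ b ∉ S, w u v ≤ w a b) :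
      PrimReach w (insert v S) (T ⊔ SimpleGraph.edge u v)

/-- `T` is a tree that Prim's algorithm can return for the edge weights `w`. -/
def IsPrimTree {n : ℕ} (w : Fin n → Fin n → ℝ) (T : SimpleGraph (Fin n)) : Prop :=
  PrimReach w Finset.univ T

/-- The edge weights given by the exact Hamming distances of the points. -/
def hamWeight {n d : ℕ} (p : Fin n → Fin d → Bool) (i j : Fin n) : ℝ :=
  (hammingDist (p i) (p j) : ℝ)

/-- The edge weights given by the approximate Hamming distances of the points. -/
noncomputable def approxWeight {n k d : ℕ} {δ : ℝ} (F : Matrices k d δ)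
    (p : Fin n → Fin d → Bool) (i j : Fin n) : ℝ :=
  approxHam F (p i) (p j)

/-- The cost of `T` in the Hamming space is at most `(1+δ)²` times that of a minimum spanning tree
of the points. -/
def IsApproxMST {n d : ℕ} (δ : ℝ) (p : Fin n → Fin d → Bool) (T : SimpleGraph (Fin n)) : Prop :=
  T.IsTree ∧ ∀ U : SimpleGraph (Fin n), IsMinSpanningTree (hamWeight p) U →
    cost (hamWeight p) T ≤ (1 + δ) ^ 2 * cost (hamWeight p) U

/-! ### A randomized real RAM

The memory consists of arrays of natural numbers and of arrays of reals. Both kinds are numbered by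
natural numbers and have three indices; a scalar variable is the cell with indices `0, 0, 0`.
Programs are finite while-programs. On naturals there are addition, truncated subtraction and
halving, on reals the field operations, `exp` and `log` (there is no rounding of reals to
naturals), and a coin instruction tosses a coin with a given bias. -/

/-- A memory state; `coins` is the number of coins tossed so far. -/
structure State where
  nat : ℕ → ℕ → ℕ → ℕ → ℕ
  real : ℕ → ℕ → ℕ → ℕ → ℝ
  coins : ℕ

/-- Overwrite the cell `i, j, l` of the array number `a`. -/
def upd {β : Type} (m : ℕ → ℕ → ℕ → ℕ → β) (a i j l : ℕ) (v : β) : ℕ → ℕ → ℕ → ℕ → β :=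
  fun a' i' j' l' => if a' = a ∧ i' = i ∧ j' = j ∧ l' = l then v else m a' i' j' l'

/-- Expressions with values in `ℕ`. -/
inductive NExp where
  | lit (m : ℕ)
  | get (a : ℕ) (i j l : NExp)
  | add (e f : NExp)
  | sub (e f : NExp)
  | half (e : NExp)

/-- Expressions with values in `ℝ`. -/
inductive RExp where
  | ofNat (e : NExp)
  | get (a : ℕ) (i j l : NExp)
  | add (e f : RExp)
  | sub (e f : RExp)
  | mul (e f : RExp)
  | div (e f : RExp)
  | exp (e : RExp)
  | log (e : RExp)

/-- Tests. -/
inductive BExp where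
  | natLe (e f : NExp)
  | realLe (e f : RExp)
  | not (b : BExp)
  | and (b c : BExp)

/-- Programs. -/
inductive Prog where
  | skip
  | setNat (a : ℕ) (i j l e : NExp)
  | setReal (a : ℕ) (i j l : NExp) (e : RExp)
  | coin (a : ℕ) (i j l : NExp) (bias : RExp)
  | seq (P Q : Prog)
  | ite (b : BExp) (P Q : Prog)
  | while (b : BExp) (P : Prog)

/-- The value of an expression. -/
def NExp.eval (s : State) : NExp → ℕ
  | .lit m => m
  | .get a i j l => s.nat a (i.eval s) (j.eval s) (l.eval s)
  | .add e f => e.eval s + f.eval s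
  | .sub e f => e.eval s - f.eval s
  | .half e => e.eval s / 2

/-- The value of an expression. -/
noncomputable def RExp.eval (s : State) : RExp → ℝ
  | .ofNat e => (e.eval s : ℝ)
  | .get a i j l => s.real a (i.eval s) (j.eval s) (l.eval s)
  | .add e f => e.eval s + f.eval s
  | .sub e f => e.eval s - f.eval s
  | .mul e f => e.eval s * f.eval s
  | .div e f => e.eval s / f.eval s
  | .exp e => Real.exp (e.eval s)
  | .log e => Real.log (e.eval s)

/-- The test succeeds in the state `s`. -/
def BExp.Holds (s : State) : BExp → Prop
  | .natLe e f => e.eval s ≤ f.eval s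
  | .realLe e f => e.eval s ≤ f.eval s
  | .not b => ¬ b.Holds s
  | .and b c => b.Holds s ∧ c.Holds s

/-- The number of elementary operations for evaluating an expression. -/
def NExp.ops : NExp → ℕ
  | .lit _ => 1
  | .get _ i j l => 1 + i.ops + j.ops + l.ops
  | .add e f => 1 + e.ops + f.ops
  | .sub e f => 1 + e.ops + f.ops
  | .half e => 1 + e.ops

/-- The number of elementary operations for evaluating an expression. -/
def RExp.ops : RExp → ℕ
  | .ofNat e => 1 + e.ops
  | .get _ i j l => 1 + i.ops + j.ops + l.ops
  | .add e f => 1 + e.ops + f.ops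
  | .sub e f => 1 + e.ops + f.ops
  | .mul e f => 1 + e.ops + f.ops
  | .div e f => 1 + e.ops + f.ops
  | .exp e => 1 + e.ops
  | .log e => 1 + e.ops

/-- The number of elementary operations for evaluating a test. -/
def BExp.ops : BExp → ℕ
  | .natLe e f => 1 + e.ops + f.ops
  | .realLe e f => 1 + e.ops + f.ops
  | .not b => 1 + b.ops
  | .and b c => 1 + b.ops + c.ops

/-- The source of randomness: an infinite sequence of numbers in `[0,1]`. A program has no access to
them except through its coin instructions. -/
abbrev Seed : Type := ℕ → unitInterval

/-- The members of the random sequence are independent and uniformly distributed. -/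
noncomputable def seedLaw : Measure Seed :=
  Measure.infinitePi fun _ : ℕ => (volume : Measure unitInterval)

open Classical in
/-- The next coin shows `1` with probability `bias`. -/
noncomputable def toss (ω : Seed) (s : State) (bias : ℝ) : ℕ :=
  if (ω s.coins : ℝ) < bias then 1 else 0

/-- `Exec ω P s s' τ`: with randomness `ω`, the program `P`, started in the state `s`, halts in the
state `s'` after `τ` elementary operations. -/
inductive Exec (ω : Seed) : Prog → State → State → ℕ → Prop
  | skip (s : State) : Exec ω .skip s s 1
  | setNat (a : ℕ) (i j l e : NExp) (s : State) :
      Exec ω (.setNat a i j l e) s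
        { s with nat := upd s.nat a (i.eval s) (j.eval s) (l.eval s) (e.eval s) }
        (1 + i.ops + j.ops + l.ops + e.ops)
  | setReal (a : ℕ) (i j l : NExp) (e : RExp) (s : State) :
      Exec ω (.setReal a i j l e) s
        { s with real := upd s.real a (i.eval s) (j.eval s) (l.eval s) (e.eval s) }
        (1 + i.ops + j.ops + l.ops + e.ops)
  | coin (a : ℕ) (i j l : NExp) (bias : RExp) (s : State) :
      Exec ω (.coin a i j l bias) s
        { s with
          nat := upd s.nat a (i.eval s) (j.eval s) (l.eval s) (toss ω s (bias.eval s))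
          coins := s.coins + 1 }
        (1 + i.ops + j.ops + l.ops + bias.ops)
  | seq (P Q : Prog) (s s' s'' : State) (τ τ' : ℕ)
      (hP : Exec ω P s s' τ) (hQ : Exec ω Q s' s'' τ') :
      Exec ω (.seq P Q) s s'' (τ + τ')
  | iteTrue (b : BExp) (P Q : Prog) (s s' : State) (τ : ℕ)
      (hb : b.Holds s) (hP : Exec ω P s s' τ) :
      Exec ω (.ite b P Q) s s' (1 + b.ops + τ)
  | iteFalse (b : BExp) (P Q : Prog) (s s' : State) (τ : ℕ)
      (hb : ¬ b.Holds s) (hQ : Exec ω Q s s' τ) :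
      Exec ω (.ite b P Q) s s' (1 + b.ops + τ)
  | whileTrue (b : BExp) (P : Prog) (s s' s'' : State) (τ τ' : ℕ)
      (hb : b.Holds s) (hP : Exec ω P s s' τ) (hW : Exec ω (.while b P) s' s'' τ') :
      Exec ω (.while b P) s s'' (1 + b.ops + τ + τ')
  | whileFalse (b : BExp) (P : Prog) (s : State) (hb : ¬ b.Holds s) :
      Exec ω (.while b P) s s (1 + b.ops)

/-- Final state and running time are determined by the program, the initial state and the
randomness. -/
theorem Exec.unique {ω : Seed} {P : Prog} {s s₁ s₂ : State} {τ₁ τ₂ : ℕ}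
    (h₁ : Exec ω P s s₁ τ₁) (h₂ : Exec ω P s s₂ τ₂) : s₁ = s₂ ∧ τ₁ = τ₂ := by
  induction h₁ generalizing s₂ τ₂ with
  | skip s => cases h₂; exact ⟨rfl, rfl⟩
  | setNat => cases h₂; exact ⟨rfl, rfl⟩
  | setReal => cases h₂; exact ⟨rfl, rfl⟩
  | coin => cases h₂; exact ⟨rfl, rfl⟩
  | seq P Q s s' s'' τ τ' hP hQ ihP ihQ =>
    cases h₂ with
    | seq _ _ _ t _ _ _ gP gQ =>
      obtain ⟨rfl, rfl⟩ := ihP gP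
      obtain ⟨rfl, rfl⟩ := ihQ gQ
      exact ⟨rfl, rfl⟩
  | iteTrue b P Q s s' τ hb hP ih =>
    cases h₂ with
    | iteTrue _ _ _ _ _ _ _ g => obtain ⟨rfl, rfl⟩ := ih g; exact ⟨rfl, rfl⟩
    | iteFalse _ _ _ _ _ _ g _ => exact absurd hb g
  | iteFalse b P Q s s' τ hb hP ih =>
    cases h₂ with
    | iteTrue _ _ _ _ _ _ g _ => exact absurd g hb
    | iteFalse _ _ _ _ _ _ _ g => obtain ⟨rfl, rfl⟩ := ih g; exact ⟨rfl, rfl⟩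
  | whileTrue b P s s' s'' τ τ' hb hP hW ihP ihW =>
    cases h₂ with
    | whileTrue _ _ _ t _ _ _ _ gP gW =>
      obtain ⟨rfl, rfl⟩ := ihP gP
      obtain ⟨rfl, rfl⟩ := ihW gW
      exact ⟨rfl, rfl⟩
    | whileFalse _ _ _ g => exact absurd hb g
  | whileFalse b P s hb =>
    cases h₂ with
    | whileTrue _ _ _ _ _ _ _ g _ _ => exact absurd g hb
    | whileFalse => exact ⟨rfl, rfl⟩

/-- The initial state for an input: the scalar naturals number `0` and `1` hold `n` and `d`, the
array of naturals number `2` holds the coordinates of the points, the scalar real number `0` holds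
`δ`, and all other cells are `0`. -/
noncomputable def inputState {n d : ℕ} (δ : ℝ) (p : Fin n → Fin d → Bool) : State where
  nat := fun a i j l =>
    if l = 0 then
      if a = 0 ∧ i = 0 ∧ j = 0 then n
      else if a = 1 ∧ i = 0 ∧ j = 0 then d
      else if a = 2 then
        if h : i < n ∧ j < d then (p ⟨i, h.1⟩ ⟨j, h.2⟩).toNat else 0
      else 0
    else 0
  real := fun a i j l => if a = 0 ∧ i = 0 ∧ j = 0 ∧ l = 0 then δ else 0
  coins := 0

/-- The graph that a state represents as output: the array of naturals number `3` lists the endpoints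
of its edges number `0, …, n - 2`. -/
def outputGraph (n : ℕ) (s : State) : SimpleGraph (Fin n) :=
  SimpleGraph.fromRel fun u v =>
    ∃ e : ℕ, e + 1 < n ∧ s.nat 3 e 0 0 = (u : ℕ) ∧ s.nat 3 e 1 0 = (v : ℕ)

/-- The running time `(log(nd)/δ²) (nd log_{1+δ} d + n² log log_{1+δ} d)`. -/
noncomputable def timeBound (n d : ℕ) (δ : ℝ) : ℝ :=
  Real.log (n * d) / δ ^ 2 *
    (n * d * Real.logb (1 + δ) d + (n : ℝ) ^ 2 * Real.log (Real.logb (1 + δ) d))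

end HamMST

namespace HamMST

/-! ### The distribution of the distance of two projections -/

/-! Fix two points at Hamming distance `h > 0` and a threshold `t`. A random row sends them to
different bits exactly when it has odd parity on the coordinates where they differ. The expected
sign of this parity factors over these coordinates, so the bits differ with probability `(1 - (1 -
1/(2t))^h) / 2` (`integral_diffSign`). As a function of `h` this increases and equals `C₁ t` at `h =
t`. If `h` is off from `t` by a factor `1 + u` with `u ≤ 1`, it moves away from `C₁ t` by an amount
of order `u` (`C₁_add_le_of_far`, `add_le_C₁_of_near`). The cutoff `C₁ t + δ/30` therefore separates
`h ≤ t` from `h > (1+δ) t` with a margin of order `δ` on both sides, and Hoeffding's inequality over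
the `k` rows makes an error unlikely.

The number of thresholds grows like `log d / δ` and is not bounded in terms of `N`, so equal error
bounds for all thresholds would not suffice. A threshold `m` steps away from `h` has the larger
margin `min (m δ) 1`, up to a constant, and fails with probability at most `N^(-β) 2^(-m)`. These
bounds sum geometrically, whatever the number of thresholds. A union bound over all pairs gives the
good event, on which `Faithful` holds for every pair of distinct points
(`matricesLaw_not_forall_faithful_le`).

The rest of the quality bound is deterministic. On the good event approximate and exact distances
agree up to a factor `1 + δ` in either direction (`approxHam_bounds`). Prim's algorithm is exact for
the approximate weights by the usual exchange argument, and comparing with an exact minimum spanning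
tree loses the factor `1 + δ` twice.

The program tosses each matrix entry once, adds it to the projections of all points and forgets it.
For each pair it finds the approximate distance by binary search over the thresholds, which is the
source of the iterated logarithm, and it then runs Prim's algorithm in quadratic time. Binary search
always finds an index where the test switches. On the good event the test is monotone, so this index
is the first success (`IsCode.decode_eq`). Off the good event the codes may be wrong, but Prim's
algorithm still returns a spanning tree. Different entries use different coins, so the matrices have
the prescribed law (`seedLaw_map_seedMatrices`). -/

/-- The product over the coordinates in which `x` and `y` differ of the signs `(-1)^(a j)`. -/
noncomputable def diffSign {d : ℕ} (x y a : Fin d → Bool) : ℝ :=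
  ∏ j, if a j = true ∧ x j ≠ y j then -1 else 1

/-- A coordinate in which both points equal `1` contributes two signs, which cancel. Hence the
product of the two parity signs only sees the coordinates of disagreement. -/
lemma diffSign_eq_pow_mul_pow {d : ℕ} (x y a : Fin d → Bool) :
    diffSign x y a =
      (-1) ^ (Finset.univ.filter fun j => a j = true ∧ x j = true).card *
      (-1) ^ (Finset.univ.filter fun j => a j = true ∧ y j = true).card := by
  rw [← Finset.prod_const, ← Finset.prod_const, Finset.prod_filter, Finset.prod_filter,
    ← Finset.prod_mul_distrib]
  refine Finset.prod_congr rfl fun j _ => ?_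
  cases a j <;> cases x j <;> cases y j <;> simp

lemma diffSign_eq_one_or {d : ℕ} (x y a : Fin d → Bool) :
    diffSign x y a = 1 ∨ diffSign x y a = -1 := by
  rw [diffSign_eq_pow_mul_pow, ← pow_add]
  exact neg_one_pow_eq_or ℝ _

lemma half_one_sub_diffSign_mem {d : ℕ} (x y a : Fin d → Bool) :
    (1 - diffSign x y a) / 2 ∈ Set.Icc (0 : ℝ) 1 := by
  rcases diffSign_eq_one_or x y a with h | h <;> rw [h] <;> norm_num

/-- The bits of a row disagree iff the product of their parity signs is `-1`. This writes the
distance as a sum of functions of the single rows, which are independent and identically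
distributed. -/
lemma hammingDist_proj_eq_sum {k d : ℕ} (A : Fin k → Fin d → Bool) (x y : Fin d → Bool) :
    (hammingDist (proj A x) (proj A y) : ℝ) = ∑ r, (1 - diffSign x y (A r)) / 2 := by
  rw [hammingDist, Finset.card_filter, Nat.cast_sum]
  refine Finset.sum_congr rfl fun r _ => ?_
  rw [diffSign_eq_pow_mul_pow, proj, proj]
  rcases Nat.even_or_odd (Finset.univ.filter fun j => A r j = true ∧ x j = true).card with hx | hx <;>
  rcases Nat.even_or_odd (Finset.univ.filter fun j => A r j = true ∧ y j = true).card with hy | hy <;>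
  simp only [hx.neg_one_pow, hy.neg_one_pow, ← Nat.not_even_iff_odd, hx, hy] <;> norm_num

/-- The law of one row of a random matrix whose entries equal `1` with probability `b`. -/
noncomputable def rowLaw (d : ℕ) (b : unitInterval) : Measure (Fin d → Bool) :=
  Measure.pi fun _ => bernoulliMeasure true false b

instance (d : ℕ) (b : unitInterval) : IsProbabilityMeasure (rowLaw d b) := by
  unfold rowLaw; infer_instance

/-- Independence of the entries turns the expectation of the product into a product, where each
coordinate of disagreement contributes `(1 - b) - b`. -/
lemma integral_diffSign {d : ℕ} (b : unitInterval) (x y : Fin d → Bool) :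
    ∫ a, diffSign x y a ∂(rowLaw d b) = (1 - 2 * (b : ℝ)) ^ hammingDist x y := by
  unfold diffSign rowLaw
  rw [integral_fintype_prod_eq_prod
    (f := fun j (v : Bool) => if v = true ∧ x j ≠ y j then (-1 : ℝ) else 1)]
  simp only [integral_bernoulliMeasure]
  rw [hammingDist, ← Finset.prod_const, Finset.prod_filter]
  refine Finset.prod_congr rfl fun j _ => ?_
  by_cases h : x j = y j
  · simp [h]
  · simp [h]; ring

lemma integral_half_one_sub_diffSign {d : ℕ} (b : unitInterval) (x y : Fin d → Bool) :
    ∫ a, (1 - diffSign x y a) / 2 ∂(rowLaw d b) =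
      (1 - (1 - 2 * (b : ℝ)) ^ hammingDist x y) / 2 := by
  rw [integral_div, integral_sub .of_finite .of_finite, integral_diffSign]
  simp

/-- Hoeffding's inequality for independent copies of a variable with values in `[0,1]`. -/
lemma measureReal_pi_sum_ge_le {Ω : Type*} [Finite Ω] [MeasurableSpace Ω]
    [MeasurableSingletonClass Ω] (μ : Measure Ω) [IsProbabilityMeasure μ] (f : Ω → ℝ)
    (hf : ∀ a, f a ∈ Set.Icc (0 : ℝ) 1) (k : ℕ) {g : ℝ} (hg : 0 ≤ g) :
    (Measure.pi fun _ : Fin k => μ).real {A | (∫ a, f a ∂μ + g) * k ≤ ∑ r, f (A r)}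
      ≤ Real.exp (-(2 * k * g ^ 2)) := by
  have hm : Measurable f := measurable_of_finite f
  have h1 : HasSubgaussianMGF (fun a => f a - ∫ a, f a ∂μ) ((‖(1 : ℝ) - 0‖₊ / 2) ^ 2) μ :=
    hasSubgaussianMGF_of_mem_Icc hm.aemeasurable (Filter.Eventually.of_forall hf)
  have hind : iIndepFun (fun (r : Fin k) (A : Fin k → Ω) => f (A r) - ∫ a, f a ∂μ)
      (Measure.pi fun _ : Fin k => μ) :=
    iIndepFun_pi (X := fun _ a => f a - ∫ a, f a ∂μ) fun _ => (hm.sub_const _).aemeasurable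
  have hsub : ∀ r ∈ (Finset.univ : Finset (Fin k)),
      HasSubgaussianMGF (fun A : Fin k → Ω => f (A r) - ∫ a, f a ∂μ)
        ((‖(1 : ℝ) - 0‖₊ / 2) ^ 2) (Measure.pi fun _ : Fin k => μ) := by
    intro r _
    have hmap : Measure.map (fun A : Fin k → Ω => A r) (Measure.pi fun _ : Fin k => μ) = μ :=
      (measurePreserving_eval (fun _ : Fin k => μ) r).map_eq
    refine HasSubgaussianMGF.of_map (Y := fun A : Fin k → Ω => A r)
      (X := fun a => f a - ∫ a, f a ∂μ) (measurable_pi_apply r).aemeasurable ?_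
    rw [hmap]; exact h1
  have := HasSubgaussianMGF.measure_sum_ge_le_of_iIndepFun hind hsub (ε := g * k) (by positivity)
  convert this using 2
  · ext A
    simp only [Set.mem_ofPred_eq, Finset.sum_sub_distrib, Finset.sum_const, Finset.card_univ,
      Fintype.card_fin, nsmul_eq_mul]
    constructor <;> intro h <;> linarith
  -- The variance proxies `1/4` add up to `k/4`, so the exponent is `(g k)² / (2 · k/4) = 2 k g²`.
  -- For `k = 0` the quotient has a zero denominator and both sides are trivial.
  · rcases Nat.eq_zero_or_pos k with rfl | hk
    · simp
    · have : (k : ℝ) ≠ 0 := by positivity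
      simp
      field_simp

/-- The lower tail of `f` is the upper tail of `1 - f`. -/
lemma measureReal_pi_sum_le_le {Ω : Type*} [Finite Ω] [MeasurableSpace Ω]
    [MeasurableSingletonClass Ω] (μ : Measure Ω) [IsProbabilityMeasure μ] (f : Ω → ℝ)
    (hf : ∀ a, f a ∈ Set.Icc (0 : ℝ) 1) (k : ℕ) {g : ℝ} (hg : 0 ≤ g) :
    (Measure.pi fun _ : Fin k => μ).real {A | ∑ r, f (A r) ≤ (∫ a, f a ∂μ - g) * k}
      ≤ Real.exp (-(2 * k * g ^ 2)) := by
  have := measureReal_pi_sum_ge_le μ (fun a => 1 - f a)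
    (fun a => ⟨by linarith [(hf a).2], by linarith [(hf a).1]⟩) k hg
  rw [integral_sub .of_finite .of_finite] at this
  convert this using 4
  simp
  constructor <;> intro h <;> linarith

lemma measureReal_rowLaw_hammingDist_ge_le {d k : ℕ} (b : unitInterval) (x y : Fin d → Bool)
    {g v : ℝ} (hg : 0 ≤ g) (hv : (1 - (1 - 2 * (b : ℝ)) ^ hammingDist x y) / 2 + g ≤ v) :
    (Measure.pi fun _ : Fin k => rowLaw d b).real
      {A | v * k ≤ (hammingDist (proj A x) (proj A y) : ℝ)} ≤ Real.exp (-(2 * k * g ^ 2)) := by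
  have := measureReal_pi_sum_ge_le (rowLaw d b) (fun a => (1 - diffSign x y a) / 2)
    (half_one_sub_diffSign_mem x y) k hg
  refine le_trans (measureReal_mono fun A hA => ?_) this
  simp only [Set.mem_ofPred_eq, hammingDist_proj_eq_sum, integral_half_one_sub_diffSign] at hA ⊢
  exact le_trans (mul_le_mul_of_nonneg_right hv (Nat.cast_nonneg k)) hA

lemma measureReal_rowLaw_hammingDist_le_le {d k : ℕ} (b : unitInterval) (x y : Fin d → Bool)
    {g v : ℝ} (hg : 0 ≤ g) (hv : v + g ≤ (1 - (1 - 2 * (b : ℝ)) ^ hammingDist x y) / 2) :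
    (Measure.pi fun _ : Fin k => rowLaw d b).real
      {A | (hammingDist (proj A x) (proj A y) : ℝ) ≤ v * k} ≤ Real.exp (-(2 * k * g ^ 2)) := by
  have := measureReal_pi_sum_le_le (rowLaw d b) (fun a => (1 - diffSign x y a) / 2)
    (half_one_sub_diffSign_mem x y) k hg
  refine le_trans (measureReal_mono fun A hA => ?_) this
  simp only [Set.mem_ofPred_eq, hammingDist_proj_eq_sum, integral_half_one_sub_diffSign] at hA ⊢
  exact le_trans hA (mul_le_mul_of_nonneg_right (by linarith) (Nat.cast_nonneg k))

/-! ### The gap between near and far pairs -/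

/-- A consequence of `1 + x ≤ exp x`. It makes the gap in the difference probabilities linear in the
relative error of the distance. -/
lemma div_one_add_le_one_sub_exp_neg {x : ℝ} (hx : 0 ≤ x) : x / (1 + x) ≤ 1 - Real.exp (-x) := by
  have h1 : 1 + x ≤ Real.exp x := by linarith [Real.add_one_le_exp x]
  have h2 : Real.exp (-x) ≤ (1 + x)⁻¹ := by
    rw [Real.exp_neg]; exact inv_anti₀ (by linarith) h1
  have h3 : x / (1 + x) = 1 - (1 + x)⁻¹ := by field_simp; ring
  linarith

/-- Bernoulli's inequality. It says that the difference probability is not yet saturated at distance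
`t`, so that a further change of the distance remains visible. -/
lemma half_le_rpow_self {t : ℝ} (ht : 1 ≤ t) : 1 / 2 ≤ (1 - 1 / (2 * t)) ^ t := by
  have h0 : 1 / (2 * t) ≤ 1 := by rw [div_le_one (by linarith)]; linarith
  have := one_add_mul_self_le_rpow_one_add (s := -(1 / (2 * t))) (by linarith) ht
  rw [← sub_eq_add_neg] at this
  refine le_trans (le_of_eq ?_) this
  field_simp
  norm_num

lemma rpow_le_exp_neg {t v : ℝ} (ht : 1 ≤ t) (hv : 0 ≤ v) :
    (1 - 1 / (2 * t)) ^ (t * v) ≤ Real.exp (-(v / 2)) := by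
  have h0 : 1 / (2 * t) ≤ 1 := by rw [div_le_one (by linarith)]; linarith
  have h1 : 1 - 1 / (2 * t) ≤ Real.exp (-(1 / (2 * t))) := Real.one_sub_le_exp_neg _
  calc (1 - 1 / (2 * t)) ^ (t * v) ≤ (Real.exp (-(1 / (2 * t)))) ^ (t * v) :=
        Real.rpow_le_rpow (by linarith) h1 (by positivity)
    _ = Real.exp (-(v / 2)) := by
        rw [← Real.exp_mul]; congr 1; field_simp

lemma base_pos {t : ℝ} (ht : 1 ≤ t) : 0 < 1 - 1 / (2 * t) := by
  have : 1 / (2 * t) < 1 := by rw [div_lt_one (by linarith)]; linarith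
  linarith

lemma base_le_one {t : ℝ} (ht : 1 ≤ t) : 1 - 1 / (2 * t) ≤ 1 := by
  have : 0 ≤ 1 / (2 * t) := by positivity
  linarith

/-- The difference probability of a far pair exceeds `C₁`. -/
lemma C₁_add_le_of_far {t h u : ℝ} (ht : 1 ≤ t) (hu0 : 0 ≤ u) (hu1 : u ≤ 1)
    (hh : t * (1 + u) ≤ h) : C₁ t + u / 12 ≤ (1 - (1 - 1 / (2 * t)) ^ h) / 2 := by
  have hq := base_pos ht
  -- With `q = 1 - 1/(2t)`, the gap is at least `q^t (1 - q^(t u)) / 2 ≥ (1/4) (1 - exp (-u/2)) ≥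
  -- (1/4) (u/3)`.
  have h1 : (1 - 1 / (2 * t)) ^ h ≤
      (1 - 1 / (2 * t)) ^ t * (1 - 1 / (2 * t)) ^ (t * u) := by
    rw [← Real.rpow_add hq]
    exact Real.rpow_le_rpow_of_exponent_ge hq (base_le_one ht) (by linarith)
  have h2 := half_le_rpow_self ht
  have h3 := rpow_le_exp_neg ht hu0
  have h4 := div_one_add_le_one_sub_exp_neg (x := u / 2) (by positivity)
  have h5 : u / 3 ≤ u / 2 / (1 + u / 2) := by
    rw [div_le_div_iff₀ (by norm_num) (by positivity)]; nlinarith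
  unfold C₁
  nlinarith

/-- The difference probability of a near pair is smaller than `C₁`. -/
lemma add_le_C₁_of_near {t h u : ℝ} (ht : 1 ≤ t) (hu0 : 0 ≤ u) (hu1 : u ≤ 1)
    (hh : h * (1 + u) ≤ t) : (1 - (1 - 1 / (2 * t)) ^ h) / 2 + u / 20 ≤ C₁ t := by
  have hq := base_pos ht
  -- For `0 ≤ u ≤ 1` one has `1 / (1 + u) ≤ 1 - u/2`. The relative saving is thus only `u/2`, and
  -- the gap becomes `(1/4) (1 - exp (-u/4)) ≥ (1/4) (u/5)`.
  have hth : t * (u / 2) ≤ t - h := by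
    have h0 : h * (1 + u) ≤ t * (1 - u / 2) * (1 + u) := by nlinarith [mul_nonneg hu0 (sub_nonneg.2 hu1)]
    have := le_of_mul_le_mul_right h0 (by linarith)
    linarith
  have h1 : (1 - 1 / (2 * t)) ^ t ≤
      (1 - 1 / (2 * t)) ^ h * (1 - 1 / (2 * t)) ^ (t * (u / 2)) := by
    rw [← Real.rpow_add hq]
    exact Real.rpow_le_rpow_of_exponent_ge hq (base_le_one ht) (by linarith)
  have h2 := half_le_rpow_self ht
  have h2' : (1 - 1 / (2 * t)) ^ t ≤ (1 - 1 / (2 * t)) ^ h :=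
    Real.rpow_le_rpow_of_exponent_ge hq (base_le_one ht) (by nlinarith)
  have h3 := rpow_le_exp_neg ht (v := u / 2) (by positivity)
  have h4 := div_one_add_le_one_sub_exp_neg (x := u / 2 / 2) (by positivity)
  have h5 : u / 5 ≤ u / 2 / 2 / (1 + u / 2 / 2) := by
    rw [div_le_div_iff₀ (by norm_num) (by positivity)]; nlinarith
  unfold C₁
  nlinarith

/-! ### The projections are faithful with high probability -/

/-- The projections tell for every threshold whether the distance of `x` and `y` is at most the
threshold or more than `1 + δ` times the threshold, and those for the first threshold separate
`x` and `y`. -/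
def Faithful {k d : ℕ} {δ : ℝ} (F : Matrices k d δ) (x y : Fin d → Bool) : Prop :=
  (∀ l : Fin (lastIdx d δ + 1),
    ((1 + δ) ^ ((l : ℕ) + 1) < (hammingDist x y : ℝ) → ¬ Passes F l x y) ∧
    ((hammingDist x y : ℝ) ≤ (1 + δ) ^ (l : ℕ) → Passes F l x y)) ∧
  proj (F 0) x ≠ proj (F 0) y

/-- The projection to the unit interval is inactive for `δ > 0`, because the value is then at most
`1/4`. -/
noncomputable def bias (δ : ℝ) (l : ℕ) : unitInterval :=
  Set.projIcc (0 : ℝ) 1 zero_le_one (1 / (4 * (1 + δ) ^ l))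

lemma matricesLaw_eq (k d : ℕ) (δ : ℝ) :
    matricesLaw k d δ = Measure.pi fun l : Fin (lastIdx d δ + 1) => Measure.pi fun _ => rowLaw d (bias δ l) := rfl

instance (k d : ℕ) (δ : ℝ) : IsProbabilityMeasure (matricesLaw k d δ) := by
  rw [matricesLaw_eq]; infer_instance

lemma one_le_threshold {δ : ℝ} (hδ : 0 < δ) (l : ℕ) : 1 ≤ (1 + δ) ^ l :=
  one_le_pow₀ (by linarith)

lemma coe_bias {δ : ℝ} (hδ : 0 < δ) (l : ℕ) : (bias δ l : ℝ) = 1 / (4 * (1 + δ) ^ l) := by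
  have := one_le_threshold hδ l
  rw [bias, Set.projIcc_of_mem _ (x := 1 / (4 * (1 + δ) ^ l))]
  refine ⟨by positivity, ?_⟩
  rw [div_le_one (by positivity)]
  linarith

lemma one_sub_two_mul_bias {δ : ℝ} (hδ : 0 < δ) (l : ℕ) :
    1 - 2 * (bias δ l : ℝ) = 1 - 1 / (2 * (1 + δ) ^ l) := by
  have := one_le_threshold hδ l
  rw [coe_bias hδ]; field_simp; ring

lemma matricesLaw_real_eval {k d : ℕ} {δ : ℝ} (l : Fin (lastIdx d δ + 1))
    (S : Set (Fin k → Fin d → Bool)) :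
    (matricesLaw k d δ).real {F | F l ∈ S} =
      (Measure.pi fun _ : Fin k => rowLaw d (bias δ l)).real S := by
  have := (measurePreserving_eval
    (fun l : Fin (lastIdx d δ + 1) => Measure.pi fun _ : Fin k => rowLaw d (bias δ l)) l)
  exact this.measureReal_preimage (Set.toFinite S).measurableSet.nullMeasurableSet

/-- The first threshold is `1` and its entries have bias `1/4`, so a row separates distinct points
with probability at least `(1 - 1/2)/2 = 1/4`. Equal projections mean that the distance is `0`, a
deviation by `1/4` per row. -/
lemma matricesLaw_real_proj_eq_le {k d : ℕ} {δ : ℝ} (hδ : 0 < δ) {x y : Fin d → Bool}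
    (hxy : x ≠ y) :
    (matricesLaw k d δ).real {F | proj (F 0) x = proj (F 0) y} ≤ Real.exp (-(k / 8)) := by
  have h1 : 1 ≤ hammingDist x y := hammingDist_pos.2 hxy
  have key := measureReal_rowLaw_hammingDist_le_le (k := k) (bias δ 0) x y (g := 1 / 4) (v := 0)
    (by norm_num) (by
      rw [one_sub_two_mul_bias hδ]
      have : ((1 : ℝ) - 1 / (2 * (1 + δ) ^ 0)) ^ hammingDist x y ≤ (1 / 2) ^ 1 := by
        norm_num
        calc ((1 : ℝ) / 2) ^ hammingDist x y ≤ (1 / 2) ^ 1 :=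
              pow_le_pow_of_le_one (by norm_num) (by norm_num) h1
          _ = 1 / 2 := by norm_num
      linarith)
  have h2 := matricesLaw_real_eval (k := k) (d := d) (δ := δ) 0
    {A | (hammingDist (proj A x) (proj A y) : ℝ) ≤ 0 * k}
  calc _ = (matricesLaw k d δ).real {F | F 0 ∈ {A : Fin k → Fin d → Bool |
          (hammingDist (proj A x) (proj A y) : ℝ) ≤ 0 * k}} := by
        congr 1; ext F; simp
    _ ≤ _ := by
        rw [h2]; refine key.trans (le_of_eq ?_); congr 1; ring

/-- Here `a` is the index of the first threshold that reaches the distance, and the truncated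
differences add up to `|a - l|`. The bound improves with `|a - l|`, because the distance is then off
from the threshold by many factors `1 + δ`; Bernoulli's inequality makes this at least linear. The
cap at `1` is the range in which the gap estimates hold. -/
lemma matricesLaw_real_not_faithful_at_le {k d : ℕ} {δ : ℝ} (hδ : 0 < δ) (hδ' : δ < 1 / 2)
    {x y : Fin d → Bool} (a : ℕ) (ha : (hammingDist x y : ℝ) ≤ (1 + δ) ^ a)
    (ha' : ∀ l < a, (1 + δ) ^ l < (hammingDist x y : ℝ)) (l : Fin (lastIdx d δ + 1)) :
    (matricesLaw k d δ).real
      {F | ¬ (((1 + δ) ^ ((l : ℕ) + 1) < (hammingDist x y : ℝ) → ¬ Passes F l x y) ∧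
        ((hammingDist x y : ℝ) ≤ (1 + δ) ^ (l : ℕ) → Passes F l x y))} ≤
    Real.exp (-(k * (min ((((a - l) + (l - a) + 1 : ℕ) : ℝ) * δ) 1) ^ 2 / 1800)) := by
  set t : ℝ := (1 + δ) ^ (l : ℕ) with ht
  have ht1 : 1 ≤ t := one_le_threshold hδ l
  set h : ℝ := (hammingDist x y : ℝ) with hh
  have hpow : (1 - 2 * (bias δ l : ℝ)) ^ hammingDist x y = (1 - 1 / (2 * t)) ^ h := by
    rw [one_sub_two_mul_bias hδ, hh, Real.rpow_natCast]
  set w : ℝ := (((a - l) + (l - a) + 1 : ℕ) : ℝ) with hw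
  have hw0 : 0 ≤ w := Nat.cast_nonneg _
  set u := min (w * δ) 1 with hu
  have hu0 : 0 ≤ u := le_min (by positivity) zero_le_one
  -- Both cases below leave a margin of at least `u / 60` between mean and cutoff, and `2 / 60² = 1
  -- / 1800`.
  have hexp : Real.exp (-(2 * k * (u / 60) ^ 2)) = Real.exp (-(k * u ^ 2 / 1800)) := by
    congr 1; ring
  have bern : ∀ m : ℕ, 1 + m * δ ≤ (1 + δ) ^ m := fun m =>
    one_add_mul_le_pow (by linarith) m
  by_cases hfar : (1 + δ) ^ ((l : ℕ) + 1) < h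
  · have hla : (l : ℕ) + 1 < a := (pow_lt_pow_iff_right₀ (by linarith)).1 (hfar.trans_le ha)
    -- Far case: the distance exceeds `t (1 + δ)^(m + 1)`, while `w = m + 3`. With `u' = min ((m +
    -- 1) δ) 1` one has `u ≤ 3 u'` and `δ ≤ u'`, so the margin is at least `u'/12 - δ/30 ≥ u'/20 ≥
    -- u/60`.
    obtain ⟨m, hm⟩ : ∃ m, a = l + m + 2 := ⟨a - l - 2, by omega⟩
    have hwm : w = m + 3 := by
      rw [hw, hm]; norm_cast; omega
    have hgt : t * (1 + δ) ^ (m + 1) < h := by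
      rw [ht, ← pow_add]; exact ha' _ (by omega)
    have hu1 : u / 3 ≤ min ((m + 1 : ℕ) * δ) 1 := by
      rw [hu, hwm]
      refine le_min ?_ ?_
      · have := min_le_left (((m : ℝ) + 3) * δ) 1
        push_cast
        nlinarith [mul_nonneg (Nat.cast_nonneg (α := ℝ) m) hδ.le]
      · have := min_le_right (((m : ℝ) + 3) * δ) 1
        linarith
    have hδu : δ ≤ min ((m + 1 : ℕ) * δ) 1 := by
      refine le_min ?_ (by linarith)
      push_cast
      nlinarith [mul_nonneg (Nat.cast_nonneg (α := ℝ) m) hδ.le]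
    have key := C₁_add_le_of_far (t := t) (h := h) (u := min ((m + 1 : ℕ) * δ) 1) ht1
      (hδ.le.trans hδu) (min_le_right _ _) (by
        refine le_trans ?_ hgt.le
        refine mul_le_mul_of_nonneg_left ?_ (by linarith)
        exact le_trans (by linarith [min_le_left (((m + 1 : ℕ) : ℝ) * δ) 1]) (bern (m + 1)))
    have := measureReal_rowLaw_hammingDist_le_le (k := k) (bias δ l) x y (g := u / 60)
      (v := C₁ t + δ / 30) (by positivity) (by rw [hpow]; linarith)
    rw [← matricesLaw_real_eval l, hexp] at this
    refine le_trans (measureReal_mono fun F hF => ?_) this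
    simp only [Set.mem_ofPred_eq, not_and_or, not_forall, not_not] at hF ⊢
    rcases hF with ⟨-, hF⟩ | ⟨hle, -⟩
    · exact hF
    · exfalso
      have : t ≤ (1 + δ) ^ ((l : ℕ) + 1) := pow_le_pow_right₀ (by linarith) (by omega)
      linarith
  by_cases hnear : h ≤ t
  · have hal : a ≤ l := by
      by_contra hcon
      exact absurd (ha' l (by omega)) (not_lt.2 hnear)
    -- Near case: now `w = m + 1`, and `m = 0` is possible, where the distance may equal the
    -- threshold and only the summand `δ/30` of the cutoff gives a margin. In general the margin is
    -- at least `min (m δ) 1 / 20 + δ/30 ≥ u/60`.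
    obtain ⟨m, hm⟩ : ∃ m, (l : ℕ) = a + m := ⟨l - a, by omega⟩
    have hwm : w = m + 1 := by
      rw [hw, hm]; norm_cast; omega
    have key := add_le_C₁_of_near (t := t) (h := h) (u := min (m * δ) 1) ht1
      (le_min (by positivity) zero_le_one) (min_le_right _ _) (by
        rw [ht, hm, pow_add]
        refine mul_le_mul ha ?_ (by positivity) (by positivity)
        exact le_trans (by linarith [min_le_left ((m : ℝ) * δ) 1]) (bern m))
    have hum : u ≤ min (m * δ) 1 + δ := by
      rw [← min_add_add_right, hu, hwm]
      exact min_le_min (by linarith) (by linarith)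
    have := measureReal_rowLaw_hammingDist_ge_le (k := k) (bias δ l) x y (g := u / 60)
      (v := C₁ t + δ / 30) (by positivity) (by
        have : 0 ≤ min ((m : ℝ) * δ) 1 := le_min (by positivity) zero_le_one
        rw [hpow]; linarith)
    rw [← matricesLaw_real_eval l, hexp] at this
    refine le_trans (measureReal_mono fun F hF => ?_) this
    simp only [Set.mem_ofPred_eq, not_and_or, not_forall, not_not] at hF ⊢
    rcases hF with ⟨hlt, -⟩ | ⟨-, hF⟩
    · exact absurd hlt hfar
    · unfold Passes at hF
      exact (not_le.1 hF).le
  -- Between `t` and `(1 + δ) t` either answer of the test is allowed.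
  · have : {F : Matrices k d δ | ¬ (((1 + δ) ^ ((l : ℕ) + 1) < h → ¬ Passes F l x y) ∧
        (h ≤ t → Passes F l x y))} = ∅ := by
      ext F; simp [hfar, hnear]
    rw [this, measureReal_empty]
    positivity

lemma le_pow_lastIdx {d : ℕ} {δ : ℝ} (hd : 1 ≤ d) (hδ : 0 < δ) :
    (d : ℝ) ≤ (1 + δ) ^ lastIdx d δ := by
  have hd' : (0 : ℝ) < d := by exact_mod_cast hd
  rw [← Real.rpow_natCast, ← Real.logb_le_iff_le_rpow (by linarith) hd']
  exact Nat.le_ceil _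

lemma two_thirds_mul_le_log {δ : ℝ} (hδ : 0 < δ) (hδ' : δ < 1 / 2) :
    2 / 3 * δ ≤ Real.log (1 + δ) := by
  have h := Real.one_sub_inv_le_log_of_pos (x := 1 + δ) (by linarith)
  have : 1 - (1 + δ)⁻¹ = δ / (1 + δ) := by field_simp; ring
  rw [this] at h
  refine le_trans ?_ h
  rw [le_div_iff₀ (by linarith)]
  nlinarith

/-- This limits how far a threshold can be from the true distance. It is needed where the cap at `1`
stops the error exponent from growing with the number of steps. -/
lemma lastIdx_le {d : ℕ} {δ : ℝ} (hd : 1 ≤ d) (hδ : 0 < δ) (hδ' : δ < 1 / 2) :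
    (lastIdx d δ : ℝ) ≤ 3 / 2 * Real.log d / δ + 1 := by
  have h1 : 0 ≤ Real.log d := Real.log_natCast_nonneg d
  have h2 := two_thirds_mul_le_log hδ hδ'
  have h3 : Real.logb (1 + δ) d ≤ 3 / 2 * Real.log d / δ := by
    rw [Real.logb, div_le_div_iff₀ (by linarith) hδ]
    nlinarith
  have h4 : 0 ≤ Real.logb (1 + δ) d :=
    Real.logb_nonneg (by linarith) (by exact_mod_cast hd)
  exact (Nat.ceil_lt_add_one h4).le.trans (by linarith)

/-- The factor `2^(-m)` is what makes the errors of all thresholds summable. As long as `m δ ≤ 1`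
the exponent is at least `K m² log N`, which dominates `m log 2`. Beyond that it stays at `K log N /
δ²`, but `m` is itself at most of order `log N / δ`. -/
lemma exp_neg_le_rpow_mul_pow {N δ k K β : ℝ} {m : ℕ} (hN : 2 ≤ N) (hδ : 0 < δ) (hδ' : δ < 1 / 2)
    (hβ : 0 ≤ β) (hK : β + 6 ≤ K) (hk : 1800 * K * Real.log N / δ ^ 2 ≤ k) (hm : 1 ≤ m)
    (hm' : (m : ℝ) ≤ 3 / 2 * Real.log N / δ + 2) :
    Real.exp (-(k * (min (m * δ) 1) ^ 2 / 1800)) ≤ N ^ (-β) * (1 / 2) ^ m := by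
  have hlog2 : 0.69 < Real.log 2 := by linarith [Real.log_two_gt_d9]
  have hlog2' : Real.log 2 < 0.7 := by linarith [Real.log_two_lt_d9]
  have hΛ : Real.log 2 ≤ Real.log N := Real.log_le_log (by norm_num) hN
  set Λ := Real.log N with hΛdef
  have hm1 : (1 : ℝ) ≤ m := by exact_mod_cast hm
  have heq : N ^ (-β) * (1 / 2) ^ m = Real.exp (-(β * Λ + m * Real.log 2)) := by
    rw [Real.rpow_def_of_pos (by linarith), ← Real.rpow_natCast,
      Real.rpow_def_of_pos (by norm_num), ← Real.exp_add, one_div, Real.log_inv]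
    congr 1; ring
  rw [heq]
  refine Real.exp_le_exp.2 (neg_le_neg ?_)
  rw [div_le_iff₀ (by positivity)] at hk
  have hKΛ : (β + 6) * Λ ≤ K * Λ := mul_le_mul_of_nonneg_right hK (by linarith)
  rcases le_total ((m : ℝ) * δ) 1 with h | h
  · rw [min_eq_left h]
    have h1 : K * Λ * (m : ℝ) ^ 2 ≤ k * (m * δ) ^ 2 / 1800 := by
      have := mul_le_mul_of_nonneg_right hk (sq_nonneg (m : ℝ))
      field_simp at this ⊢
      linarith
    have h2 : (β + 6) * Λ * m ≤ K * Λ * (m : ℝ) ^ 2 := by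
      have : (m : ℝ) ≤ m ^ 2 := by nlinarith
      have h0 : 0 ≤ (β + 6) * Λ := mul_nonneg (by linarith) (by linarith)
      calc (β + 6) * Λ * m ≤ (β + 6) * Λ * m ^ 2 := mul_le_mul_of_nonneg_left this h0
        _ ≤ _ := mul_le_mul_of_nonneg_right hKΛ (by positivity)
    have h3 : β * Λ ≤ β * Λ * m := le_mul_of_one_le_right (mul_nonneg hβ (by linarith)) hm1
    have h4 : (m : ℝ) * Real.log 2 ≤ m * Λ := mul_le_mul_of_nonneg_left hΛ (by linarith)
    nlinarith
  · rw [min_eq_right h]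
    have hk2 : K * Λ / δ ^ 2 ≤ k * 1 ^ 2 / 1800 := by
      rw [div_le_div_iff₀ (by positivity) (by norm_num)]
      linarith
    refine le_trans ?_ hk2
    rw [le_div_iff₀ (by positivity)]
    have h1 : (m : ℝ) * Real.log 2 ≤ 3 / 2 * Λ / δ + 3 * Λ := by
      have : (m : ℝ) * Real.log 2 ≤ m * 1 := mul_le_mul_of_nonneg_left (by linarith) (by linarith)
      linarith
    have h2 : 3 / 2 * Λ / δ * δ ^ 2 = 3 / 2 * Λ * δ := by field_simp
    have h3 : (β * Λ + m * Real.log 2) * δ ^ 2 ≤ β * Λ * δ ^ 2 + (3 / 2 * Λ * δ + 3 * Λ * δ ^ 2) := by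
      have := mul_le_mul_of_nonneg_right h1 (sq_nonneg δ)
      nlinarith
    have hΛ0 : 0 ≤ Λ := by linarith
    have h4 : δ ^ 2 ≤ 1 := by nlinarith
    have h5 : β * Λ * δ ^ 2 ≤ β * Λ := mul_le_of_le_one_right (mul_nonneg hβ hΛ0) h4
    have h6 : Λ * δ ≤ Λ := mul_le_of_le_one_right hΛ0 (by linarith)
    have h7 : Λ * δ ^ 2 ≤ Λ := mul_le_of_le_one_right hΛ0 h4
    linarith

lemma sum_range_half_pow_le (M : ℕ) : ∑ l ∈ Finset.range M, (1 / 2 : ℝ) ^ (l + 1) ≤ 1 := by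
  have : ∑ l ∈ Finset.range M, (1 / 2 : ℝ) ^ (l + 1) = 1 - (1 / 2) ^ M := by
    induction M with
    | zero => simp
    | succ M ih => rw [Finset.sum_range_succ, ih]; ring
  rw [this]
  have : (0 : ℝ) ≤ (1 / 2) ^ M := by positivity
  linarith

/-- Two geometric series, one on each side of `a`. The bound does not depend on the number of
thresholds. -/
lemma sum_half_pow_dist_le (a M : ℕ) :
    ∑ l : Fin M, (1 / 2 : ℝ) ^ ((a - l) + (l - a) + 1 : ℕ) ≤ 2 := by
  rw [Fin.sum_univ_eq_sum_range (fun l => (1 / 2 : ℝ) ^ ((a - l) + (l - a) + 1 : ℕ)) M]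
  calc ∑ l ∈ Finset.range M, (1 / 2 : ℝ) ^ ((a - l) + (l - a) + 1 : ℕ)
      ≤ ∑ l ∈ Finset.range (a + M), (1 / 2 : ℝ) ^ ((a - l) + (l - a) + 1 : ℕ) :=
        Finset.sum_le_sum_of_subset_of_nonneg (Finset.range_mono (by omega))
          fun _ _ _ => by positivity
    _ ≤ ∑ l ∈ Finset.range a, (1 / 2 : ℝ) ^ (l + 1) + ∑ l ∈ Finset.range M, (1 / 2 : ℝ) ^ (l + 1) := by
        rw [Finset.sum_range_add, ← Finset.sum_range_reflect (fun l => (1 / 2 : ℝ) ^ (l + 1)) a]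
        refine add_le_add (Finset.sum_le_sum fun l hl => ?_) (Finset.sum_le_sum fun l _ => ?_)
        · have := Finset.mem_range.1 hl
          exact pow_le_pow_of_le_one (by norm_num) (by norm_num) (by omega)
        · exact pow_le_pow_of_le_one (by norm_num) (by norm_num) (by omega)
    _ ≤ 2 := by linarith [sum_range_half_pow_le a, sum_range_half_pow_le M]

lemma two_le_inputSize {n d : ℕ} (hn : 1 ≤ n) (hd : 1 ≤ d) : (2 : ℝ) ≤ 2 * n * d := by
  have : 1 ≤ n * d := Nat.mul_pos hn hd
  have : (1 : ℝ) ≤ n * d := by exact_mod_cast this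
  linarith

/-- The thresholds contribute `2 N^(-β)` in total, and the separation by the first projection
another `N^(-β)`. -/
lemma matricesLaw_real_not_faithful_le {n d : ℕ} {δ K β : ℝ} (hn : 1 ≤ n) (hd : 1 ≤ d)
    (hδ : 0 < δ) (hδ' : δ < 1 / 2) (hβ : 0 ≤ β) (hK : β + 6 ≤ K) {x y : Fin d → Bool}
    (hxy : x ≠ y) :
    (matricesLaw (sketchDim (1800 * K) n d δ) d δ).real {F | ¬ Faithful F x y} ≤
      3 * (2 * n * d : ℝ) ^ (-β) := by
  classical
  set N : ℝ := 2 * n * d with hN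
  have hN2 : 2 ≤ N := two_le_inputSize hn hd
  have hlog2 : 0.69 < Real.log 2 := by linarith [Real.log_two_gt_d9]
  have hΛ : Real.log 2 ≤ Real.log N := Real.log_le_log (by norm_num) hN2
  have hd0 : (0 : ℝ) < d := by exact_mod_cast hd
  have hdN : Real.log d ≤ Real.log N := by
    refine Real.log_le_log hd0 ?_
    have : (1 : ℝ) ≤ n := by exact_mod_cast hn
    rw [hN]; nlinarith
  set k := sketchDim (1800 * K) n d δ with hk
  have hk' : 1800 * K * Real.log N / δ ^ 2 ≤ k := Nat.le_ceil _
  have hex : ∃ a, (hammingDist x y : ℝ) ≤ (1 + δ) ^ a := ⟨lastIdx d δ, by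
    refine le_trans ?_ (le_pow_lastIdx hd hδ)
    have := hammingDist_le_card_fintype (x := x) (y := y)
    rw [Fintype.card_fin] at this
    exact_mod_cast this⟩
  set a := Nat.find hex with ha
  have haL : a ≤ lastIdx d δ := Nat.find_min' hex (by
    refine le_trans ?_ (le_pow_lastIdx hd hδ)
    have := hammingDist_le_card_fintype (x := x) (y := y)
    rw [Fintype.card_fin] at this
    exact_mod_cast this)
  have hL := lastIdx_le hd hδ hδ'
  have hterm : ∀ l : Fin (lastIdx d δ + 1), (matricesLaw k d δ).real
      {F | ¬ (((1 + δ) ^ ((l : ℕ) + 1) < (hammingDist x y : ℝ) → ¬ Passes F l x y) ∧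
        ((hammingDist x y : ℝ) ≤ (1 + δ) ^ (l : ℕ) → Passes F l x y))} ≤
      N ^ (-β) * (1 / 2 : ℝ) ^ ((a - l) + (l - a) + 1 : ℕ) := by
    intro l
    refine (matricesLaw_real_not_faithful_at_le hδ hδ' a (Nat.find_spec hex)
      (fun l hl => not_le.1 (Nat.find_min hex hl)) l).trans ?_
    refine exp_neg_le_rpow_mul_pow hN2 hδ hδ' hβ hK hk' (by omega) ?_
    have h1 : ((a - l) + (l - a) + 1 : ℕ) ≤ lastIdx d δ + 1 := by omega
    have h2 : (((a - l) + (l - a) + 1 : ℕ) : ℝ) ≤ lastIdx d δ + 1 := by exact_mod_cast h1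
    have h3 : 3 / 2 * Real.log d / δ ≤ 3 / 2 * Real.log N / δ := by gcongr
    linarith
  have heq : (matricesLaw k d δ).real {F | proj (F 0) x = proj (F 0) y} ≤ N ^ (-β) := by
    refine (matricesLaw_real_proj_eq_le hδ hxy).trans ?_
    rw [Real.rpow_def_of_pos (by linarith)]
    refine Real.exp_le_exp.2 ?_
    have h1 : K * Real.log N ≤ 1800 * K * Real.log N / δ ^ 2 / 8 := by
      rw [div_div, le_div_iff₀ (by positivity)]
      have h0 : 0 ≤ K * Real.log N := mul_nonneg (by linarith) (by linarith)
      have h1 : δ ^ 2 ≤ 1 := by nlinarith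
      have := mul_le_of_le_one_right h0 h1
      linarith
    nlinarith
  have hsub : {F : Matrices k d δ | ¬ Faithful F x y} ⊆
      (⋃ l ∈ (Finset.univ : Finset (Fin (lastIdx d δ + 1))),
        {F | ¬ (((1 + δ) ^ ((l : ℕ) + 1) < (hammingDist x y : ℝ) → ¬ Passes F l x y) ∧
        ((hammingDist x y : ℝ) ≤ (1 + δ) ^ (l : ℕ) → Passes F l x y))}) ∪
      {F | proj (F 0) x = proj (F 0) y} := by
    intro F hF
    by_contra hcon
    simp only [Set.mem_union, Set.mem_iUnion, Set.mem_ofPred_eq, not_or, not_exists, not_not,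
      Finset.mem_univ, exists_prop, true_and] at hcon
    exact hF ⟨hcon.1, hcon.2⟩
  calc (matricesLaw k d δ).real {F | ¬ Faithful F x y}
      ≤ _ := measureReal_mono hsub
    _ ≤ _ := measureReal_union_le _ _
    _ ≤ (∑ l : Fin (lastIdx d δ + 1),
          N ^ (-β) * (1 / 2 : ℝ) ^ ((a - l) + (l - a) + 1 : ℕ)) + N ^ (-β) :=
        add_le_add ((measureReal_biUnion_finset_le _ _).trans
          (Finset.sum_le_sum fun l _ => hterm l)) heq
    _ ≤ 3 * N ^ (-β) := by
        rw [← Finset.mul_sum]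
        have := sum_half_pow_dist_le a (lastIdx d δ + 1)
        have h0 : 0 ≤ N ^ (-β) := Real.rpow_nonneg (by linarith) _
        nlinarith

/-- With high probability the projections are faithful for all pairs of distinct points. -/
theorem matricesLaw_not_forall_faithful_le {n d : ℕ} {δ K α : ℝ} (hn : 1 ≤ n) (hd : 1 ≤ d)
    (hδ : 0 < δ) (hδ' : δ < 1 / 2) (hα : 0 ≤ α) (hK : α + 8 ≤ K) (p : Fin n → Fin d → Bool) :
    matricesLaw (sketchDim (1800 * K) n d δ) d δ
      {F | ¬ ∀ i j, p i ≠ p j → Faithful F (p i) (p j)} ≤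
      ENNReal.ofReal (1 / (2 * n * d : ℝ) ^ α) := by
  classical
  rw [← ofReal_measureReal]
  refine ENNReal.ofReal_le_ofReal ?_
  set N : ℝ := 2 * n * d with hN
  have hN2 : 2 ≤ N := two_le_inputSize hn hd
  set μ := matricesLaw (sketchDim (1800 * K) n d δ) d δ with hμ
  have hsub : {F : Matrices (sketchDim (1800 * K) n d δ) d δ |
      ¬ ∀ i j, p i ≠ p j → Faithful F (p i) (p j)} ⊆
      ⋃ e ∈ (Finset.univ : Finset (Fin n × Fin n)),
        {F | p e.1 ≠ p e.2 ∧ ¬ Faithful F (p e.1) (p e.2)} := by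
    intro F hF
    simp only [Set.mem_ofPred_eq, not_forall] at hF
    obtain ⟨i, j, hij, hF⟩ := hF
    simp only [Set.mem_iUnion]
    exact ⟨(i, j), Finset.mem_univ _, hij, hF⟩
  -- The exponent is raised by `2` to pay for the union over all ordered pairs, since `3 n² ≤ (2 n
  -- d)²`. This is also why `K` has to be `α + 8` rather than `α + 6`.
  have hterm : ∀ e : Fin n × Fin n,
      μ.real {F | p e.1 ≠ p e.2 ∧ ¬ Faithful F (p e.1) (p e.2)} ≤ 3 * N ^ (-(α + 2)) := by
    intro e
    by_cases he : p e.1 = p e.2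
    · simp only [he, ne_eq, not_true_eq_false, false_and]
      rw [show {F : Matrices (sketchDim (1800 * K) n d δ) d δ | False} = ∅ from rfl,
        measureReal_empty]
      have : 0 ≤ N ^ (-(α + 2)) := Real.rpow_nonneg (by linarith) _
      positivity
    · exact (measureReal_mono fun F hF => hF.2).trans
        (matricesLaw_real_not_faithful_le hn hd hδ hδ' (by linarith) (by linarith) he)
  calc _ ≤ _ := measureReal_mono hsub (measure_ne_top _ _)
    _ ≤ _ := measureReal_biUnion_finset_le _ _
    _ ≤ ∑ _e : Fin n × Fin n, 3 * N ^ (-(α + 2)) := Finset.sum_le_sum fun e _ => hterm e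
    _ = 3 * n ^ 2 * N ^ (-(α + 2)) := by simp; ring
    _ ≤ N ^ (2 : ℝ) * N ^ (-(α + 2)) := by
        refine mul_le_mul_of_nonneg_right ?_ (Real.rpow_nonneg (by linarith) _)
        have h1 : (1 : ℝ) ≤ d := by exact_mod_cast hd
        have h0 : (0 : ℝ) ≤ n := Nat.cast_nonneg n
        rw [hN, Real.rpow_two]
        have h2 : (n : ℝ) ≤ n * d := le_mul_of_one_le_right h0 h1
        nlinarith
    _ = 1 / N ^ α := by
        rw [← Real.rpow_add (by linarith), one_div, ← Real.rpow_neg (by linarith)]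
        congr 1; ring

/-! ### Prim's algorithm finds a minimum spanning tree -/

lemma cost_sup_edge {n : ℕ} {w : Fin n → Fin n → ℝ} (hw : ∀ i j, w i j = w j i)
    {T : SimpleGraph (Fin n)} {u v : Fin n} (huv : u ≠ v) (hT : ¬ T.Adj u v) :
    cost w (T ⊔ SimpleGraph.edge u v) = cost w T + w u v := by
  classical
  -- `cost` counts an edge at its increasing pair, so the orientation of the new edge is irrelevant
  -- only by the symmetry of `w`.
  wlog hlt : u < v generalizing u v
  · have := this huv.symm (fun h => hT h.symm) (lt_of_le_of_ne (not_lt.1 hlt) huv.symm)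
    rwa [SimpleGraph.edge_comm, hw v u] at this
  unfold cost
  rw [add_comm, ← Finset.sum_insert (f := fun e : Fin n × Fin n => w e.1 e.2) (a := (u, v)) (by simp [hT])]
  refine Finset.sum_congr ?_ fun _ _ => rfl
  ext ⟨a, b⟩
  simp only [Finset.mem_filter, Finset.mem_univ, true_and, SimpleGraph.sup_adj,
    SimpleGraph.edge_adj, Finset.mem_insert, Prod.mk.injEq]
  constructor
  · rintro ⟨hab, h | ⟨⟨rfl, rfl⟩ | ⟨rfl, rfl⟩, -⟩⟩
    · exact Or.inr ⟨hab, h⟩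
    · exact Or.inl ⟨rfl, rfl⟩
    · exact absurd hab hlt.asymm
  · rintro (⟨rfl, rfl⟩ | ⟨hab, h⟩)
    · exact ⟨hlt, Or.inr ⟨Or.inl ⟨rfl, rfl⟩, huv⟩⟩
    · exact ⟨hab, Or.inl h⟩

lemma cost_le_mul_cost {n : ℕ} {w w' : Fin n → Fin n → ℝ} {a : ℝ}
    (h : ∀ i j, w i j ≤ a * w' i j) (T : SimpleGraph (Fin n)) : cost w T ≤ a * cost w' T := by
  unfold cost
  rw [Finset.mul_sum]
  exact Finset.sum_le_sum fun e _ => h _ _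

/-- Adding an edge across a cut to a tree allows to remove another edge across the cut. -/
lemma exists_isTree_exchange {V : Type*} [Finite V] {U : SimpleGraph V} (hU : U.IsTree)
    {S : Set V} {u v : V} (hu : u ∈ S) (hv : v ∉ S) (huv : ¬ U.Adj u v) :
    ∃ a ∈ S, ∃ b ∉ S, U.Adj a b ∧ ∃ U' : SimpleGraph V, U'.IsTree ∧ ¬ U'.Adj a b ∧
      U' ⊔ SimpleGraph.edge a b = U ⊔ SimpleGraph.edge u v := by
  classical
  have hne : u ≠ v := fun h => hv (h ▸ hu)
  obtain ⟨p, hp⟩ := hU.connected.exists_isPath u v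
  -- The tree path from `u` to `v` crosses the cut somewhere. Together with the new edge it closes
  -- to a cycle, so the crossing edge is no bridge and can be removed without disconnecting the
  -- graph.
  obtain ⟨e, he, heS, heS'⟩ := p.exists_boundary_dart S hu hv
  set G := U ⊔ SimpleGraph.edge u v with hG
  have hUG : U ≤ G := le_sup_left
  have hGvu : G.Adj v u := Or.inr ((SimpleGraph.edge_adj ..).2 ⟨Or.inr ⟨rfl, rfl⟩, hne.symm⟩)
  have hab : U.Adj e.fst e.snd := e.adj
  have hcyc : (SimpleGraph.Walk.cons hGvu (p.mapLe hUG)).IsCycle := by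
    rw [SimpleGraph.Walk.cons_isCycle_iff]
    refine ⟨hp.mapLe hUG, fun h => huv ?_⟩
    rw [SimpleGraph.Walk.edges_mapLe_eq_edges] at h
    exact (p.adj_of_mem_edges h).symm
  have hemem : s(e.fst, e.snd) ∈ (SimpleGraph.Walk.cons hGvu (p.mapLe hUG)).edges := by
    rw [SimpleGraph.Walk.edges_cons, SimpleGraph.Walk.edges_mapLe_eq_edges]
    exact List.mem_cons_of_mem _ (List.mem_map_of_mem (f := SimpleGraph.Dart.edge) he)
  have hnb : ¬ G.IsBridge s(e.fst, e.snd) := fun hb =>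
    hb.notMem_edges_of_isCycle hcyc hemem
  have hGconn : G.Connected := hU.connected.mono hUG
  refine ⟨e.fst, heS, e.snd, heS', hab, G.deleteEdges {s(e.fst, e.snd)}, ?_, ?_, ?_⟩
  -- Connectedness and an unchanged number of edges suffice for a tree.
  · rw [SimpleGraph.isTree_iff_connected_and_card]
    refine ⟨hGconn.connected_delete_edge_of_not_isBridge hnb, ?_⟩
    have hcard := (SimpleGraph.isTree_iff_connected_and_card.1 hU).2
    rw [Nat.card_coe_set_eq] at hcard ⊢
    rw [← hcard, SimpleGraph.edgeSet_deleteEdges, hG, SimpleGraph.edgeSet_sup,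
      SimpleGraph.edgeSet_edge_of_ne hne, Set.union_singleton,
      Set.ncard_sdiff_singleton_of_mem
        (Set.mem_insert_of_mem _ ((SimpleGraph.mem_edgeSet U).2 hab)),
      Set.ncard_insert_of_notMem (by simpa using huv)]
    rfl
  · simp
  · ext x y
    simp only [SimpleGraph.sup_adj, SimpleGraph.deleteEdges_adj, Set.mem_singleton_iff]
    constructor
    · rintro (h | h)
      · exact h.1
      · rw [SimpleGraph.adj_edge] at h
        rw [← SimpleGraph.mem_edgeSet, ← h.1]
        exact hUG hab
    · intro h
      by_cases hxy : s(x, y) = s(e.fst, e.snd)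
      · exact Or.inr ((SimpleGraph.adj_edge ..).2 ⟨hxy.symm, h.ne⟩)
      · exact Or.inl ⟨h, hxy⟩

/-- Used to see that an edge across the cut cannot belong to the partial tree, so that the exchange
never removes an edge already chosen. -/
lemma PrimReach.adj_mem {n : ℕ} {w : Fin n → Fin n → ℝ} {S : Finset (Fin n)}
    {T : SimpleGraph (Fin n)} (h : PrimReach w S T) {a b : Fin n} (hab : T.Adj a b) :
    a ∈ S ∧ b ∈ S := by
  induction h generalizing a b with
  | start r => exact absurd hab (by simp)
  | step S T u v h hu hv hmin ih =>
    rw [SimpleGraph.sup_adj, SimpleGraph.edge_adj] at hab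
    rcases hab with hab | ⟨⟨rfl, rfl⟩ | ⟨rfl, rfl⟩, -⟩
    · exact ⟨Finset.mem_insert_of_mem (ih hab).1, Finset.mem_insert_of_mem (ih hab).2⟩
    · exact ⟨Finset.mem_insert_of_mem hu, Finset.mem_insert_self _ _⟩
    · exact ⟨Finset.mem_insert_self _ _, Finset.mem_insert_of_mem hu⟩

lemma PrimReach.reachable {n : ℕ} {w : Fin n → Fin n → ℝ} {S : Finset (Fin n)}
    {T : SimpleGraph (Fin n)} (h : PrimReach w S T) {a b : Fin n} (ha : a ∈ S) (hb : b ∈ S) :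
    T.Reachable a b := by
  induction h generalizing a b with
  | start r => rw [Finset.mem_singleton.1 ha, Finset.mem_singleton.1 hb]
  | step S T u v h hu hv hmin ih =>
    have hle : T ≤ T ⊔ SimpleGraph.edge u v := le_sup_left
    have huv : (T ⊔ SimpleGraph.edge u v).Adj u v :=
      Or.inr ((SimpleGraph.edge_adj ..).2 ⟨Or.inl ⟨rfl, rfl⟩, fun h => hv (h ▸ hu)⟩)
    have hto : ∀ c ∈ insert v S, (T ⊔ SimpleGraph.edge u v).Reachable u c := by
      intro c hc
      rcases Finset.mem_insert.1 hc with rfl | hc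
      · exact huv.reachable
      · exact (ih hu hc).mono hle
    exact (hto a ha).symm.trans (hto b hb)

lemma PrimReach.nonempty {n : ℕ} {w : Fin n → Fin n → ℝ} {S : Finset (Fin n)}
    {T : SimpleGraph (Fin n)} (h : PrimReach w S T) : S.Nonempty := by
  cases h with
  | start r => exact Finset.singleton_nonempty r
  | step S T u v => exact Finset.insert_nonempty v S

/-- Every tree can be turned into one that contains the tree built so far, at no extra cost. -/
lemma PrimReach.exists_isTree_ge {n : ℕ} {w : Fin n → Fin n → ℝ} (hw : ∀ i j, w i j = w j i)
    {S : Finset (Fin n)} {T : SimpleGraph (Fin n)} (h : PrimReach w S T)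
    {U : SimpleGraph (Fin n)} (hU : U.IsTree) :
    ∃ U' : SimpleGraph (Fin n), U'.IsTree ∧ T ≤ U' ∧ cost w U' ≤ cost w U := by
  induction h with
  | start r => exact ⟨U, hU, bot_le, le_rfl⟩
  | step S T u v h hu hv hmin ih =>
    obtain ⟨U₁, hU₁, hTU₁, hcost⟩ := ih
    have hne : u ≠ v := fun h => hv (h ▸ hu)
    by_cases huv : U₁.Adj u v
    · exact ⟨U₁, hU₁, sup_le hTU₁ ((SimpleGraph.edge_le_iff _).2 (Or.inr huv)), hcost⟩
    obtain ⟨a, ha, b, hb, hab, U₂, hU₂, hab₂, heq⟩ :=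
      exists_isTree_exchange hU₁ (S := (S : Set (Fin n))) (Finset.mem_coe.2 hu)
        (fun h => hv (Finset.mem_coe.1 h)) huv
    have hb' : b ∉ S := fun h => hb (Finset.mem_coe.2 h)
    refine ⟨U₂, hU₂, ?_, ?_⟩
    · intro x y hxy
      have h1 : (U₂ ⊔ SimpleGraph.edge a b).Adj x y := by
        rw [heq]
        rcases hxy with hxy | hxy
        · exact Or.inl (hTU₁ hxy)
        · exact Or.inr hxy
      rcases h1 with h1 | h1
      · exact h1
      exfalso
      -- The removed edge is neither in `T`, whose edges stay inside `S`, nor the new edge, which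
      -- was not in `U₁`.
      rw [SimpleGraph.edge_adj] at h1
      rcases hxy with hxy | hxy
      · have := h.adj_mem hxy
        rcases h1 with ⟨⟨rfl, rfl⟩ | ⟨rfl, rfl⟩, -⟩
        · exact hb' this.2
        · exact hb' this.1
      · rw [SimpleGraph.edge_adj] at hxy
        have : U₁.Adj u v := by
          rcases h1 with ⟨⟨rfl, rfl⟩ | ⟨rfl, rfl⟩, -⟩ <;>
          rcases hxy with ⟨⟨rfl, rfl⟩ | ⟨rfl, rfl⟩, -⟩ <;>
          first | exact hab | exact hab.symm
        exact huv this
    · have h1 := cost_sup_edge hw hne huv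
      have h2 := cost_sup_edge hw hab.ne hab₂
      rw [heq, h1] at h2
      linarith [hmin a (Finset.mem_coe.1 ha) b hb']

/-- The final graph is connected and lies below a tree of no larger cost. A tree is minimal among
connected graphs, so the two coincide; acyclicity needs no separate argument. -/
theorem IsPrimTree.isMinSpanningTree {n : ℕ} {w : Fin n → Fin n → ℝ}
    (hw : ∀ i j, w i j = w j i) {T : SimpleGraph (Fin n)} (h : IsPrimTree w T) :
    IsMinSpanningTree w T := by
  have hreach : PrimReach w Finset.univ T := h
  have hconn : T.Connected :=
    { preconnected := fun a b => hreach.reachable (Finset.mem_univ a) (Finset.mem_univ b)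
      nonempty := ⟨hreach.nonempty.choose⟩ }
  have key : ∀ U : SimpleGraph (Fin n), U.IsTree → T.IsTree ∧ cost w T ≤ cost w U := by
    intro U hU
    obtain ⟨U', hU', hle, hcost⟩ := hreach.exists_isTree_ge hw hU
    have : T = U' :=
      le_antisymm hle ((SimpleGraph.isTree_iff_minimal_connected.1 hU').le_of_le hconn hle)
    exact this ▸ ⟨hU', hcost⟩
  obtain ⟨U, -, hU⟩ := hconn.exists_isTree_le
  exact ⟨(key U hU).1, fun U hU => (key U hU).2⟩

/-! ### Approximate distances -/

lemma hammingDist_le_pow_lastIdx {d : ℕ} {δ : ℝ} (hd : 1 ≤ d) (hδ : 0 < δ)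
    (x y : Fin d → Bool) : (hammingDist x y : ℝ) ≤ (1 + δ) ^ lastIdx d δ := by
  refine le_trans ?_ (le_pow_lastIdx hd hδ)
  have := hammingDist_le_card_fintype (x := x) (y := y)
  rw [Fintype.card_fin] at this
  exact_mod_cast this

/-- A passing test excludes a distance beyond the next threshold. Conversely, the first threshold
that reaches the distance passes, so the selected one is no larger, and the threshold before it is
smaller than the distance. If no test passes, the default is the last threshold, which is at least
`d`. -/
lemma approxHam_bounds {k d : ℕ} {δ : ℝ} (hd : 1 ≤ d) (hδ : 0 < δ) (F : Matrices k d δ)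
    (x y : Fin d → Bool) (hF : x ≠ y → Faithful F x y) :
    (hammingDist x y : ℝ) ≤ (1 + δ) * approxHam F x y ∧
    approxHam F x y ≤ (1 + δ) * (hammingDist x y : ℝ) := by
  classical
  by_cases hxy : x = y
  · simp [approxHam, hxy]
  have hF := hF hxy
  have h1 : (1 : ℝ) ≤ hammingDist x y := by exact_mod_cast hammingDist_pos.2 hxy
  unfold approxHam
  rw [if_neg hxy]
  set A := {m : ℕ | m = lastIdx d δ ∨ ∃ h : m < lastIdx d δ + 1, Passes F ⟨m, h⟩ x y} with hA
  have hex : ∃ a, (hammingDist x y : ℝ) ≤ (1 + δ) ^ a :=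
    ⟨lastIdx d δ, hammingDist_le_pow_lastIdx hd hδ x y⟩
  constructor
  · rcases Nat.sInf_mem (s := A) ⟨_, Or.inl rfl⟩ with h | ⟨hlt, hpass⟩
    · rw [h]
      have := hammingDist_le_pow_lastIdx hd hδ x y
      nlinarith
    · have := (hF.1 ⟨sInf A, hlt⟩).1
      rw [← pow_succ']
      exact not_lt.1 fun hcon => this hcon hpass
  · have ha : Nat.find hex ≤ lastIdx d δ :=
      Nat.find_min' hex (hammingDist_le_pow_lastIdx hd hδ x y)
    have hmem : Nat.find hex ∈ A :=
      Or.inr ⟨by omega, (hF.1 ⟨Nat.find hex, by omega⟩).2 (Nat.find_spec hex)⟩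
    refine le_trans (pow_le_pow_right₀ (by linarith) (Nat.sInf_le hmem)) ?_
    rcases Nat.eq_zero_or_pos (Nat.find hex) with h0 | h0
    · rw [h0]; nlinarith
    · have h2 := Nat.find_min hex (m := Nat.find hex - 1) (by omega)
      rw [show Nat.find hex = Nat.find hex - 1 + 1 by omega, pow_succ']
      exact mul_le_mul_of_nonneg_left (not_le.1 h2).le (by linarith)

lemma approxHam_comm {k d : ℕ} {δ : ℝ} (F : Matrices k d δ) (x y : Fin d → Bool) :
    approxHam F x y = approxHam F y x := by
  have h : ∀ l, Passes F l x y ↔ Passes F l y x := fun l => by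
    unfold Passes; rw [hammingDist_comm]
  simp only [approxHam, h, eq_comm (a := x)]

/-- One factor `1 + δ` passes from exact to approximate weights on the computed tree, the other one
back on the optimal tree. In between, the computed tree is optimal for the approximate weights. -/
theorem isApproxMST_of_isPrimTree {n k d : ℕ} {δ : ℝ} (hd : 1 ≤ d) (hδ : 0 < δ)
    {F : Matrices k d δ} {p : Fin n → Fin d → Bool}
    (hF : ∀ i j, p i ≠ p j → Faithful F (p i) (p j)) {T : SimpleGraph (Fin n)}
    (hT : IsPrimTree (approxWeight F p) T) : IsApproxMST δ p T := by
  obtain ⟨htree, hmin⟩ := hT.isMinSpanningTree fun i j => approxHam_comm F (p i) (p j)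
  refine ⟨htree, fun U hU => ?_⟩
  calc cost (hamWeight p) T ≤ (1 + δ) * cost (approxWeight F p) T :=
        cost_le_mul_cost (fun i j => (approxHam_bounds hd hδ F (p i) (p j) (hF i j)).1) T
    _ ≤ (1 + δ) * cost (approxWeight F p) U :=
        mul_le_mul_of_nonneg_left (hmin U hU.1) (by linarith)
    _ ≤ (1 + δ) * ((1 + δ) * cost (hamWeight p) U) :=
        mul_le_mul_of_nonneg_left (cost_le_mul_cost
          (fun i j => (approxHam_bounds hd hδ F (p i) (p j) (hF i j)).2) U) (by linarith)
    _ = (1 + δ) ^ 2 * cost (hamWeight p) U := by ring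

/-! ### Reasoning about programs -/

/-- Started in `s`, the program halts after at most `T` operations in a state that satisfies `Q`. -/
def Runs (ω : Seed) (P : Prog) (s : State) (T : ℕ) (Q : State → Prop) : Prop :=
  ∃ s' τ, Exec ω P s s' τ ∧ τ ≤ T ∧ Q s'

/-- The state with the scalar natural number `a` set to `v`. -/
def State.setVar (s : State) (a v : ℕ) : State := { s with nat := upd s.nat a 0 0 0 v }

/-- The scalar natural number `a`. -/
abbrev NExp.var (a : ℕ) : NExp := .get a (.lit 0) (.lit 0) (.lit 0)

/-- The scalar real number `a`. -/
abbrev RExp.var (a : ℕ) : RExp := .get a (.lit 0) (.lit 0) (.lit 0)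

/-- Assignment to a scalar natural number. -/
abbrev Prog.assign (a : ℕ) (e : NExp) : Prog := .setNat a (.lit 0) (.lit 0) (.lit 0) e

@[simp] lemma upd_same {β : Type} (m : ℕ → ℕ → ℕ → ℕ → β) (a i j l : ℕ) (v : β) :
    upd m a i j l v a i j l = v := by simp [upd]

lemma upd_of_ne {β : Type} (m : ℕ → ℕ → ℕ → ℕ → β) {a a' : ℕ} (i j l : ℕ) (v : β) (h : a' ≠ a) :
    upd m a i j l v a' = m a' := by funext; simp [upd, h]

@[simp] lemma upd_upd {β : Type} (m : ℕ → ℕ → ℕ → ℕ → β) (a i j l : ℕ) (v v' : β) :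
    upd (upd m a i j l v) a i j l v' = upd m a i j l v' := by
  funext a' i' j' l'; simp only [upd]; split_ifs <;> rfl

@[simp] lemma State.setVar_coins (s : State) (a v : ℕ) : (s.setVar a v).coins = s.coins := rfl

@[simp] lemma State.setVar_real (s : State) (a v : ℕ) : (s.setVar a v).real = s.real := rfl

@[simp] lemma State.setVar_nat_same (s : State) (a v : ℕ) : (s.setVar a v).nat a 0 0 0 = v := by
  simp [State.setVar]

lemma State.setVar_nat_of_ne (s : State) {a a' : ℕ} (v : ℕ) (h : a' ≠ a) :
    (s.setVar a v).nat a' = s.nat a' := upd_of_ne _ _ _ _ _ h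

@[simp] lemma State.setVar_setVar (s : State) (a v v' : ℕ) :
    (s.setVar a v).setVar a v' = s.setVar a v' := by simp [State.setVar]

section rules

variable {ω : Seed} {P P' : Prog} {s : State} {T T' : ℕ} {Q Q' : State → Prop}

lemma Runs.mono (h : Runs ω P s T Q) (hT : T ≤ T') (hQ : ∀ s', Q s' → Q' s') :
    Runs ω P s T' Q' := by
  obtain ⟨s', τ, h1, h2, h3⟩ := h
  exact ⟨s', τ, h1, h2.trans hT, hQ _ h3⟩

lemma Runs.skip (hT : 1 ≤ T) (hQ : Q s) : Runs ω .skip s T Q := ⟨s, 1, .skip s, hT, hQ⟩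

lemma Runs.setNat {a : ℕ} {i j l e : NExp} (hT : 1 + i.ops + j.ops + l.ops + e.ops ≤ T)
    (hQ : Q { s with nat := upd s.nat a (i.eval s) (j.eval s) (l.eval s) (e.eval s) }) :
    Runs ω (.setNat a i j l e) s T Q := ⟨_, _, .setNat a i j l e s, hT, hQ⟩

lemma Runs.setReal {a : ℕ} {i j l : NExp} {e : RExp}
    (hT : 1 + i.ops + j.ops + l.ops + e.ops ≤ T)
    (hQ : Q { s with real := upd s.real a (i.eval s) (j.eval s) (l.eval s) (e.eval s) }) :
    Runs ω (.setReal a i j l e) s T Q := ⟨_, _, .setReal a i j l e s, hT, hQ⟩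

lemma Runs.coin {a : ℕ} {i j l : NExp} {e : RExp}
    (hT : 1 + i.ops + j.ops + l.ops + e.ops ≤ T)
    (hQ : Q { s with
      nat := upd s.nat a (i.eval s) (j.eval s) (l.eval s) (toss ω s (e.eval s))
      coins := s.coins + 1 }) :
    Runs ω (.coin a i j l e) s T Q := ⟨_, _, .coin a i j l e s, hT, hQ⟩

lemma Runs.assign {a : ℕ} {e : NExp} (hT : 4 + e.ops ≤ T) (hQ : Q (s.setVar a (e.eval s))) :
    Runs ω (.assign a e) s T Q :=
  Runs.setNat (by simp only [NExp.ops]; omega) hQ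

lemma Runs.seq (h : Runs ω P s T fun s' => Runs ω P' s' T' Q) :
    Runs ω (.seq P P') s (T + T') Q := by
  obtain ⟨s', τ, h1, h2, s'', τ', h1', h2', h3⟩ := h
  exact ⟨s'', τ + τ', .seq _ _ _ _ _ _ _ h1 h1', by omega, h3⟩

lemma Runs.ite {b : BExp} (h1 : b.Holds s → Runs ω P s T Q) (h2 : ¬ b.Holds s → Runs ω P' s T Q)
    (hT : 1 + b.ops + T ≤ T') : Runs ω (.ite b P P') s T' Q := by
  by_cases hb : b.Holds s
  · obtain ⟨s', τ, h1, h2, h3⟩ := h1 hb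
    exact ⟨s', _, .iteTrue _ _ _ _ _ _ hb h1, by omega, h3⟩
  · obtain ⟨s', τ, h1, h2, h3⟩ := h2 hb
    exact ⟨s', _, .iteFalse _ _ _ _ _ _ hb h1, by omega, h3⟩

/-- The index of the invariant bounds the number of remaining iterations. -/
lemma Runs.while {b : BExp} (Inv : ℕ → State → Prop) {m : ℕ} (h0 : Inv m s)
    (hstep : ∀ i s', Inv (i + 1) s' → b.Holds s' → Runs ω P s' T (Inv i))
    (hexit : ∀ s', Inv 0 s' → ¬ b.Holds s')
    (hQ : ∀ i s', Inv i s' → ¬ b.Holds s' → Q s') (hT : (m + 1) * (1 + b.ops + T) ≤ T') :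
    Runs ω (.while b P) s T' Q := by
  refine Runs.mono (T := (m + 1) * (1 + b.ops + T)) (Q := Q) ?_ hT fun _ h => h
  clear hT
  induction m generalizing s with
  | zero =>
    have := hexit s h0
    exact ⟨s, _, .whileFalse b P s this, by omega, hQ _ _ h0 this⟩
  | succ m ih =>
    by_cases hb : b.Holds s
    · obtain ⟨s', τ, h1, h2, h3⟩ := hstep m s h0 hb
      obtain ⟨s'', τ', h1', h2', h3'⟩ := ih h3
      refine ⟨s'', _, .whileTrue _ _ _ _ _ _ _ hb h1 h1', ?_, h3'⟩
      rw [add_mul (m + 1)]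
      omega
    · refine ⟨s, _, .whileFalse b P s hb, ?_, hQ _ _ h0 hb⟩
      rw [add_mul (m + 1)]
      omega

/-- The loop that lets the variable `v` run through `0, …, N - 1`. -/
def Prog.forLoop (v : ℕ) (N : NExp) (P : Prog) : Prog :=
  .seq (.assign v (.lit 0))
    (.while (.natLe (.add (.var v) (.lit 1)) N) (.seq P (.assign v (.add (.var v) (.lit 1)))))

/-- The bound `N` is evaluated anew in every round, so `hN` asks the invariant to keep its value.
One extra round in the time bound pays for the initialization, another one for the final test. -/
lemma Runs.forLoop {v m : ℕ} {N : NExp} (Inv : ℕ → State → Prop)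
    (h0 : Inv 0 (s.setVar v 0)) (hN : ∀ i s', i ≤ m → s'.nat v 0 0 0 = i → Inv i s' → N.eval s' = m)
    (hstep : ∀ i s', i < m → s'.nat v 0 0 0 = i → Inv i s' →
      Runs ω P s' T fun s'' => s''.nat v 0 0 0 = i ∧ Inv (i + 1) (s''.setVar v (i + 1)))
    (hQ : ∀ s', s'.nat v 0 0 0 = m → Inv m s' → Q s')
    (hT : (m + 2) * (N.ops + 18 + T) ≤ T') :
    Runs ω (.forLoop v N P) s T' Q := by
  refine Runs.mono (Runs.seq (T := 5) (T' := (m + 1) * (N.ops + 18 + T)) (Q := Q) ?_) ?_ fun _ h => h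
  · refine Runs.assign (by simp [NExp.ops]) ?_
    -- The index of the while rule counts the remaining rounds, hence `m - i`.
    refine Runs.while (T := T + 10)
      (fun i s' => i ≤ m ∧ s'.nat v 0 0 0 = m - i ∧ Inv (m - i) s') (m := m) ?_ ?_ ?_ ?_ ?_
    · exact ⟨le_rfl, by simp [NExp.eval], by simpa [NExp.eval] using h0⟩
    · rintro i s' ⟨hi, hv, hinv⟩ -
      refine Runs.seq ((hstep _ s' (by omega) hv hinv).mono le_rfl ?_)
      rintro s'' ⟨hv', hinv'⟩
      refine Runs.assign (by simp [NExp.ops]) ?_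
      rw [show m - (i + 1) + 1 = m - i by omega] at hinv'
      refine ⟨by omega, ?_, ?_⟩
      · simp [NExp.eval, hv']; omega
      · simp only [NExp.eval, hv']
        rwa [show m - (i + 1) + 1 = m - i by omega]
    · rintro s' ⟨hi, hv, hinv⟩
      simp only [BExp.Holds, NExp.eval, hv, hN _ s' (by omega) hv hinv]
      omega
    · rintro i s' ⟨hi, hv, hinv⟩ hb
      simp only [BExp.Holds, NExp.eval, hv, hN _ s' (by omega) hv hinv] at hb
      have : i = 0 := by omega
      subst this
      exact hQ s' hv hinv
    · refine Nat.mul_le_mul_left _ ?_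
      simp only [BExp.ops, NExp.ops]
      omega
  · refine le_trans ?_ hT
    rw [show m + 2 = m + 1 + 1 from rfl, add_mul (m + 1)]
    omega

end rules

/-- The states agree apart from the arrays of naturals in `A` and the number of coins. -/
structure Frame (A : Finset ℕ) (s s' : State) : Prop where
  nat : ∀ a ∉ A, s'.nat a = s.nat a
  real : s'.real = s.real

lemma Frame.refl (A : Finset ℕ) (s : State) : Frame A s s := ⟨fun _ _ => rfl, rfl⟩

lemma Frame.mono {A B : Finset ℕ} {s s' : State} (h : Frame A s s') (hAB : A ⊆ B) :
    Frame B s s' := ⟨fun a ha => h.nat a fun h' => ha (hAB h'), h.real⟩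

lemma Frame.trans {A B : Finset ℕ} {s s' s'' : State} (h : Frame A s s') (h' : Frame B s' s'')
    (hAB : B ⊆ A) : Frame A s s'' :=
  ⟨fun a ha => (h'.nat a fun h => ha (hAB h)).trans (h.nat a ha), h'.real.trans h.real⟩

lemma Frame.upd {A : Finset ℕ} {s s' : State} (h : Frame A s s') {a : ℕ} (ha : a ∈ A)
    (i j l v c : ℕ) : Frame A s { s' with nat := upd s'.nat a i j l v, coins := c } :=
  ⟨fun a' ha' => (upd_of_ne _ _ _ _ _ fun e => ha' (by rw [e]; exact ha)).trans (h.nat a' ha'), h.real⟩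

lemma Frame.setVar {A : Finset ℕ} {s s' : State} (h : Frame A s s') {a : ℕ} (ha : a ∈ A)
    (v : ℕ) : Frame A s (s'.setVar a v) := h.upd ha 0 0 0 v s'.coins

/-! ### The number of rows and the thresholds -/

/-- Computes the number of rows of the matrices. -/
def progRows (c : ℕ) : Prog :=
  .seq (.assign 4 (.lit 0))
    (.while
      (.not (.realLe
        (.div (.mul (.ofNat (.lit c))
            (.log (.mul (.mul (.ofNat (.lit 2)) (.ofNat (.var 0))) (.ofNat (.var 1)))))
          (.mul (.var 0) (.var 0)))
        (.ofNat (.var 4))))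
      (.assign 4 (.add (.var 4) (.lit 1))))

/-- Reals cannot be rounded by the machine, so the ceiling is found by counting upwards. The number
of steps is linear in `k`, which the time bound allows. -/
lemma runs_progRows (ω : Seed) (c : ℕ) (s : State) {n d : ℕ} {δ : ℝ} (hn : s.nat 0 0 0 0 = n)
    (hd : s.nat 1 0 0 0 = d) (hδ : s.real 0 0 0 0 = δ) :
    Runs ω (progRows c) s ((sketchDim c n d δ + 2) * 50)
      fun s' => s' = s.setVar 4 (sketchDim c n d δ) := by
  set k := sketchDim c n d δ with hk
  refine Runs.mono (Runs.seq (T := 5) (T' := (k + 1) * 50)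
    (Q := fun s' => s' = s.setVar 4 k) ?_) (by omega) fun _ h => h
  refine Runs.assign (by simp [NExp.ops]) ?_
  have htest : ∀ v : ℕ, c * Real.log (2 * n * d) / (δ * δ) ≤ v ↔ k ≤ v := fun v => by
    rw [hk, sketchDim, Nat.ceil_le, sq]
  have h0 : ∀ v, (s.setVar 4 v).nat 0 0 0 0 = n := fun v => by
    rw [s.setVar_nat_of_ne v (by norm_num), hn]
  have h1 : ∀ v, (s.setVar 4 v).nat 1 0 0 0 = d := fun v => by
    rw [s.setVar_nat_of_ne v (by norm_num), hd]
  refine Runs.while (T := 10) (fun i s' => i ≤ k ∧ s' = s.setVar 4 (k - i)) (m := k) ?_ ?_ ?_ ?_ ?_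
  · simp [NExp.eval]
  · rintro i s' ⟨hi, rfl⟩ -
    refine Runs.assign (by simp [NExp.ops]) ⟨by omega, ?_⟩
    simp only [NExp.eval, State.setVar_nat_same, State.setVar_setVar]
    congr 1; omega
  · rintro s' ⟨-, rfl⟩
    simp only [BExp.Holds, RExp.eval, NExp.eval, h0, h1, State.setVar_nat_same,
      State.setVar_real, hδ, Nat.cast_ofNat, htest]
    omega
  · rintro i s' ⟨hi, rfl⟩ hb
    simp only [BExp.Holds, RExp.eval, NExp.eval, h0, h1, State.setVar_nat_same,
      State.setVar_real, hδ, Nat.cast_ofNat, htest, not_not] at hb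
    rw [show k - i = k by omega]
  · simp [BExp.ops, RExp.ops, NExp.ops]

/-- Computes the thresholds. -/
def progThresholds : Prog :=
  .seq (.setReal 1 (.lit 0) (.lit 0) (.lit 0) (.ofNat (.lit 1)))
    (.seq (.assign 5 (.lit 0))
      (.while (.not (.realLe (.ofNat (.var 1)) (.get 1 (.var 5) (.lit 0) (.lit 0))))
        (.seq
          (.setReal 1 (.add (.var 5) (.lit 1)) (.lit 0) (.lit 0)
            (.mul (.get 1 (.var 5) (.lit 0) (.lit 0)) (.add (.ofNat (.lit 1)) (.var 0))))
          (.assign 5 (.add (.var 5) (.lit 1))))))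

/-- Allows to stop at the first power of `1 + δ` that reaches `d`. The index is thus found while the
powers are tabulated, without computing a logarithm. -/
lemma lastIdx_le_iff {d : ℕ} {δ : ℝ} (hd : 1 ≤ d) (hδ : 0 < δ) (l : ℕ) :
    lastIdx d δ ≤ l ↔ (d : ℝ) ≤ (1 + δ) ^ l := by
  rw [lastIdx, Nat.ceil_le, Real.logb_le_iff_le_rpow (by linarith) (by exact_mod_cast hd),
    Real.rpow_natCast]

lemma runs_progThresholds (ω : Seed) (s : State) {d : ℕ} {δ : ℝ} (hd1 : 1 ≤ d) (hδ0 : 0 < δ)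
    (hd : s.nat 1 0 0 0 = d) (hδ : s.real 0 0 0 0 = δ) :
    Runs ω progThresholds s ((lastIdx d δ + 3) * 60) fun s' =>
      s'.nat = (s.setVar 5 (lastIdx d δ)).nat ∧ s'.coins = s.coins ∧ s'.real 0 0 0 0 = δ ∧
      ∀ l ≤ lastIdx d δ, s'.real 1 l 0 0 = (1 + δ) ^ l := by
  set L := lastIdx d δ with hL
  refine Runs.mono (Runs.seq (T := 7) (T' := 5 + (L + 1) * 60) (Q := fun s' =>
      s'.nat = (s.setVar 5 L).nat ∧ s'.coins = s.coins ∧ s'.real 0 0 0 0 = δ ∧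
      ∀ l ≤ L, s'.real 1 l 0 0 = (1 + δ) ^ l) ?_) (by omega) fun _ h => h
  refine Runs.setReal (by simp [RExp.ops, NExp.ops]) (Runs.seq (Runs.assign (by simp [NExp.ops]) ?_))
  refine Runs.while (T := 40) (fun i s' => i ≤ L ∧ s'.nat = (s.setVar 5 (L - i)).nat ∧
      s'.coins = s.coins ∧ s'.real 0 0 0 0 = δ ∧
      ∀ l ≤ L - i, s'.real 1 l 0 0 = (1 + δ) ^ l) (m := L) ?_ ?_ ?_ ?_ ?_
  · refine ⟨le_rfl, ?_, rfl, ?_, ?_⟩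
    · simp [State.setVar, NExp.eval]
    · simp [State.setVar, upd, hδ]
    · intro l hl
      have : l = 0 := by omega
      subst this
      simp [RExp.eval, NExp.eval]
  · rintro i s' ⟨hi, hnat, hcoins, hδ', ht⟩ -
    have h5 : s'.nat 5 0 0 0 = L - (i + 1) := by rw [hnat, State.setVar_nat_same]
    refine Runs.mono (Runs.seq (T := 30) (T' := 10) (Runs.setReal (by simp [RExp.ops, NExp.ops])
      (Runs.assign (by simp [NExp.ops]) (Q := fun s' => i ≤ L ∧ s'.nat = (s.setVar 5 (L - i)).nat ∧
      s'.coins = s.coins ∧ s'.real 0 0 0 0 = δ ∧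
      ∀ l ≤ L - i, s'.real 1 l 0 0 = (1 + δ) ^ l) ?_))) (by omega) fun _ h => h
    refine ⟨by omega, ?_, hcoins, ?_, ?_⟩
    · simp only [NExp.eval, h5]
      simp only [State.setVar, hnat, upd_upd]
      congr 1; omega
    · simp [upd, hδ']
    · intro l hl
      simp only [NExp.eval, RExp.eval, h5, State.setVar_real, upd]
      by_cases hl' : l = L - (i + 1) + 1
      · simp [hl', ht _ le_rfl, hδ', pow_succ]
      · simp [hl', ht l (by omega)]
  · rintro s' ⟨-, hnat, -, -, ht⟩
    have h5 : s'.nat 5 0 0 0 = L := by rw [hnat, State.setVar_nat_same, Nat.sub_zero]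
    have h1 : s'.nat 1 0 0 0 = d := by rw [hnat, s.setVar_nat_of_ne _ (by norm_num), hd]
    simp only [BExp.Holds, RExp.eval, NExp.eval, h5, h1, ht L le_rfl, not_not]
    exact (lastIdx_le_iff hd1 hδ0 L).1 le_rfl
  · rintro i s' ⟨hi, hnat, hcoins, hδ', ht⟩ hb
    have h5 : s'.nat 5 0 0 0 = L - i := by rw [hnat, State.setVar_nat_same]
    have h1 : s'.nat 1 0 0 0 = d := by rw [hnat, s.setVar_nat_of_ne _ (by norm_num), hd]
    simp only [BExp.Holds, RExp.eval, NExp.eval, h5, h1, ht _ le_rfl, not_not] at hb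
    rw [← lastIdx_le_iff hd1 hδ0] at hb
    have : L - i = L := by omega
    rw [this] at hnat ht
    exact ⟨hnat, hcoins, hδ', ht⟩
  · refine Nat.mul_le_mul_left _ ?_
    simp [BExp.ops, RExp.ops, NExp.ops]

/-! ### Computing the projections -/

open Classical in
/-- The entry in row `r` and column `j` of the matrix for the threshold `(1+δ)^l`. -/
noncomputable def matrixBit (ω : Seed) (δ : ℝ) (k d l r j : ℕ) : Bool :=
  decide ((ω ((l * k + r) * d + j) : ℝ) < 1 / (4 * (1 + δ) ^ l))

/-- The parity of the products of the first coordinates of the row `a` and the point `x`. -/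
def parityBit (a x : ℕ → Bool) : ℕ → Bool
  | 0 => false
  | J + 1 => xor (parityBit a x J) (a J && x J)

/-- Adds one coordinate of the points to their projections. -/
def progAddCoord : Prog :=
  .forLoop 9 (.var 0)
    (.ite (.and (.natLe (.lit 1) (.var 10)) (.natLe (.lit 1) (.get 2 (.var 9) (.var 8) (.lit 0))))
      (.setNat 11 (.var 6) (.var 9) (.var 7)
        (.sub (.lit 1) (.get 11 (.var 6) (.var 9) (.var 7))))
      .skip)

/-- The coin in variable `10` is the matrix entry for threshold `l`, row `r` and column `j`, held in
variables `6`, `7` and `8`. It is applied to all points at once, so that no matrix has to be stored.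
The cell `l, i, r` of array `11` is the bit `r` of the projection of point `i`, and a bit is flipped
by subtracting it from `1`. -/
lemma runs_progAddCoord (ω : Seed) (s : State) {n l r j : ℕ} {b : Bool} {x y : ℕ → Bool}
    (h0 : s.nat 0 0 0 0 = n) (h6 : s.nat 6 0 0 0 = l) (h7 : s.nat 7 0 0 0 = r)
    (h8 : s.nat 8 0 0 0 = j) (h10 : s.nat 10 0 0 0 = b.toNat)
    (hx : ∀ i < n, s.nat 2 i j 0 = (x i).toNat) (hy : ∀ i < n, s.nat 11 l i r = (y i).toNat) :
    Runs ω progAddCoord s ((n + 2) * 100) fun s' => Frame {9, 11} s s' ∧ s'.coins = s.coins ∧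
      ∀ l' i' r', s'.nat 11 l' i' r' =
        if l' = l ∧ r' = r ∧ i' < n then (xor (y i') (b && x i')).toNat else s.nat 11 l' i' r' := by
  have key : ∀ s', Frame {9, 11} s s' → s'.nat 0 0 0 0 = n ∧ s'.nat 6 0 0 0 = l ∧
      s'.nat 7 0 0 0 = r ∧ s'.nat 8 0 0 0 = j ∧ s'.nat 10 0 0 0 = b.toNat ∧
      s'.nat 2 = s.nat 2 := fun s' h => by
    refine ⟨?_, ?_, ?_, ?_, ?_, ?_⟩ <;> rw [h.nat _ (by decide)] <;> assumption
  refine Runs.forLoop (m := n) (T := 60) (fun m s' => Frame {9, 11} s s' ∧ s'.coins = s.coins ∧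
      ∀ l' i' r', s'.nat 11 l' i' r' =
        if l' = l ∧ r' = r ∧ i' < m then (xor (y i') (b && x i')).toNat else s.nat 11 l' i' r')
    ?_ ?_ ?_ ?_ ?_
  · refine ⟨(Frame.refl _ s).setVar (by decide) _, rfl, fun l' i' r' => ?_⟩
    rw [s.setVar_nat_of_ne _ (by norm_num)]
    simp
  · rintro i s' - - ⟨hf, -, -⟩
    exact (key s' hf).1
  · rintro i s' hi h9 ⟨hf, hc, hS⟩
    obtain ⟨-, k6, k7, k8, k10, k2⟩ := key s' hf
    refine Runs.ite (T := 40) (fun hb => ?_) (fun hb => ?_) (by simp [BExp.ops, NExp.ops])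
    · simp only [BExp.Holds, NExp.eval, k10, k2, h9, k8, hx i hi] at hb
      have hbt : b = true := by cases b <;> simp at hb ⊢
      have hxt : x i = true := by cases hxi : x i <;> simp [hxi] at hb ⊢
      refine Runs.setNat (by simp [NExp.ops]) ⟨?_, ?_, hc, fun l' i' r' => ?_⟩
      · simp [upd, h9]
      · exact (hf.upd (by decide) _ _ _ _ s'.coins).setVar (by decide) _
      · rw [State.setVar_nat_of_ne _ _ (by norm_num)]
        simp only [NExp.eval, k6, k7, h9, upd]
        by_cases hl : l' = l ∧ i' = i ∧ r' = r
        · obtain ⟨rfl, rfl, rfl⟩ := hl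
          rw [if_pos (by simp), if_pos (by simp), hS, if_neg (by simp), hy _ hi, hbt, hxt]
          cases y i' <;> rfl
        · rw [if_neg (by tauto), hS]
          refine if_congr ?_ rfl rfl
          constructor
          · rintro ⟨rfl, rfl, h⟩; exact ⟨rfl, rfl, by omega⟩
          · rintro ⟨rfl, rfl, h⟩
            refine ⟨rfl, rfl, ?_⟩
            have : i' ≠ i := fun h => hl ⟨rfl, h, rfl⟩
            omega
    · simp only [BExp.Holds, NExp.eval, k10, k2, h9, k8, hx i hi] at hb
      have hbx : (b && x i) = false := by cases b <;> cases hxi : x i <;> simp [hxi] at hb ⊢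
      refine Runs.skip (by norm_num) ⟨h9, hf.setVar (by decide) _, hc, fun l' i' r' => ?_⟩
      rw [State.setVar_nat_of_ne _ _ (by norm_num), hS]
      by_cases hl : l' = l ∧ i' = i ∧ r' = r
      · obtain ⟨rfl, rfl, rfl⟩ := hl
        rw [if_neg (by simp), if_pos (by simp), hy _ hi, hbx, Bool.xor_false]
      · refine if_congr ?_ rfl rfl
        constructor
        · rintro ⟨rfl, rfl, h⟩; exact ⟨rfl, rfl, by omega⟩
        · rintro ⟨rfl, rfl, h⟩
          refine ⟨rfl, rfl, ?_⟩
          have : i' ≠ i := fun h => hl ⟨rfl, h, rfl⟩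
          omega
  · rintro s' - h
    exact h
  · simp [NExp.ops]

/-- Computes one row of a matrix and the corresponding coordinate of the projections. -/
def progRow : Prog :=
  .forLoop 8 (.var 1)
    (.seq
      (.coin 10 (.lit 0) (.lit 0) (.lit 0)
        (.div (.ofNat (.lit 1)) (.mul (.ofNat (.lit 4)) (.get 1 (.var 6) (.lit 0) (.lit 0)))))
      progAddCoord)

/-- Coins are tossed in lexicographic order of threshold, row and column, so the coin counter
identifies the matrix entry. -/
lemma toss_eq {ω : Seed} {s : State} {δ v : ℝ} {k d l r j : ℕ}
    (hc : s.coins = (l * k + r) * d + j) (hv : v = 1 / (4 * (1 + δ) ^ l)) :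
    toss ω s v = (matrixBit ω δ k d l r j).toNat := by
  unfold toss matrixBit
  rw [hc, hv]
  by_cases h : (ω ((l * k + r) * d + j) : ℝ) < 1 / (4 * (1 + δ) ^ l)
  · rw [if_pos h, decide_eq_true h]; rfl
  · rw [if_neg h, decide_eq_false h]; rfl

lemma runs_progRow (ω : Seed) (s : State) {n d k l r : ℕ} {δ : ℝ} {x : ℕ → ℕ → Bool}
    (h0 : s.nat 0 0 0 0 = n) (h1 : s.nat 1 0 0 0 = d) (h6 : s.nat 6 0 0 0 = l)
    (h7 : s.nat 7 0 0 0 = r) (ht : s.real 1 l 0 0 = (1 + δ) ^ l)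
    (hc : s.coins = (l * k + r) * d)
    (hx : ∀ i < n, ∀ j < d, s.nat 2 i j 0 = (x i j).toNat) (hy : ∀ i < n, s.nat 11 l i r = 0) :
    Runs ω progRow s ((d + 2) * (22 + (50 + (n + 2) * 100)))
      fun s' => Frame {8, 9, 10, 11} s s' ∧
      s'.coins = (l * k + (r + 1)) * d ∧ ∀ l' i' r', s'.nat 11 l' i' r' =
        if l' = l ∧ r' = r ∧ i' < n then (parityBit (matrixBit ω δ k d l r) (x i') d).toNat
        else s.nat 11 l' i' r' := by
  refine Runs.forLoop (m := d) (T := 50 + (n + 2) * 100)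
    (fun m s' => Frame {8, 9, 10, 11} s s' ∧
      s'.coins = (l * k + r) * d + m ∧ ∀ l' i' r', s'.nat 11 l' i' r' =
        if l' = l ∧ r' = r ∧ i' < n then (parityBit (matrixBit ω δ k d l r) (x i') m).toNat
        else s.nat 11 l' i' r')
    ?_ ?_ ?_ ?_ ?_
  · refine ⟨(Frame.refl _ s).setVar (by decide) _, hc, fun l' i' r' => ?_⟩
    rw [s.setVar_nat_of_ne _ (by norm_num)]
    split_ifs with h
    · obtain ⟨rfl, rfl, hi⟩ := h
      exact hy _ hi
    · rfl
  · rintro i s' - - ⟨hf, -, -⟩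
    simp only [NExp.eval]
    rw [hf.nat _ (by decide), h1]
  · rintro j s' hj h8 ⟨hf, hcoin, hS⟩
    have k6 : s'.nat 6 0 0 0 = l := by rw [hf.nat _ (by decide), h6]
    refine Runs.seq (Runs.coin (by simp [RExp.ops, NExp.ops]) ?_)
    rw [toss_eq (δ := δ) (k := k) (d := d) (l := l) (r := r) (j := j) hcoin
      (by simp [RExp.eval, NExp.eval, k6, hf.real, ht])]
    generalize hs₁ : State.mk _ _ _ = s₁
    have hn₁ : ∀ a, a ≠ 10 → s₁.nat a = s'.nat a := fun a ha => by
      rw [← hs₁]; exact upd_of_ne _ _ _ _ _ ha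
    have hf₁ : Frame {8, 9, 10, 11} s s₁ := by
      rw [← hs₁]; exact hf.upd (by decide) _ _ _ _ _
    refine (runs_progAddCoord ω s₁ (n := n) (l := l) (r := r) (j := j)
      (b := matrixBit ω δ k d l r j) (x := fun i => x i j)
      (y := fun i => parityBit (matrixBit ω δ k d l r) (x i) j)
      ?_ ?_ ?_ ?_ ?_ ?_ ?_).mono le_rfl ?_
    · rw [hf₁.nat _ (by decide), h0]
    · rw [hf₁.nat _ (by decide), h6]
    · rw [hf₁.nat _ (by decide), h7]
    · rw [hn₁ _ (by norm_num), h8]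
    · simp [← hs₁, NExp.eval]
    · intro i hi
      rw [hf₁.nat _ (by decide), hx i hi j hj]
    · intro i hi
      rw [hn₁ _ (by norm_num), hS, if_pos ⟨rfl, rfl, hi⟩]
    · rintro s'' ⟨hf', hc', hS'⟩
      refine ⟨?_, ?_, ?_, fun l' i' r' => ?_⟩
      · rw [hf'.nat _ (by decide), hn₁ _ (by norm_num), h8]
      · exact (hf₁.trans hf' (by decide)).setVar (by decide) _
      · rw [State.setVar_coins, hc', ← hs₁]
        simp only [hcoin, add_assoc]
      · rw [State.setVar_nat_of_ne _ _ (by norm_num), hS']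
        split_ifs with h
        · rfl
        · rw [hn₁ _ (by norm_num), hS, if_neg h]
  · rintro s' - ⟨hf, hc', hS⟩
    exact ⟨hf, by rw [hc']; ring, hS⟩
  · simp [NExp.ops]

/-- Computes one matrix and the corresponding projections. -/
def progMatrix : Prog := .forLoop 7 (.var 4) progRow

lemma runs_progMatrix (ω : Seed) (s : State) {n d k l : ℕ} {δ : ℝ} {x : ℕ → ℕ → Bool}
    (h0 : s.nat 0 0 0 0 = n) (h1 : s.nat 1 0 0 0 = d) (h4 : s.nat 4 0 0 0 = k)
    (h6 : s.nat 6 0 0 0 = l)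
    (ht : s.real 1 l 0 0 = (1 + δ) ^ l) (hc : s.coins = l * k * d)
    (hx : ∀ i < n, ∀ j < d, s.nat 2 i j 0 = (x i j).toNat)
    (hy : ∀ i < n, ∀ r < k, s.nat 11 l i r = 0) :
    Runs ω progMatrix s ((k + 2) * (22 + ((d + 2) * (22 + (50 + (n + 2) * 100)))))
      fun s' => Frame {7, 8, 9, 10, 11} s s' ∧
      s'.coins = (l + 1) * k * d ∧ ∀ l' i' r', s'.nat 11 l' i' r' =
        if l' = l ∧ r' < k ∧ i' < n then (parityBit (matrixBit ω δ k d l r') (x i') d).toNat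
        else s.nat 11 l' i' r' := by
  refine Runs.forLoop (m := k) (T := (d + 2) * (22 + (50 + (n + 2) * 100)))
    (fun m s' => Frame {7, 8, 9, 10, 11} s s' ∧
      s'.coins = (l * k + m) * d ∧ ∀ l' i' r', s'.nat 11 l' i' r' =
        if l' = l ∧ r' < m ∧ i' < n then (parityBit (matrixBit ω δ k d l r') (x i') d).toNat
        else s.nat 11 l' i' r')
    ?_ ?_ ?_ ?_ ?_
  · refine ⟨(Frame.refl _ s).setVar (by decide) _, by simpa using hc, fun l' i' r' => ?_⟩
    rw [s.setVar_nat_of_ne _ (by norm_num)]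
    simp
  · rintro i s' - - ⟨hf, -, -⟩
    simp only [NExp.eval]
    rw [hf.nat _ (by decide), h4]
  · rintro r s' hr h7 ⟨hf, hcoin, hS⟩
    refine (runs_progRow ω s' (n := n) (d := d) (k := k) (l := l) (r := r) (δ := δ) (x := x)
      ?_ ?_ ?_ h7 ?_ hcoin ?_ ?_).mono le_rfl ?_
    · rw [hf.nat _ (by decide), h0]
    · rw [hf.nat _ (by decide), h1]
    · rw [hf.nat _ (by decide), h6]
    · rw [hf.real, ht]
    · intro i hi j hj
      rw [hf.nat _ (by decide), hx i hi j hj]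
    · intro i hi
      rw [hS, if_neg (by simp), hy i hi r hr]
    · rintro s'' ⟨hf', hc', hS'⟩
      refine ⟨?_, ?_, hc', fun l' i' r' => ?_⟩
      · rw [hf'.nat _ (by decide), h7]
      · exact (hf.trans hf' (by decide)).setVar (by decide) _
      · rw [State.setVar_nat_of_ne _ _ (by norm_num), hS', hS]
        by_cases h : l' = l ∧ r' = r ∧ i' < n
        · obtain ⟨rfl, rfl, hi⟩ := h
          rw [if_pos ⟨rfl, rfl, hi⟩, if_pos ⟨rfl, by omega, hi⟩]
        · rw [if_neg h]
          refine if_congr ?_ rfl rfl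
          constructor
          · rintro ⟨rfl, h1, h2⟩; exact ⟨rfl, by omega, h2⟩
          · rintro ⟨rfl, h1, h2⟩
            have : r' ≠ r := fun h' => h ⟨rfl, h', h2⟩
            exact ⟨rfl, by omega, h2⟩
  · rintro s' - ⟨hf, hc', hS⟩
    exact ⟨hf, by rw [hc']; ring, hS⟩
  · simp [NExp.ops]

/-- Computes all matrices and projections. -/
def progProjections : Prog := .forLoop 6 (.add (.var 5) (.lit 1)) progMatrix

lemma runs_progProjections (ω : Seed) (s : State) {n d k L : ℕ} {δ : ℝ} {x : ℕ → ℕ → Bool}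
    (h0 : s.nat 0 0 0 0 = n) (h1 : s.nat 1 0 0 0 = d) (h4 : s.nat 4 0 0 0 = k)
    (h5 : s.nat 5 0 0 0 = L)
    (ht : ∀ l ≤ L, s.real 1 l 0 0 = (1 + δ) ^ l) (hc : s.coins = 0)
    (hx : ∀ i < n, ∀ j < d, s.nat 2 i j 0 = (x i j).toNat)
    (hy : ∀ l i r, s.nat 11 l i r = 0) :
    Runs ω progProjections s
      ((L + 3) * (24 + ((k + 2) * (22 + ((d + 2) * (22 + (50 + (n + 2) * 100)))))))
      fun s' => Frame {6, 7, 8, 9, 10, 11} s s' ∧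
      ∀ l ≤ L, ∀ i < n, ∀ r < k, s'.nat 11 l i r =
        (parityBit (matrixBit ω δ k d l r) (x i) d).toNat := by
  refine Runs.forLoop (m := L + 1) (T := (k + 2) * (22 + ((d + 2) * (22 + (50 + (n + 2) * 100)))))
    (fun m s' => Frame {6, 7, 8, 9, 10, 11} s s' ∧
      s'.coins = m * k * d ∧ ∀ l' i' r', s'.nat 11 l' i' r' =
        if l' < m ∧ r' < k ∧ i' < n then (parityBit (matrixBit ω δ k d l' r') (x i') d).toNat
        else 0)
    ?_ ?_ ?_ ?_ ?_
  · refine ⟨(Frame.refl _ s).setVar (by decide) _, by simpa using hc, fun l' i' r' => ?_⟩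
    rw [s.setVar_nat_of_ne _ (by norm_num)]
    simp [hy]
  · rintro i s' - - ⟨hf, -, -⟩
    simp only [NExp.eval]
    rw [hf.nat _ (by decide), h5]
  · rintro l s' hl h6 ⟨hf, hcoin, hS⟩
    refine (runs_progMatrix ω s' (n := n) (d := d) (k := k) (l := l) (δ := δ) (x := x)
      ?_ ?_ ?_ h6 ?_ hcoin ?_ ?_).mono le_rfl ?_
    · rw [hf.nat _ (by decide), h0]
    · rw [hf.nat _ (by decide), h1]
    · rw [hf.nat _ (by decide), h4]
    · rw [hf.real, ht l (by omega)]
    · intro i hi j hj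
      rw [hf.nat _ (by decide), hx i hi j hj]
    · intro i hi r hr
      rw [hS, if_neg (by simp)]
    · rintro s'' ⟨hf', hc', hS'⟩
      refine ⟨?_, ?_, hc', fun l' i' r' => ?_⟩
      · rw [hf'.nat _ (by decide), h6]
      · exact (hf.trans hf' (by decide)).setVar (by decide) _
      · rw [State.setVar_nat_of_ne _ _ (by norm_num), hS', hS]
        by_cases h : l' = l ∧ r' < k ∧ i' < n
        · obtain ⟨rfl, hr, hi⟩ := h
          rw [if_pos ⟨rfl, hr, hi⟩, if_pos ⟨by omega, hr, hi⟩]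
        · rw [if_neg h]
          refine if_congr ?_ rfl rfl
          constructor
          · rintro ⟨h1, h2, h3⟩; exact ⟨by omega, h2, h3⟩
          · rintro ⟨h1, h2, h3⟩
            have : l' ≠ l := fun h' => h ⟨h', h2, h3⟩
            exact ⟨by omega, h2, h3⟩
  · rintro s' - ⟨hf, hc', hS⟩
    exact ⟨hf, fun l hl i hi r hr => by rw [hS, if_pos ⟨by omega, hr, hi⟩]⟩
  · simp [NExp.ops]

/-! ### Computing the approximate distances -/

/-- The number of indices below `k` at which two sequences differ. -/
def diffCount (f g : ℕ → ℕ) (k : ℕ) : ℕ := ((Finset.range k).filter fun r => f r ≠ g r).card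

lemma diffCount_succ (f g : ℕ → ℕ) (k : ℕ) :
    diffCount f g (k + 1) = diffCount f g k + if f k = g k then 0 else 1 := by
  unfold diffCount
  rw [Finset.range_add_one, Finset.filter_insert]
  by_cases h : f k = g k
  · simp [h]
  · rw [if_pos h, if_neg h, Finset.card_insert_of_notMem (by simp)]

/-- Computes the distance of two projections. -/
def progDist : Prog :=
  .seq (.assign 16 (.lit 0))
    (.forLoop 8 (.var 4)
      (.ite
        (.and (.natLe (.get 11 (.var 15) (.var 6) (.var 8)) (.get 11 (.var 15) (.var 7) (.var 8)))
          (.natLe (.get 11 (.var 15) (.var 7) (.var 8)) (.get 11 (.var 15) (.var 6) (.var 8))))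
        .skip (.assign 16 (.add (.var 16) (.lit 1)))))

lemma runs_progDist (ω : Seed) (s : State) {k m i j : ℕ} (h4 : s.nat 4 0 0 0 = k)
    (h6 : s.nat 6 0 0 0 = i) (h7 : s.nat 7 0 0 0 = j) (h15 : s.nat 15 0 0 0 = m) :
    Runs ω progDist s (5 + (k + 2) * 100) fun s' => Frame {8, 16} s s' ∧
      s'.nat 16 0 0 0 = diffCount (s.nat 11 m i) (s.nat 11 m j) k := by
  refine Runs.seq (Runs.assign (by simp [NExp.ops]) ?_)
  have hf₀ : Frame {8, 16} s (s.setVar 16 0) := (Frame.refl _ s).setVar (by decide) _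
  refine Runs.forLoop (m := k) (T := 78) (fun r s' => Frame {8, 16} s s' ∧
    s'.nat 16 0 0 0 = diffCount (s.nat 11 m i) (s.nat 11 m j) r) ?_ ?_ ?_ ?_ ?_
  · refine ⟨hf₀.setVar (by decide) _, ?_⟩
    rw [State.setVar_nat_of_ne _ _ (by norm_num)]
    simp [NExp.eval, diffCount]
  · rintro r s' - - ⟨hf, -⟩
    simp only [NExp.eval]
    rw [hf.nat _ (by decide), h4]
  · rintro r s' hr h8 ⟨hf, h16⟩
    have k6 : s'.nat 6 0 0 0 = i := by rw [hf.nat _ (by decide), h6]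
    have k7 : s'.nat 7 0 0 0 = j := by rw [hf.nat _ (by decide), h7]
    have k15 : s'.nat 15 0 0 0 = m := by rw [hf.nat _ (by decide), h15]
    have k11 : s'.nat 11 = s.nat 11 := hf.nat _ (by decide)
    have htest : (BExp.and (.natLe (.get 11 (.var 15) (.var 6) (.var 8))
        (.get 11 (.var 15) (.var 7) (.var 8)))
        (.natLe (.get 11 (.var 15) (.var 7) (.var 8))
          (.get 11 (.var 15) (.var 6) (.var 8)))).Holds s' ↔
        s.nat 11 m i r = s.nat 11 m j r := by
      simp only [BExp.Holds, NExp.eval, k6, k7, k15, k11, h8]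
      exact ⟨fun h => le_antisymm h.1 h.2, fun h => ⟨h.le, h.ge⟩⟩
    refine Runs.ite (T := 10) (fun hb => ?_) (fun hb => ?_) (by simp [BExp.ops, NExp.ops])
    · refine Runs.skip (by norm_num) ⟨h8, hf.setVar (by decide) _, ?_⟩
      rw [State.setVar_nat_of_ne _ _ (by norm_num), diffCount_succ, if_pos (htest.1 hb), h16,
        add_zero]
    · refine Runs.assign (by simp [NExp.ops])
        ⟨?_, (hf.setVar (by decide) _).setVar (by decide) _, ?_⟩
      · rw [State.setVar_nat_of_ne _ _ (by norm_num), h8]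
      · rw [State.setVar_nat_of_ne _ _ (by norm_num), diffCount_succ,
          if_neg fun h => hb (htest.2 h), State.setVar_nat_same]
        simp [NExp.eval, h16]
  · rintro s' - h
    exact h
  · simp [NExp.ops]

/-- The bound on the distance of two projections for the threshold with the index in variable
`15`. -/
def cutoffExp : RExp :=
  .mul
    (.add
      (.div
        (.sub (.ofNat (.lit 1))
          (.exp (.mul
            (.log (.sub (.ofNat (.lit 1)) (.div (.ofNat (.lit 1))
              (.mul (.ofNat (.lit 2)) (.get 1 (.var 15) (.lit 0) (.lit 0))))))
            (.get 1 (.var 15) (.lit 0) (.lit 0)))))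
        (.ofNat (.lit 2)))
      (.div (.var 0) (.ofNat (.lit 30))))
    (.ofNat (.var 4))

/-- The machine has no real powers; `exp` of a product with `log` gives the right value because the
base is positive. -/
lemma eval_cutoffExp {s : State} {k m : ℕ} {δ : ℝ} (hδ : 0 < δ) (h0 : s.real 0 0 0 0 = δ)
    (h4 : s.nat 4 0 0 0 = k) (h15 : s.nat 15 0 0 0 = m) (ht : s.real 1 m 0 0 = (1 + δ) ^ m) :
    cutoffExp.eval s = (C₁ ((1 + δ) ^ m) + δ / 30) * k := by
  simp only [cutoffExp, RExp.eval, NExp.eval, h0, h4, h15, ht, C₁,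
    Real.rpow_def_of_pos (base_pos (one_le_threshold hδ m))]
  norm_num

/-- Binary search for the first threshold for which the projections are close. -/
def progSearch : Prog :=
  .seq (.assign 13 (.lit 0)) (.seq (.assign 14 (.var 5))
    (.while (.natLe (.add (.var 13) (.lit 1)) (.var 14))
      (.seq (.assign 15 (.half (.add (.var 13) (.var 14))))
        (.seq progDist
          (.ite (.realLe (.ofNat (.var 16)) cutoffExp)
            (.assign 14 (.var 15))
            (.assign 13 (.add (.var 15) (.lit 1))))))))

/-- `Q` holds at `g` but not directly before. -/
def IsSwitch (Q : ℕ → Prop) (L g : ℕ) : Prop :=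
  g ≤ L ∧ (g = L ∨ Q g) ∧ (g = 0 ∨ ¬ Q (g - 1))

/-- The projections in the state are close for the threshold with index `m`. -/
def Close (s : State) (δ : ℝ) (k i j m : ℕ) : Prop :=
  (diffCount (s.nat 11 m i) (s.nat 11 m j) k : ℝ) ≤ (C₁ ((1 + δ) ^ m) + δ / 30) * k

/-- Variables `13` and `14` are the ends of the interval. The test fails just before the lower end
unless this is `0`, and holds at the upper end unless this is `L`; the length is halved in each
round. No monotonicity of the test is required, which is why only a switch is claimed. -/
lemma runs_progSearch (ω : Seed) (s : State) {k L i j : ℕ} {δ : ℝ} (hδ : 0 < δ)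
    (h4 : s.nat 4 0 0 0 = k) (h5 : s.nat 5 0 0 0 = L) (h6 : s.nat 6 0 0 0 = i)
    (h7 : s.nat 7 0 0 0 = j) (hr0 : s.real 0 0 0 0 = δ)
    (ht : ∀ l ≤ L, s.real 1 l 0 0 = (1 + δ) ^ l) :
    Runs ω progSearch s (20 + (Nat.log 2 L + 2) * (150 + (k + 2) * 100))
      fun s' => Frame {8, 13, 14, 15, 16} s s' ∧
        IsSwitch (Close s δ k i j) L (s'.nat 13 0 0 0) := by
  refine Runs.mono (Runs.seq (T := 5) (T' := 8 + (Nat.log 2 L + 2) * (150 + (k + 2) * 100))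
    (Q := fun s' => Frame {8, 13, 14, 15, 16} s s' ∧
        IsSwitch (Close s δ k i j) L (s'.nat 13 0 0 0))
    (Runs.assign (by simp [NExp.ops]) (Runs.seq (Runs.assign (by simp [NExp.ops]) ?_))))
    (by omega) fun _ h => h
  refine Runs.while (T := 130 + (k + 2) * 100) (fun f s' => Frame {8, 13, 14, 15, 16} s s' ∧
      s'.nat 13 0 0 0 ≤ s'.nat 14 0 0 0 ∧ s'.nat 14 0 0 0 ≤ L ∧
      s'.nat 14 0 0 0 - s'.nat 13 0 0 0 < 2 ^ f ∧
      (s'.nat 14 0 0 0 = L ∨ Close s δ k i j (s'.nat 14 0 0 0)) ∧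
      (s'.nat 13 0 0 0 = 0 ∨ ¬ Close s δ k i j (s'.nat 13 0 0 0 - 1)))
    (m := Nat.log 2 L + 1) ?_ ?_ ?_ ?_ ?_
  · have e13 : (((s.setVar 13 (NExp.eval s (.lit 0))).setVar 14
        (NExp.eval (s.setVar 13 (NExp.eval s (.lit 0))) (.var 5)))).nat 13 0 0 0 = 0 := by
      rw [State.setVar_nat_of_ne _ _ (by norm_num), State.setVar_nat_same]; rfl
    have e14 : (((s.setVar 13 (NExp.eval s (.lit 0))).setVar 14
        (NExp.eval (s.setVar 13 (NExp.eval s (.lit 0))) (.var 5)))).nat 14 0 0 0 = L := by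
      rw [State.setVar_nat_same]
      simp only [NExp.eval]
      rw [State.setVar_nat_of_ne _ _ (by norm_num), h5]
    rw [e13, e14]
    refine ⟨((Frame.refl _ s).setVar (by decide) _).setVar (by decide) _, by omega, le_rfl, ?_,
      Or.inl rfl, Or.inl rfl⟩
    exact Nat.lt_pow_succ_log_self (by norm_num) L
  · rintro f s' ⟨hf, hle, hL, hlt, hhi, hlo⟩ hb
    simp only [BExp.Holds, NExp.eval] at hb
    set lo := s'.nat 13 0 0 0 with hlo'
    set hi := s'.nat 14 0 0 0 with hhi'
    set mid := (lo + hi) / 2 with hmid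
    have hpow : 2 ^ (f + 1) = 2 * 2 ^ f := by ring
    refine Runs.mono (Runs.seq (T := 15) (T' := 5 + (k + 2) * 100 + 110)
      (Q := fun s' => Frame {8, 13, 14, 15, 16} s s' ∧
        s'.nat 13 0 0 0 ≤ s'.nat 14 0 0 0 ∧ s'.nat 14 0 0 0 ≤ L ∧
        s'.nat 14 0 0 0 - s'.nat 13 0 0 0 < 2 ^ f ∧
        (s'.nat 14 0 0 0 = L ∨ Close s δ k i j (s'.nat 14 0 0 0)) ∧
        (s'.nat 13 0 0 0 = 0 ∨ ¬ Close s δ k i j (s'.nat 13 0 0 0 - 1)))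
      (Runs.assign (by simp [NExp.ops]) (Runs.seq ?_))) (by omega) fun _ h => h
    have hev : NExp.eval s' (.half (.add (.var 13) (.var 14))) = mid := by
      simp [NExp.eval, hmid, hlo', hhi']
    rw [hev]
    have hf₁ : Frame {8, 13, 14, 15, 16} s (s'.setVar 15 mid) := hf.setVar (by decide) _
    refine (runs_progDist ω (s'.setVar 15 mid) (k := k) (m := mid) (i := i) (j := j)
      ?_ ?_ ?_ (State.setVar_nat_same _ _ _)).mono le_rfl ?_
    · rw [hf₁.nat _ (by decide), h4]
    · rw [hf₁.nat _ (by decide), h6]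
    · rw [hf₁.nat _ (by decide), h7]
    rintro s'' ⟨hf', h16⟩
    rw [hf₁.nat 11 (by decide)] at h16
    have hf₂ : Frame {8, 13, 14, 15, 16} s s'' := hf₁.trans hf' (by decide)
    have k13 : s''.nat 13 0 0 0 = lo := by
      rw [hf'.nat _ (by decide), State.setVar_nat_of_ne _ _ (by norm_num)]
    have k14 : s''.nat 14 0 0 0 = hi := by
      rw [hf'.nat _ (by decide), State.setVar_nat_of_ne _ _ (by norm_num)]
    have k15 : s''.nat 15 0 0 0 = mid := by
      rw [hf'.nat _ (by decide), State.setVar_nat_same]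
    have hcut : cutoffExp.eval s'' = (C₁ ((1 + δ) ^ mid) + δ / 30) * k := by
      refine eval_cutoffExp hδ ?_ ?_ k15 ?_
      · rw [hf₂.real, hr0]
      · rw [hf₂.nat _ (by decide), h4]
      · rw [hf₂.real, ht _ (by omega)]
    refine Runs.ite (T := 15) (fun hb' => ?_) (fun hb' => ?_)
      (by simp [BExp.ops, NExp.ops, RExp.ops, cutoffExp])
    · simp only [BExp.Holds, RExp.eval, NExp.eval, h16, hcut] at hb'
      refine Runs.assign (by simp [NExp.ops]) ?_
      rw [State.setVar_nat_same, State.setVar_nat_of_ne _ _ (by norm_num), k13]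
      simp only [NExp.eval, k15]
      exact ⟨hf₂.setVar (by decide) _, by omega, by omega, by omega, Or.inr hb', hlo⟩
    · simp only [BExp.Holds, RExp.eval, NExp.eval, h16, hcut] at hb'
      refine Runs.assign (by simp [NExp.ops]) ?_
      rw [State.setVar_nat_same, State.setVar_nat_of_ne _ _ (by norm_num), k14]
      simp only [NExp.eval, k15]
      exact ⟨hf₂.setVar (by decide) _, by omega, by omega, by omega, hhi, Or.inr hb'⟩
  · rintro s' ⟨hf, hle, hL, hlt, hhi, hlo⟩
    simp only [BExp.Holds, NExp.eval]
    omega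
  · rintro f s' ⟨hf, hle, hL, hlt, hhi, hlo⟩ hb
    simp only [BExp.Holds, NExp.eval] at hb
    have heq : s'.nat 14 0 0 0 = s'.nat 13 0 0 0 := by omega
    rw [heq] at hhi hL
    exact ⟨hf, hL, hhi, hlo⟩
  · refine Nat.mul_le_mul_left _ ?_
    simp only [BExp.ops, NExp.ops]
    omega

/-- The value that is computed for a pair of points. -/
def IsCode (s : State) (δ : ℝ) (k L i j w : ℕ) : Prop :=
  (diffCount (s.nat 11 0 i) (s.nat 11 0 j) k = 0 → w = 0) ∧
  (diffCount (s.nat 11 0 i) (s.nat 11 0 j) k ≠ 0 →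
    ∃ g, w = g + 1 ∧ IsSwitch (Close s δ k i j) L g)

/-- Computes the code of the approximate distance of one pair. -/
def progPair : Prog :=
  .seq (.assign 15 (.lit 0)) (.seq progDist
    (.ite (.natLe (.var 16) (.lit 0))
      (.setNat 12 (.var 6) (.var 7) (.lit 0) (.lit 0))
      (.seq progSearch
        (.setNat 12 (.var 6) (.var 7) (.lit 0) (.add (.var 13) (.lit 1))))))

/-- Equality of two points is decided by their projections for the first threshold, in time of order
`k`. Comparing the points themselves would cost `d` for each pair. The code is `0` for pairs taken
to be equal and `g + 1` for the threshold with index `g`, so codes are ordered like the weights and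
Prim's algorithm can work with naturals. -/
lemma runs_progPair (ω : Seed) (s : State) {k L i j : ℕ} {δ : ℝ} (hδ : 0 < δ)
    (h4 : s.nat 4 0 0 0 = k) (h5 : s.nat 5 0 0 0 = L) (h6 : s.nat 6 0 0 0 = i)
    (h7 : s.nat 7 0 0 0 = j) (hr0 : s.real 0 0 0 0 = δ)
    (ht : ∀ l ≤ L, s.real 1 l 0 0 = (1 + δ) ^ l) :
    Runs ω progPair s ((Nat.log 2 L + 4) * (150 + (k + 2) * 100))
      fun s' => Frame {8, 12, 13, 14, 15, 16} s s' ∧ IsCode s δ k L i j (s'.nat 12 i j 0) ∧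
        ∀ i' j', (i' ≠ i ∨ j' ≠ j) → s'.nat 12 i' j' 0 = s.nat 12 i' j' 0 := by
  set T₀ := 20 + (Nat.log 2 L + 2) * (150 + (k + 2) * 100) + 20 with hT₀
  refine Runs.mono (Runs.seq (T := 5) (T' := 5 + (k + 2) * 100 + (10 + T₀)) (Q := fun s' =>
      Frame {8, 12, 13, 14, 15, 16} s s' ∧ IsCode s δ k L i j (s'.nat 12 i j 0) ∧
        ∀ i' j', (i' ≠ i ∨ j' ≠ j) → s'.nat 12 i' j' 0 = s.nat 12 i' j' 0)
    (Runs.assign (by simp [NExp.ops]) (Runs.seq ?_))) ?_ fun _ h => h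
  · have hf₁ : Frame {8, 12, 13, 14, 15, 16} s (s.setVar 15 0) :=
      (Frame.refl _ s).setVar (by decide) _
    have hn₁ : (s.setVar 15 0).nat 12 = s.nat 12 := State.setVar_nat_of_ne _ _ (by norm_num)
    refine (runs_progDist ω (s.setVar 15 0) (k := k) (m := 0) (i := i) (j := j)
      ?_ ?_ ?_ (State.setVar_nat_same _ _ _)).mono le_rfl ?_
    · rw [hf₁.nat _ (by decide), h4]
    · rw [hf₁.nat _ (by decide), h6]
    · rw [hf₁.nat _ (by decide), h7]
    rintro s₂ ⟨hf', h16⟩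
    rw [hf₁.nat 11 (by decide)] at h16
    have hf₂ : Frame {8, 12, 13, 14, 15, 16} s s₂ := hf₁.trans hf' (by decide)
    have hn₂ : s₂.nat 12 = s.nat 12 := by rw [hf'.nat _ (by decide), hn₁]
    have k6 : s₂.nat 6 0 0 0 = i := by rw [hf₂.nat _ (by decide), h6]
    have k7 : s₂.nat 7 0 0 0 = j := by rw [hf₂.nat _ (by decide), h7]
    refine Runs.ite (T := T₀) (fun hb => ?_) (fun hb => ?_) (by simp [BExp.ops, NExp.ops])
    · simp only [BExp.Holds, NExp.eval, h16] at hb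
      refine Runs.setNat (by simp [NExp.ops]; omega)
        ⟨hf₂.upd (by decide) _ _ _ _ s₂.coins, ?_, ?_⟩
      · simp only [NExp.eval, k6, k7, upd_same]
        exact ⟨fun _ => rfl, fun h => absurd (Nat.le_zero.1 hb) h⟩
      · intro i' j' hne
        simp only [NExp.eval, k6, k7, upd, hn₂]
        rw [if_neg (by tauto)]
    · simp only [BExp.Holds, NExp.eval, h16] at hb
      refine Runs.seq ((runs_progSearch ω s₂ (k := k) (L := L) (i := i) (j := j) hδ
        ?_ ?_ k6 k7 ?_ ?_).mono le_rfl ?_)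
      · rw [hf₂.nat _ (by decide), h4]
      · rw [hf₂.nat _ (by decide), h5]
      · rw [hf₂.real, hr0]
      · intro l hl
        rw [hf₂.real, ht l hl]
      rintro s₃ ⟨hf'', hsw⟩
      have hf₃ : Frame {8, 12, 13, 14, 15, 16} s s₃ := hf₂.trans hf'' (by decide)
      have k6' : s₃.nat 6 0 0 0 = i := by rw [hf₃.nat _ (by decide), h6]
      have k7' : s₃.nat 7 0 0 0 = j := by rw [hf₃.nat _ (by decide), h7]
      have hclose : Close s₂ δ k i j = Close s δ k i j := by
        funext m
        simp only [Close, hf₂.nat 11 (by decide)]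
      rw [hclose] at hsw
      refine Runs.setNat (by simp [NExp.ops]) ⟨hf₃.upd (by decide) _ _ _ _ s₃.coins, ?_, ?_⟩
      · simp only [NExp.eval, k6', k7', upd_same]
        exact ⟨fun h => absurd h.le hb, fun _ => ⟨_, rfl, hsw⟩⟩
      · intro i' j' hne
        simp only [NExp.eval, k6', k7', upd, hf''.nat 12 (by decide), hn₂]
        rw [if_neg (by tauto)]
  · rw [hT₀, show Nat.log 2 L + 4 = Nat.log 2 L + 2 + 2 from rfl, add_mul (Nat.log 2 L + 2)]
    omega

/-- Computes the codes of the approximate distances of all pairs. -/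
def progPairs : Prog := .forLoop 6 (.var 0) (.forLoop 7 (.var 0) progPair)

lemma IsCode.congr {s s' : State} (h : s'.nat 11 = s.nat 11) {δ : ℝ} {k L i j w : ℕ} :
    IsCode s' δ k L i j w ↔ IsCode s δ k L i j w := by
  have hclose : Close s' δ k i j = Close s δ k i j := by
    funext m; simp only [Close, h]
  simp only [IsCode, hclose, h]

lemma runs_progPairs (ω : Seed) (s : State) {n k L : ℕ} {δ : ℝ} (hδ : 0 < δ)
    (h0 : s.nat 0 0 0 0 = n) (h4 : s.nat 4 0 0 0 = k) (h5 : s.nat 5 0 0 0 = L)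
    (hr0 : s.real 0 0 0 0 = δ) (ht : ∀ l ≤ L, s.real 1 l 0 0 = (1 + δ) ^ l) :
    Runs ω progPairs s
      ((n + 2) * (22 + (n + 2) * (22 + (Nat.log 2 L + 4) * (150 + (k + 2) * 100))))
      fun s' => Frame {6, 7, 8, 12, 13, 14, 15, 16} s s' ∧
        ∀ i < n, ∀ j < n, IsCode s δ k L i j (s'.nat 12 i j 0) := by
  set T₀ := (Nat.log 2 L + 4) * (150 + (k + 2) * 100) with hT₀
  refine Runs.forLoop (m := n) (T := (n + 2) * (22 + T₀)) (fun m s' =>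
    Frame {6, 7, 8, 12, 13, 14, 15, 16} s s' ∧
      ∀ i < m, ∀ j < n, IsCode s δ k L i j (s'.nat 12 i j 0)) ?_ ?_ ?_ ?_ ?_
  · exact ⟨(Frame.refl _ s).setVar (by decide) _, fun i hi => absurd hi (by omega)⟩
  · rintro i s' - - ⟨hf, -⟩
    simp only [NExp.eval]
    rw [hf.nat _ (by decide), h0]
  · rintro i s₁ hi h6 ⟨hf₁, hW₁⟩
    refine Runs.forLoop (m := n) (T := T₀) (fun m s' =>
      Frame {6, 7, 8, 12, 13, 14, 15, 16} s s' ∧ s'.nat 6 0 0 0 = i ∧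
      (∀ i' < i, ∀ j < n, IsCode s δ k L i' j (s'.nat 12 i' j 0)) ∧
      ∀ j < m, IsCode s δ k L i j (s'.nat 12 i j 0)) ?_ ?_ ?_ ?_ ?_
    · refine ⟨hf₁.setVar (by decide) _, ?_, ?_, fun j hj => absurd hj (by omega)⟩
      · rw [State.setVar_nat_of_ne _ _ (by norm_num), h6]
      · rw [State.setVar_nat_of_ne _ _ (by norm_num)]
        exact hW₁
    · rintro j s' - - ⟨hf, -⟩
      simp only [NExp.eval]
      rw [hf.nat _ (by decide), h0]
    · rintro j s₂ hj h7 ⟨hf₂, k6, hW₂, hW₂'⟩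
      refine (runs_progPair ω s₂ (k := k) (L := L) (i := i) (j := j) hδ
        ?_ ?_ k6 h7 ?_ ?_).mono le_rfl ?_
      · rw [hf₂.nat _ (by decide), h4]
      · rw [hf₂.nat _ (by decide), h5]
      · rw [hf₂.real, hr0]
      · intro l hl
        rw [hf₂.real, ht l hl]
      rintro s₃ ⟨hf₃, hcode, hkeep⟩
      rw [IsCode.congr (hf₂.nat 11 (by decide))] at hcode
      refine ⟨?_, (hf₂.trans hf₃ (by decide)).setVar (by decide) _, ?_, ?_, ?_⟩
      · rw [hf₃.nat _ (by decide), h7]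
      · rw [State.setVar_nat_of_ne _ _ (by norm_num), hf₃.nat _ (by decide), k6]
      · intro i' hi' j' hj'
        rw [State.setVar_nat_of_ne _ _ (by norm_num), hkeep i' j' (Or.inl (by omega))]
        exact hW₂ i' hi' j' hj'
      · intro j' hj'
        rw [State.setVar_nat_of_ne _ _ (by norm_num)]
        by_cases hjj : j' = j
        · rw [hjj]; exact hcode
        · rw [hkeep i j' (Or.inr hjj)]
          exact hW₂' j' (by omega)
    · rintro s' - ⟨hf, k6, hW, hW'⟩
      refine ⟨k6, hf.setVar (by decide) _, fun i' hi' j hj => ?_⟩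
      rw [State.setVar_nat_of_ne _ _ (by norm_num)]
      rcases Nat.lt_succ_iff_lt_or_eq.1 hi' with h | rfl
      · exact hW i' h j hj
      · exact hW' j hj
    · simp [NExp.ops]
  · rintro s' - h
    exact h
  · simp [NExp.ops]

/-! ### Prim's algorithm as a program -/

/-- The weight of the edge from the vertex `v` to its current parent. -/
def keyExp (v : NExp) : NExp := .get 12 (.get 18 v (.lit 0) (.lit 0)) v (.lit 0)

/-- The weight of the edge from the vertex `v` to its parent in the state `s`. -/
def State.key (s : State) (v : ℕ) : ℕ := s.nat 12 (s.nat 18 v 0 0) v 0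

/-- Finds the vertex outside of the tree that is closest to the tree. -/
def progScan : Prog :=
  .seq (.assign 20 (.var 0))
    (.forLoop 21 (.var 0)
      (.ite
        (.and (.natLe (.get 17 (.var 21) (.lit 0) (.lit 0)) (.lit 0))
          (.not (.and (.not (.natLe (.var 0) (.var 20)))
            (.natLe (keyExp (.var 20)) (keyExp (.var 21))))))
        (.assign 20 (.var 21)) .skip))

lemma runs_progScan (ω : Seed) (s : State) {n : ℕ} (h0 : s.nat 0 0 0 0 = n)
    (hex : ∃ v < n, s.nat 17 v 0 0 = 0) :
    Runs ω progScan s (8 + (n + 2) * 100) fun s' => Frame {20, 21} s s' ∧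
      s'.nat 20 0 0 0 < n ∧ s.nat 17 (s'.nat 20 0 0 0) 0 0 = 0 ∧
      ∀ v < n, s.nat 17 v 0 0 = 0 → s.key (s'.nat 20 0 0 0) ≤ s.key v := by
  refine Runs.seq (Runs.assign (by simp [NExp.ops])
    -- The value `n` in variable `20` marks that no candidate has been met yet.
    (Runs.forLoop (m := n) (T := 78) (fun m s' => Frame {20, 21} s s' ∧
      ((s'.nat 20 0 0 0 = n ∧ ∀ v < m, s.nat 17 v 0 0 ≠ 0) ∨
        (s'.nat 20 0 0 0 < n ∧ s.nat 17 (s'.nat 20 0 0 0) 0 0 = 0 ∧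
          ∀ v < m, s.nat 17 v 0 0 = 0 → s.key (s'.nat 20 0 0 0) ≤ s.key v))) ?_ ?_ ?_ ?_ ?_))
  · refine ⟨((Frame.refl _ s).setVar (by decide) _).setVar (by decide) _, Or.inl ⟨?_, ?_⟩⟩
    · rw [State.setVar_nat_of_ne _ _ (by norm_num), State.setVar_nat_same]
      simpa [NExp.eval] using h0
    · intro v hv; omega
  · rintro i s' - - ⟨hf, -⟩
    simp only [NExp.eval]
    rw [hf.nat _ (by decide), h0]
  · rintro v s' hv h21 ⟨hf, hx⟩
    have k0 : s'.nat 0 0 0 0 = n := by rw [hf.nat _ (by decide), h0]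
    have k12 : s'.nat 12 = s.nat 12 := hf.nat _ (by decide)
    have k17 : s'.nat 17 = s.nat 17 := hf.nat _ (by decide)
    have k18 : s'.nat 18 = s.nat 18 := hf.nat _ (by decide)
    refine Runs.ite (T := 10) (fun hb => ?_) (fun hb => ?_)
      (by simp [BExp.ops, NExp.ops, keyExp])
    · simp only [BExp.Holds, keyExp, NExp.eval, k0, k12, k17, k18, h21] at hb
      refine Runs.assign (by simp [NExp.ops]) ?_
      simp only [NExp.eval, h21]
      refine ⟨?_, (hf.setVar (by decide) _).setVar (by decide) _, Or.inr ?_⟩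
      · rw [State.setVar_nat_of_ne _ _ (by norm_num), h21]
      · rw [State.setVar_nat_of_ne _ _ (by norm_num), State.setVar_nat_same]
        refine ⟨hv, by omega, fun v' hv' hvis => ?_⟩
        rcases Nat.lt_succ_iff_lt_or_eq.1 hv' with h | rfl
        · rcases hx with ⟨-, hall⟩ | ⟨hlt, -, hall⟩
          · exact absurd hvis (hall v' h)
          · have h1 := hall v' h hvis
            have h2 : ¬ s.key (s'.nat 20 0 0 0) ≤ s.key v := fun hle =>
              hb.2 ⟨by omega, hle⟩
            omega
        · exact le_rfl
    · simp only [BExp.Holds, keyExp, NExp.eval, k0, k12, k17, k18, h21] at hb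
      refine Runs.skip (by norm_num) ⟨h21, hf.setVar (by decide) _, ?_⟩
      rw [State.setVar_nat_of_ne _ _ (by norm_num)]
      rcases hx with ⟨hxn, hall⟩ | ⟨hlt, hxv, hall⟩
      · refine Or.inl ⟨hxn, fun v' hv' => ?_⟩
        rcases Nat.lt_succ_iff_lt_or_eq.1 hv' with h | rfl
        · exact hall v' h
        · intro hvis
          exact hb ⟨hvis.le, fun h => h.1 hxn.ge⟩
      · refine Or.inr ⟨hlt, hxv, fun v' hv' hvis => ?_⟩
        rcases Nat.lt_succ_iff_lt_or_eq.1 hv' with h | rfl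
        · exact hall v' h hvis
        · by_contra hcon
          exact hb ⟨hvis.le, fun h => hcon h.2⟩
  · rintro s' - ⟨hf, hx⟩
    rcases hx with ⟨-, hall⟩ | h
    · obtain ⟨v, hv, hvis⟩ := hex
      exact absurd hvis (hall v hv)
    · exact ⟨hf, h⟩
  · simp [NExp.ops]

/-- Updates the parents after a vertex has been added to the tree. -/
def progRelax : Prog :=
  .forLoop 21 (.var 0)
    (.ite (.natLe (keyExp (.var 21)) (.get 12 (.var 20) (.var 21) (.lit 0)))
      .skip (.setNat 18 (.var 21) (.lit 0) (.lit 0) (.var 20)))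

/-- Vertices in the tree are treated like all others. Their parent entries may change, which is
harmless, because their edges are already stored in array `3`. -/
lemma runs_progRelax (ω : Seed) (s : State) {n x : ℕ} (h0 : s.nat 0 0 0 0 = n)
    (h20 : s.nat 20 0 0 0 = x) :
    Runs ω progRelax s ((n + 2) * 100) fun s' => Frame {18, 21} s s' ∧
      ∀ v < n, s'.nat 18 v 0 0 = if s.key v ≤ s.nat 12 x v 0 then s.nat 18 v 0 0 else x := by
  refine Runs.forLoop (m := n) (T := 78) (fun m s' => Frame {18, 21} s s' ∧
    (∀ v, m ≤ v → s'.nat 18 v 0 0 = s.nat 18 v 0 0) ∧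
      ∀ v < m, s'.nat 18 v 0 0 = if s.key v ≤ s.nat 12 x v 0 then s.nat 18 v 0 0 else x)
      ?_ ?_ ?_ ?_ ?_
  · refine ⟨(Frame.refl _ s).setVar (by decide) _, fun v _ => ?_, fun v hv => absurd hv (by omega)⟩
    rw [State.setVar_nat_of_ne _ _ (by norm_num)]
  · rintro i s' - - ⟨hf, -⟩
    simp only [NExp.eval]
    rw [hf.nat _ (by decide), h0]
  · rintro v s' hv h21 ⟨hf, hold, hnew⟩
    have k12 : s'.nat 12 = s.nat 12 := hf.nat _ (by decide)
    have k20 : s'.nat 20 0 0 0 = x := by rw [hf.nat _ (by decide), h20]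
    have htest : (BExp.natLe (keyExp (.var 21))
        (.get 12 (.var 20) (.var 21) (.lit 0))).Holds s' ↔ s.key v ≤ s.nat 12 x v 0 := by
      simp only [BExp.Holds, keyExp, NExp.eval, k12, k20, h21, hold v le_rfl]
      rfl
    refine Runs.ite (T := 20) (fun hb => ?_) (fun hb => ?_) (by simp [BExp.ops, NExp.ops, keyExp])
    · refine Runs.skip (by norm_num) ⟨h21, hf.setVar (by decide) _, ?_, ?_⟩
      · intro v' hv'
        rw [State.setVar_nat_of_ne _ _ (by norm_num), hold v' (by omega)]
      · intro v' hv'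
        rw [State.setVar_nat_of_ne _ _ (by norm_num)]
        rcases Nat.lt_succ_iff_lt_or_eq.1 hv' with h | rfl
        · exact hnew v' h
        · rw [if_pos (htest.1 hb), hold _ le_rfl]
    · refine Runs.setNat (by simp [NExp.ops])
        ⟨?_, (hf.upd (by decide) _ _ _ _ s'.coins).setVar (by decide) _, ?_, ?_⟩
      · simp only [NExp.eval]
        rw [upd_of_ne _ _ _ _ _ (by norm_num), h21]
      · intro v' hv'
        rw [State.setVar_nat_of_ne _ _ (by norm_num)]
        simp only [NExp.eval, upd, h21]
        rw [if_neg (by omega), hold v' (by omega)]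
      · intro v' hv'
        rw [State.setVar_nat_of_ne _ _ (by norm_num)]
        simp only [NExp.eval, upd, h21]
        rcases Nat.lt_succ_iff_lt_or_eq.1 hv' with h | rfl
        · rw [if_neg (by omega)]
          exact hnew v' h
        · rw [if_pos (by simp), if_neg fun h => hb (htest.2 h), k20]
  · rintro s' - ⟨hf, -, h⟩
    exact ⟨hf, h⟩
  · simp [NExp.ops]

/-- Computes a tree by Prim's algorithm. -/
def progPrim : Prog :=
  .seq (.setNat 17 (.lit 0) (.lit 0) (.lit 0) (.lit 1))
    (.forLoop 19 (.sub (.var 0) (.lit 1))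
      (.seq progScan
        (.seq (.setNat 3 (.var 19) (.lit 0) (.lit 0) (.get 18 (.var 20) (.lit 0) (.lit 0)))
          (.seq (.setNat 3 (.var 19) (.lit 1) (.lit 0) (.var 20))
            (.seq (.setNat 17 (.var 20) (.lit 0) (.lit 0) (.lit 1)) progRelax)))))

/-- The state represents a configuration of Prim's algorithm after `e` steps. -/
structure PrimState {n : ℕ} (W : ℕ → ℕ → ℕ) (e : ℕ) (s : State) (S : Finset (Fin n))
    (T : SimpleGraph (Fin n)) : Prop where
  reach : PrimReach (fun i j : Fin n => (W i j : ℝ)) S T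
  card : S.card = e + 1
  vis : ∀ v : Fin n, s.nat 17 v 0 0 = 0 ↔ v ∉ S
  parent : ∀ v ∉ S, ∃ u ∈ S, s.nat 18 v 0 0 = (u : Fin n) ∧ ∀ a ∈ S, W u v ≤ W a v
  adj : ∀ a b : Fin n, T.Adj a b ↔ a ≠ b ∧ ∃ e' < e,
    (s.nat 3 e' 0 0 = a ∧ s.nat 3 e' 1 0 = b) ∨ (s.nat 3 e' 0 0 = b ∧ s.nat 3 e' 1 0 = a)

/-- Each outside vertex keeps a nearest tree vertex as its parent. Therefore a minimum over the
outside vertices is a minimum over all edges across the cut, and only the new vertex `x` has to be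
compared with the old parents. -/
lemma PrimState.step {n : ℕ} {W : ℕ → ℕ → ℕ} {e : ℕ} {s s' : State} {S : Finset (Fin n)}
    {T : SimpleGraph (Fin n)} (h : PrimState W e s S T) {u x : Fin n} (hu : u ∈ S) (hx : x ∉ S)
    (hpar : s.nat 18 x 0 0 = u) (hmin : ∀ v ∉ S, W u x ≤ W (s.nat 18 v 0 0) v)
    (h17 : ∀ v, s'.nat 17 v 0 0 = if v = x then 1 else s.nat 17 v 0 0)
    (h18 : ∀ v < n, s'.nat 18 v 0 0 =
      if W (s.nat 18 v 0 0) v ≤ W x v then s.nat 18 v 0 0 else x)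
    (h3 : ∀ e' < e, s'.nat 3 e' = s.nat 3 e') (h30 : s'.nat 3 e 0 0 = u)
    (h31 : s'.nat 3 e 1 0 = x) :
    PrimState W (e + 1) s' (insert x S) (T ⊔ SimpleGraph.edge u x) where
  reach := by
    refine PrimReach.step S T u x h.reach hu hx fun a ha b hb => ?_
    obtain ⟨c, hc, hcp, hcmin⟩ := h.parent b hb
    have h1 := hmin b hb
    rw [hcp] at h1
    exact_mod_cast h1.trans (hcmin a ha)
  card := by rw [Finset.card_insert_of_notMem hx, h.card]
  vis := fun v => by
    rw [h17, Finset.mem_insert, not_or]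
    by_cases hv : v = x
    · simp [hv]
    · rw [if_neg fun h => hv (Fin.ext h), h.vis]
      simp [hv]
  parent := fun v hv => by
    rw [Finset.mem_insert, not_or] at hv
    obtain ⟨c, hc, hcp, hcmin⟩ := h.parent v hv.2
    rw [h18 v v.2, hcp]
    split_ifs with hle
    · refine ⟨c, Finset.mem_insert_of_mem hc, rfl, fun a ha => ?_⟩
      rcases Finset.mem_insert.1 ha with rfl | ha
      · exact hle
      · exact hcmin a ha
    · refine ⟨x, Finset.mem_insert_self _ _, rfl, fun a ha => ?_⟩
      rcases Finset.mem_insert.1 ha with rfl | ha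
      · exact le_rfl
      · exact (not_le.1 hle).le.trans (hcmin a ha)
  adj := fun a b => by
    rw [SimpleGraph.sup_adj, SimpleGraph.edge_adj, h.adj]
    constructor
    · rintro (⟨hne, e', he', h'⟩ | ⟨h', hne⟩)
      · exact ⟨hne, e', by omega, by rwa [h3 e' he']⟩
      · refine ⟨hne, e, by omega, ?_⟩
        rw [h30, h31]
        rcases h' with ⟨rfl, rfl⟩ | ⟨rfl, rfl⟩
        · exact Or.inl ⟨rfl, rfl⟩
        · exact Or.inr ⟨rfl, rfl⟩
    · rintro ⟨hne, e', he', h'⟩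
      rcases Nat.lt_succ_iff_lt_or_eq.1 he' with he | rfl
      · rw [h3 e' he] at h'
        exact Or.inl ⟨hne, e', he, h'⟩
      · rw [h30, h31] at h'
        refine Or.inr ⟨?_, hne⟩
        rcases h' with ⟨h1, h2⟩ | ⟨h1, h2⟩
        · exact Or.inl ⟨(Fin.ext h1).symm, (Fin.ext h2).symm⟩
        · exact Or.inr ⟨(Fin.ext h2).symm, (Fin.ext h1).symm⟩

lemma runs_progPrim (ω : Seed) (s : State) {n : ℕ} (hn : 1 ≤ n) (h0 : s.nat 0 0 0 0 = n)
    (h17 : ∀ v, s.nat 17 v 0 0 = 0) (h18 : ∀ v, s.nat 18 v 0 0 = 0) :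
    Runs ω progPrim s (10 + (n + 1) * (100 + (n + 2) * 200))
      fun s' => IsPrimTree (fun i j : Fin n => (s.nat 12 i j 0 : ℝ)) (outputGraph n s') := by
  refine Runs.seq (T := 10) (Runs.setNat (by simp [NExp.ops]) ?_)
  set s₀ : State := { s with nat := upd s.nat 17 0 0 0 1 } with hs₀
  change Runs ω _ s₀ _ _
  have hs₀f : ∀ a, a ≠ 17 → s₀.nat a = s.nat a := fun a ha => upd_of_ne _ _ _ _ _ ha
  refine Runs.forLoop (m := n - 1) (T := (8 + (n + 2) * 100) + (20 + (20 + (20 + (n + 2) * 100))))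
    (fun e s' => Frame {3, 17, 18, 19, 20, 21} s s' ∧
      ∃ (S : Finset (Fin n)) (T : SimpleGraph (Fin n)),
        PrimState (fun i j => s.nat 12 i j 0) e s' S T) ?_ ?_ ?_ ?_ ?_
  · refine ⟨((Frame.refl _ s).upd (by decide) _ _ _ _ s.coins).setVar (by decide) _,
      {⟨0, hn⟩}, ⊥, PrimReach.start _, by simp, ?_, ?_, ?_⟩
    · intro v
      rw [State.setVar_nat_of_ne _ _ (by norm_num)]
      simp only [hs₀, upd, h17, Finset.mem_singleton, Fin.ext_iff]
      simp
    -- The cells of array `18` are initially `0`, which is the start vertex, so the parents are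
    -- correct without initialization.
    · intro v hv
      refine ⟨⟨0, hn⟩, by simp, ?_, ?_⟩
      · rw [State.setVar_nat_of_ne _ _ (by norm_num), hs₀f _ (by norm_num), h18]
      · intro a ha
        rw [Finset.mem_singleton.1 ha]
    · intro a b
      simp
  · rintro e s' - - ⟨hf, -⟩
    simp only [NExp.eval]
    rw [hf.nat _ (by decide), h0]
  · rintro e s₁ he h19 ⟨hf₁, S, T, hP⟩
    have k0 : s₁.nat 0 0 0 0 = n := by rw [hf₁.nat _ (by decide), h0]
    have k12 : s₁.nat 12 = s.nat 12 := hf₁.nat _ (by decide)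
    obtain ⟨v, hv⟩ : ∃ v, v ∉ S := by
      by_contra hcon
      push Not at hcon
      have : S = Finset.univ := Finset.eq_univ_iff_forall.2 hcon
      have hc := hP.card
      rw [this, Finset.card_univ, Fintype.card_fin] at hc
      omega
    refine Runs.seq ((runs_progScan ω s₁ k0 ⟨v, v.2, (hP.vis v).2 hv⟩).mono le_rfl ?_)
    rintro s₂ ⟨hf₂, hxlt, hxvis, hxmin⟩
    obtain ⟨x, hxx⟩ : ∃ x : Fin n, s₂.nat 20 0 0 0 = x := ⟨⟨_, hxlt⟩, rfl⟩
    rw [hxx] at hxvis hxmin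
    have hxS : x ∉ S := (hP.vis x).1 hxvis
    obtain ⟨u, huS, hux, -⟩ := hP.parent x hxS
    have k19 : s₂.nat 19 0 0 0 = e := by rw [hf₂.nat _ (by decide), h19]
    have k18 : s₂.nat 18 = s₁.nat 18 := hf₂.nat _ (by decide)
    refine Runs.seq (Runs.setNat (by simp [NExp.ops]) (Runs.seq (Runs.setNat (by simp [NExp.ops])
      (Runs.seq (Runs.setNat (by simp [NExp.ops]) ?_)))))
    generalize hs₃ : State.mk _ _ _ = s₃
    have hnat : s₃.nat = upd (upd (upd s₂.nat 3 e 0 0 u) 3 e 1 0 x) 17 x 0 0 1 := by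
      rw [← hs₃]
      simp only [NExp.eval, hxx, k19, k18, hux, upd_of_ne _ _ _ _ _ (show (20 : ℕ) ≠ 3 by norm_num),
        upd_of_ne _ _ _ _ _ (show (19 : ℕ) ≠ 3 by norm_num)]
    have hreal : s₃.real = s₂.real := by rw [← hs₃]
    have hkeep : ∀ a, a ≠ 3 → a ≠ 17 → s₃.nat a = s₂.nat a := fun a h1 h2 => by
      rw [hnat, upd_of_ne _ _ _ _ _ h2, upd_of_ne _ _ _ _ _ h1, upd_of_ne _ _ _ _ _ h1]
    have hf₃ : Frame {3, 17, 18, 19, 20, 21} s s₃ :=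
      (hf₁.trans hf₂ (by decide)).trans (B := {3, 17}) ⟨fun a ha => hkeep a
        (fun h => ha (by simp [h])) (fun h => ha (by simp [h])), hreal⟩ (by decide)
    have hkey : ∀ v, s₃.key v = s.nat 12 (s₁.nat 18 v 0 0) v 0 := fun v => by
      rw [State.key, hkeep 18 (by norm_num) (by norm_num), k18,
        hkeep 12 (by norm_num) (by norm_num), hf₂.nat _ (by decide), k12]
    have hkey₁ : ∀ v, s₁.key v = s.nat 12 (s₁.nat 18 v 0 0) v 0 := fun v => by
      rw [State.key, k12]
    refine (runs_progRelax ω s₃ (n := n) (x := x) ?_ ?_).mono le_rfl ?_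
    · rw [hf₃.nat _ (by decide), h0]
    · rw [hkeep _ (by norm_num) (by norm_num), hxx]
    rintro s₄ ⟨hf₄, hrelax⟩
    refine ⟨?_, (hf₃.trans hf₄ (by decide)).setVar (by decide) _, insert x S,
      T ⊔ SimpleGraph.edge u x, ?_⟩
    · rw [hf₄.nat _ (by decide), hkeep _ (by norm_num) (by norm_num), k19]
    have hk3 : (s₄.setVar 19 (e + 1)).nat 3 = s₃.nat 3 := by
      rw [State.setVar_nat_of_ne _ _ (by norm_num), hf₄.nat _ (by decide)]
    refine hP.step huS hxS hux ?_ ?_ ?_ ?_ ?_ ?_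
    · intro v hv
      have := hxmin v v.2 ((hP.vis v).2 hv)
      rwa [hkey₁, hkey₁, hux] at this
    · intro v
      rw [State.setVar_nat_of_ne _ _ (by norm_num), hf₄.nat _ (by decide), hnat]
      simp only [upd]
      by_cases hvx : v = x
      · simp [hvx]
      · simp only [hvx, false_and, and_false, if_false]
        norm_num
        rw [hf₂.nat _ (by decide)]
    · intro v hv
      rw [State.setVar_nat_of_ne _ _ (by norm_num), hrelax v hv, hkey,
        hkeep 12 (by norm_num) (by norm_num), hf₂.nat 12 (by decide), k12,
        hkeep 18 (by norm_num) (by norm_num), k18]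
    · intro e' he'
      rw [hk3, hnat]
      funext a b
      simp only [upd]
      have : e' ≠ e := by omega
      simp only [this, false_and, and_false, if_false]
      norm_num
      rw [hf₂.nat _ (by decide)]
    · rw [hk3, hnat]
      simp [upd]
    · rw [hk3, hnat]
      simp [upd]
  · rintro s' - ⟨-, S, T, hP⟩
    have hS : S = Finset.univ := by
      rw [← Finset.card_eq_iff_eq_univ, hP.card, Fintype.card_fin]
      omega
    have hT : outputGraph n s' = T := by
      ext a b
      rw [hP.adj, outputGraph, SimpleGraph.fromRel_adj]
      refine and_congr_right fun _ => ⟨?_, ?_⟩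
      · rintro (⟨e, he, h⟩ | ⟨e, he, h⟩)
        · exact ⟨e, by omega, Or.inl h⟩
        · exact ⟨e, by omega, Or.inr h⟩
      · rintro ⟨e, he, h | h⟩
        · exact Or.inl ⟨e, by omega, h⟩
        · exact Or.inr ⟨e, by omega, h⟩
    rw [hT, IsPrimTree, ← hS]
    exact hP.reach
  · rw [show n - 1 + 2 = n + 1 by omega]
    refine Nat.mul_le_mul_left _ ?_
    simp only [NExp.ops]
    omega

/-- Prim's algorithm only compares weights. A map that preserves their order, such as the passage
from codes to distances, keeps its runs. -/
lemma PrimReach.congr {n : ℕ} {w w' : Fin n → Fin n → ℝ}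
    (hw : ∀ a b a' b', w a b ≤ w a' b' → w' a b ≤ w' a' b') {S : Finset (Fin n)}
    {T : SimpleGraph (Fin n)} (h : PrimReach w S T) : PrimReach w' S T := by
  induction h with
  | start r => exact .start r
  | step S T u v h hu hv hmin ih =>
    exact .step S T u v ih hu hv fun a ha b hb => hw _ _ _ _ (hmin a ha b hb)

/-- Every run is also a run for the weights that are all `0`, and these are symmetric. So nothing
has to be known about the weights, which matters off the good event. -/
lemma IsPrimTree.isTree {n : ℕ} {w : Fin n → Fin n → ℝ} {T : SimpleGraph (Fin n)}
    (h : IsPrimTree w T) : T.IsTree :=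
  (IsPrimTree.isMinSpanningTree (w := fun _ _ => 0) (fun _ _ => rfl)
    (PrimReach.congr (fun _ _ _ _ _ => le_rfl) h)).1

/-! ### The law of the matrices that the program uses -/

/-- The matrices that the program uses. -/
noncomputable def seedMatrices (k d : ℕ) (δ : ℝ) (ω : Seed) : Matrices k d δ :=
  fun l r j => matrixBit ω δ k d l r j

lemma volume_map_decide_lt (b : unitInterval) :
    (volume : Measure unitInterval).map (fun u => decide (u < b)) =
      bernoulliMeasure true false b := by
  have hm : Measurable fun u : unitInterval => decide (u < b) :=
    measurable_to_bool (by
      rw [show (fun u : unitInterval => decide (u < b)) ⁻¹' {true} = Set.Iio b by ext u; simp]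
      exact measurableSet_Iio)
  refine Measure.ext_of_singleton fun v => ?_
  rw [Measure.map_apply hm (measurableSet_singleton _)]
  cases v
  · rw [show (fun u : unitInterval => decide (u < b)) ⁻¹' {false} = Set.Ici b by ext u; simp,
      unitInterval.volume_Ici, bernoulliMeasure_apply_of_notMem_of_mem _ _ (by simp) (by simp)]
    · rw [ENNReal.ofReal, ENNReal.coe_inj]
      ext
      rw [Real.coe_toNNReal _ (by linarith [b.2.2])]
      rfl
    · exact measurableSet_singleton _
  · rw [show (fun u : unitInterval => decide (u < b)) ⁻¹' {true} = Set.Iio b by ext u; simp,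
      unitInterval.volume_Iio, bernoulliMeasure_apply_of_mem_of_notMem _ _ (by simp) (by simp)]
    · rw [ENNReal.ofReal, ENNReal.coe_inj]
      ext
      rw [Real.coe_toNNReal _ b.2.1]
      rfl
    · exact measurableSet_singleton _

/-- The index is a mixed radix expansion with digits `r < k` and `j < d`. Different entries thus use
different coins, which gives their independence. -/
lemma injective_coinIndex (k d m : ℕ) : Function.Injective
    fun i : Fin m × Fin k × Fin d => ((i.1 : ℕ) * k + i.2.1) * d + i.2.2 := by
  rintro ⟨l, r, j⟩ ⟨l', r', j'⟩ h
  simp only at h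
  have hd : 0 < d := j.pos
  have hk : 0 < k := r.pos
  have hj : (j : ℕ) = j' := by
    have := congrArg (· % d) h
    simpa [Nat.add_mod, Nat.mod_eq_of_lt j.2, Nat.mod_eq_of_lt j'.2] using this
  have h1 : (l : ℕ) * k + r = l' * k + r' := by
    rw [hj] at h
    exact Nat.eq_of_mul_eq_mul_right hd (by omega)
  have hr : (r : ℕ) = r' := by
    have := congrArg (· % k) h1
    simpa [Nat.add_mod, Nat.mod_eq_of_lt r.2, Nat.mod_eq_of_lt r'.2] using this
  have hl : (l : ℕ) = l' := by
    rw [hr] at h1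
    exact Nat.eq_of_mul_eq_mul_right hk (by omega)
  rw [Fin.ext hl, Fin.ext hr, Fin.ext hj]

lemma measurable_matrixBit {δ : ℝ} (k d l r j : ℕ) :
    Measurable fun ω : Seed => matrixBit ω δ k d l r j := by
  classical
  refine measurable_to_bool ?_
  have : (fun ω : Seed => matrixBit ω δ k d l r j) ⁻¹' {true} =
      {ω : Seed | (ω ((l * k + r) * d + j) : ℝ) < 1 / (4 * (1 + δ) ^ l)} := by
    ext ω; simp [matrixBit]
  rw [this]
  exact measurableSet_lt (measurable_subtype_coe.comp (measurable_pi_apply _)) measurable_const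

lemma measurable_seedMatrices (k d : ℕ) (δ : ℝ) : Measurable (seedMatrices k d δ) :=
  measurable_pi_lambda _ fun l => measurable_pi_lambda _ fun r => measurable_pi_lambda _ fun j =>
    measurable_matrixBit k d l r j

lemma seedLaw_map_seedMatrices (k d : ℕ) {δ : ℝ} (hδ : 0 < δ) :
    seedLaw.map (seedMatrices k d δ) = matricesLaw k d δ := by
  classical
  set ι := Fin (lastIdx d δ + 1) × Fin k × Fin d
  set idx : ι → ℕ := fun i => ((i.1 : ℕ) * k + i.2.1) * d + i.2.2 with hidx
  have hm : ∀ i : ι, Measurable fun u : unitInterval => decide (u < bias δ i.1) := fun i =>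
    measurable_to_bool (by
      rw [show (fun u : unitInterval => decide (u < bias δ i.1)) ⁻¹' {true} =
        Set.Iio (bias δ i.1) by ext u; simp]
      exact measurableSet_Iio)
  have h1 : seedLaw.map (fun ω (i : ι) => ω (idx i)) =
      Measure.infinitePi fun _ : ι => (volume : Measure unitInterval) :=
    Measure.map_infinitePi_infinitePi_of_inj (P := fun _ : ℕ => (volume : Measure unitInterval))
      (injective_coinIndex k d (lastIdx d δ + 1))
  have h2 : seedLaw.map (fun ω (i : ι) => decide (ω (idx i) < bias δ i.1)) =
      Measure.pi fun i : ι => bernoulliMeasure true false (bias δ i.1) := by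
    have := Measure.infinitePi_map_pi (μ := fun _ : ι => (volume : Measure unitInterval)) hm
    simp only [volume_map_decide_lt, Measure.infinitePi_eq_pi] at this
    rw [← this, ← Measure.infinitePi_eq_pi, ← h1, Measure.map_map]
    · rfl
    · exact measurable_pi_lambda _ fun i => (hm i).comp (measurable_pi_apply i)
    · exact measurable_pi_lambda _ fun i => measurable_pi_apply _
  have hG : Measurable fun (ω : Seed) (i : ι) => decide (ω (idx i) < bias δ i.1) :=
    measurable_pi_lambda _ fun i => (hm i).comp (measurable_pi_apply (idx i))
  refine Measure.ext_of_singleton fun f => ?_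
  -- The iterated product measure and the product over all triples live on different types. Both
  -- spaces are finite, so it suffices to compare the masses of single points.
  have h3 : matricesLaw k d δ {f} =
      ∏ i : ι, bernoulliMeasure true false (bias δ i.1) {f i.1 i.2.1 i.2.2} := by
    rw [matricesLaw_eq]
    simp only [Measure.pi_singleton, rowLaw, Fintype.prod_prod_type, ι]
  rw [h3, ← Measure.pi_singleton (μ := fun i : ι => bernoulliMeasure true false (bias δ i.1)),
    ← h2, Measure.map_apply (measurable_seedMatrices k d δ) (measurableSet_singleton _),
    Measure.map_apply hG (measurableSet_singleton _)]
  congr 1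
  have hbit : ∀ (ω : Seed) (i : ι), seedMatrices k d δ ω i.1 i.2.1 i.2.2 =
      decide (ω (idx i) < bias δ i.1) := by
    intro ω i
    simp only [seedMatrices, matrixBit, ← Subtype.coe_lt_coe, coe_bias hδ, hidx]
  ext ω
  simp only [Set.mem_preimage, Set.mem_singleton_iff]
  constructor
  · intro h
    funext i
    rw [← hbit, h]
  · intro h
    funext l r j
    rw [hbit ω (l, r, j), congrFun h (l, r, j)]

/-! ### The weights that the program computes -/

/-- The coordinates of the points. -/
def coord {n d : ℕ} (p : Fin n → Fin d → Bool) (i j : ℕ) : Bool :=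
  if h : i < n ∧ j < d then p ⟨i, h.1⟩ ⟨j, h.2⟩ else false

lemma parityBit_eq_decide (a x : ℕ → Bool) (d : ℕ) :
    parityBit a x d =
      decide (Odd ((Finset.range d).filter fun j => a j = true ∧ x j = true).card) := by
  induction d with
  | zero => simp [parityBit]
  | succ d ih =>
    rw [parityBit, ih, Finset.range_add_one, Finset.filter_insert]
    by_cases h : a d = true ∧ x d = true
    · rw [if_pos h, Finset.card_insert_of_notMem (by simp), h.1, h.2]
      simp [Nat.odd_add_one, ← Nat.not_even_iff_odd]
    · have : (a d && x d) = false := by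
        cases ha : a d <;> cases hx : x d <;> simp_all
      rw [if_neg h, this, Bool.xor_false]

lemma proj_seedMatrices {n d k : ℕ} {δ : ℝ} (ω : Seed) (p : Fin n → Fin d → Bool)
    (l : Fin (lastIdx d δ + 1)) (i : Fin n) (r : Fin k) :
    proj (seedMatrices k d δ ω l) (p i) r =
      parityBit (matrixBit ω δ k d l r) (coord p i) d := by
  rw [parityBit_eq_decide, proj]
  congr 2
  refine Finset.card_bij (fun j _ => (j : ℕ)) ?_ ?_ ?_
  · intro j hj
    have := (Finset.mem_filter.1 hj).2
    rw [Finset.mem_filter, Finset.mem_range]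
    exact ⟨j.2, this.1, by rw [coord, dif_pos ⟨i.2, j.2⟩]; exact this.2⟩
  · intro j _ j' _ h
    exact Fin.ext h
  · intro j hj
    rw [Finset.mem_filter, Finset.mem_range] at hj
    have hx := hj.2.2
    rw [coord, dif_pos ⟨i.2, hj.1⟩] at hx
    exact ⟨⟨j, hj.1⟩, Finset.mem_filter.2 ⟨Finset.mem_univ _, hj.2.1, hx⟩, rfl⟩

lemma bool_toNat_injective : Function.Injective Bool.toNat := by decide

/-- The state contains the projections of the points. -/
def HasProjections {n k d : ℕ} {δ : ℝ} (F : Matrices k d δ) (p : Fin n → Fin d → Bool)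
    (s : State) : Prop :=
  ∀ (l : Fin (lastIdx d δ + 1)) (i : Fin n) (r : Fin k),
    s.nat 11 l i r = (proj (F l) (p i) r).toNat

lemma HasProjections.diffCount {n k d : ℕ} {δ : ℝ} {F : Matrices k d δ}
    {p : Fin n → Fin d → Bool} {s : State} (h : HasProjections F p s)
    (l : Fin (lastIdx d δ + 1)) (i j : Fin n) :
    diffCount (s.nat 11 l i) (s.nat 11 l j) k =
      hammingDist (proj (F l) (p i)) (proj (F l) (p j)) := by
  rw [HamMST.diffCount, hammingDist]
  symm
  refine Finset.card_bij (fun r _ => (r : ℕ)) ?_ ?_ ?_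
  · intro r hr
    simp only [Finset.mem_filter, Finset.mem_univ, true_and, Finset.mem_range] at hr ⊢
    refine ⟨r.2, fun he => hr ?_⟩
    rw [h, h] at he
    exact bool_toNat_injective he
  · intro r _ r' _ hr
    exact Fin.ext hr
  · intro r hr
    simp only [Finset.mem_filter, Finset.mem_range] at hr
    refine ⟨⟨r, hr.1⟩, ?_, rfl⟩
    simp only [Finset.mem_filter, Finset.mem_univ, true_and]
    intro he
    refine hr.2 ?_
    exact (h l i ⟨r, hr.1⟩).trans ((congrArg Bool.toNat he).trans (h l j ⟨r, hr.1⟩).symm)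

/-- The weight that belongs to a code. -/
noncomputable def decode (δ : ℝ) : ℕ → ℝ
  | 0 => 0
  | g + 1 => (1 + δ) ^ g

lemma decode_mono {δ : ℝ} (hδ : 0 < δ) : Monotone (decode δ) := by
  intro a b hab
  cases a with
  | zero =>
    cases b with
    | zero => exact le_rfl
    | succ b => exact pow_nonneg (by linarith) b
  | succ a =>
    cases b with
    | zero => omega
    | succ b => exact pow_le_pow_right₀ (by linarith) (by omega)

/-- On the good event the first projections separate distinct points, so the equality test is right.
The threshold test is monotone, so the switch found by binary search is the first success, or the
last index if there is none. -/
lemma IsCode.decode_eq {n k d : ℕ} {δ : ℝ} (hδ : 0 < δ) {F : Matrices k d δ}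
    {p : Fin n → Fin d → Bool} {s : State} (hs : HasProjections F p s) {i j : Fin n}
    (hF : p i ≠ p j → Faithful F (p i) (p j)) {w : ℕ}
    (hw : IsCode s δ k (lastIdx d δ) i j w) : decode δ w = approxWeight F p i j := by
  classical
  have h0 : diffCount (s.nat 11 0 i) (s.nat 11 0 j) k =
      hammingDist (proj (F 0) (p i)) (proj (F 0) (p j)) := hs.diffCount 0 i j
  by_cases hij : p i = p j
  · rw [hw.1 (by rw [h0, hij, hammingDist_self])]
    simp [approxWeight, approxHam, hij, decode]
  have hF := hF hij
  obtain ⟨g, rfl, hgL, hg, hg'⟩ := hw.2 (by rw [h0]; exact hammingDist_ne_zero.2 hF.2)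
  have hclose : ∀ m, (hm : m < lastIdx d δ + 1) →
      (Close s δ k i j m ↔ Passes F ⟨m, hm⟩ (p i) (p j)) := fun m hm => by
    rw [Close, Passes, hs.diffCount ⟨m, hm⟩ i j]
  -- A success at `m` bounds the distance by the threshold with index `m + 1 ≤ m'`, and then success
  -- at `m'` is guaranteed.
  have hmono : ∀ m m', m < m' → (hm : m' < lastIdx d δ + 1) → Close s δ k i j m →
      Close s δ k i j m' := fun m m' hlt hm hc => by
    rw [hclose m (by omega)] at hc
    rw [hclose m' hm]
    refine (hF.1 ⟨m', hm⟩).2 ?_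
    have h1 : (hammingDist (p i) (p j) : ℝ) ≤ (1 + δ) ^ (m + 1) :=
      not_lt.1 fun hcon => (hF.1 ⟨m, by omega⟩).1 hcon hc
    exact h1.trans (pow_le_pow_right₀ (by linarith) (by simpa using hlt))
  simp only [decode, approxWeight, approxHam, if_neg hij]
  congr 1
  refine le_antisymm (le_csInf ⟨_, Or.inl rfl⟩ ?_) (Nat.sInf_le ?_)
  · rintro m (rfl | ⟨hm, hpass⟩)
    · exact hgL
    · by_contra hlt
      push Not at hlt
      rcases hg' with h | h
      · omega
      · refine h ?_
        have hc := (hclose m hm).2 hpass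
        rcases Nat.lt_or_ge m (g - 1) with h' | h'
        · exact hmono m (g - 1) h' (by omega) hc
        · rwa [show g - 1 = m by omega]
  · rcases hg with h | h
    · exact Or.inl h
    · exact Or.inr ⟨by omega, (hclose g (by omega)).1 h⟩

/-! ### The whole program -/

/-- The program that computes an approximate minimum spanning tree. -/
def progMST (c : ℕ) : Prog :=
  .seq (progRows c) (.seq progThresholds (.seq progProjections (.seq progPairs progPrim)))

/-- A bound on the number of operations of the program. -/
def mstTime (n d k L : ℕ) : ℕ :=
  (k + 2) * 50 + ((L + 3) * 60 +
    ((L + 3) * (24 + ((k + 2) * (22 + ((d + 2) * (22 + (50 + (n + 2) * 100)))))) +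
      ((n + 2) * (22 + (n + 2) * (22 + (Nat.log 2 L + 4) * (150 + (k + 2) * 100))) +
        (10 + (n + 1) * (100 + (n + 2) * 200)))))

/-- The output is a tree for every outcome of the coins; only the identification of its weights with
the approximate distances needs the good event. -/
lemma runs_progMST (ω : Seed) (c : ℕ) {n d : ℕ} {δ : ℝ} (hn : 1 ≤ n) (hd : 1 ≤ d) (hδ : 0 < δ)
    (p : Fin n → Fin d → Bool) :
    Runs ω (progMST c) (inputState δ p) (mstTime n d (sketchDim c n d δ) (lastIdx d δ)) fun s' =>
      (outputGraph n s').IsTree ∧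
      ((∀ i j, p i ≠ p j → Faithful (seedMatrices (sketchDim c n d δ) d δ ω) (p i) (p j)) →
        IsPrimTree (approxWeight (seedMatrices (sketchDim c n d δ) d δ ω) p)
          (outputGraph n s')) := by
  unfold mstTime progMST
  set k := sketchDim c n d δ with hk
  set L := lastIdx d δ with hL
  refine Runs.seq ((runs_progRows ω c (inputState δ p) (n := n) (d := d) (δ := δ)
    (by simp [inputState]) (by simp [inputState]) (by simp [inputState])).mono le_rfl ?_)
  rintro s₁ rfl
  rw [← hk]
  refine Runs.seq ((runs_progThresholds ω _ (d := d) (δ := δ) hd hδ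
    (by rw [State.setVar_nat_of_ne _ _ (by norm_num)]; simp [inputState])
    (by simp [inputState])).mono le_rfl ?_)
  rintro s₂ ⟨hnat₂, hcoins₂, hδ₂, ht₂⟩
  have hin : ∀ a, a ≠ 4 → a ≠ 5 → s₂.nat a = (inputState δ p).nat a := fun a h4 h5 => by
    rw [hnat₂, State.setVar_nat_of_ne _ _ h5, State.setVar_nat_of_ne _ _ h4]
  have k0 : s₂.nat 0 0 0 0 = n := by
    rw [hin _ (by norm_num) (by norm_num)]; simp [inputState]
  have k4 : s₂.nat 4 0 0 0 = k := by
    rw [hnat₂, State.setVar_nat_of_ne _ _ (by norm_num), State.setVar_nat_same]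
  have k5 : s₂.nat 5 0 0 0 = L := by rw [hnat₂, State.setVar_nat_same]
  have hzero : ∀ a, 5 < a → ∀ i j l, s₂.nat a i j l = 0 := fun a ha i j l => by
    rw [hin _ (by omega) (by omega)]
    have h0 : a ≠ 0 := by omega
    have h1 : a ≠ 1 := by omega
    have h2 : a ≠ 2 := by omega
    simp [inputState, h0, h1, h2]
  refine Runs.seq ((runs_progProjections ω s₂ (n := n) (d := d) (k := k) (L := L) (δ := δ)
    (x := coord p) k0 ?_ k4 k5 ht₂ ?_ ?_ ?_).mono le_rfl ?_)
  · rw [hin _ (by norm_num) (by norm_num)]; simp [inputState]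
  · rw [hcoins₂]; rfl
  · intro i hi j hj
    rw [hin _ (by norm_num) (by norm_num)]
    simp [inputState, coord, hi, hj]
  · exact hzero 11 (by norm_num)
  rintro s₃ ⟨hf₃, hproj⟩
  have hr₃ : s₃.real = s₂.real := hf₃.real
  have hproj' : HasProjections (seedMatrices k d δ ω) p s₃ := fun l i r => by
    rw [hproj l (by have := l.2; omega) i i.2 r r.2, proj_seedMatrices]
  have hpairs := runs_progPairs ω s₃ (n := n) (k := k) (L := L) hδ
    (by rw [hf₃.nat _ (by decide), k0]) (by rw [hf₃.nat _ (by decide), k4])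
    (by rw [hf₃.nat _ (by decide), k5]) (by rw [hr₃, hδ₂]) (by rw [hr₃]; exact ht₂)
  refine Runs.seq (hpairs.mono le_rfl ?_)
  rintro s₄ ⟨hf₄, hcode⟩
  have hf₃₄ : Frame {6, 7, 8, 9, 10, 11, 12, 13, 14, 15, 16} s₂ s₄ :=
    (hf₃.mono (by decide)).trans hf₄ (by decide)
  refine (runs_progPrim ω s₄ hn ?_ ?_ ?_).mono le_rfl ?_
  · rw [hf₃₄.nat _ (by decide), k0]
  · intro v
    rw [hf₃₄.nat _ (by decide), hzero 17 (by norm_num)]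
  · intro v
    rw [hf₃₄.nat _ (by decide), hzero 18 (by norm_num)]
  intro s₅ hprim
  refine ⟨hprim.isTree, fun hF => PrimReach.congr ?_ hprim⟩
  intro a b a' b' hle
  have hle' : s₄.nat 12 a b 0 ≤ s₄.nat 12 a' b' 0 := by exact_mod_cast hle
  rw [← (hcode a a.2 b b.2).decode_eq hδ hproj' (hF a b),
    ← (hcode a' a'.2 b' b'.2).decode_eq hδ hproj' (hF a' b')]
  exact decode_mono hδ hle'

/-! ### The running time -/

/-- All additive terms are absorbed into the two leading products, since `n`, `d`, `k` and `L` are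
at least `1`. -/
lemma mstTime_le {n d k L : ℕ} (hn : 1 ≤ n) (hd : 1 ≤ d) (hk : 1 ≤ k) (hL : 1 ≤ L) :
    mstTime n d k L ≤ 20000 * (k * (n * d * L + n ^ 2 * (Nat.log 2 L + 4))) := by
  unfold mstTime
  generalize hb : Nat.log 2 L + 4 = b
  have hb4 : 1 ≤ b := by omega
  have e1 : 1 ≤ k * L := Nat.mul_pos hk hL
  have e2 : 1 ≤ n * d := Nat.mul_pos hn hd
  have e3 : k * L ≤ k * (n * d * L) := by
    calc k * L = 1 * (k * L) := (one_mul _).symm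
      _ ≤ n * d * (k * L) := Nat.mul_le_mul_right _ e2
      _ = k * (n * d * L) := by ring
  have e4 : k ≤ k * L := Nat.le_mul_of_pos_right k hL
  have e5 : L ≤ k * L := Nat.le_mul_of_pos_left L hk
  have e6 : 1 ≤ k * b := Nat.mul_pos hk hb4
  have e7 : n ^ 2 ≤ k * (n ^ 2 * b) := by
    calc n ^ 2 = 1 * n ^ 2 := (one_mul _).symm
      _ ≤ k * b * n ^ 2 := Nat.mul_le_mul_right _ e6
      _ = k * (n ^ 2 * b) := by ring
  have e8 : n ≤ n ^ 2 := Nat.le_self_pow (by norm_num) n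
  have f1 : (L + 3) * (24 + (k + 2) * (22 + (d + 2) * (22 + (50 + (n + 2) * 100)))) ≤
      13752 * (k * (n * d * L)) := by
    have g1 : 22 + (d + 2) * (22 + (50 + (n + 2) * 100)) ≤ 1138 * (n * d) := by
      calc 22 + (d + 2) * (22 + (50 + (n + 2) * 100))
          ≤ 22 * (n * d) + (3 * d) * (372 * n) :=
            add_le_add (by omega) (Nat.mul_le_mul (by omega) (by omega))
        _ = 1138 * (n * d) := by ring
    have e9 : 1 ≤ k * (n * d) := Nat.mul_pos hk e2
    calc (L + 3) * (24 + (k + 2) * (22 + (d + 2) * (22 + (50 + (n + 2) * 100))))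
        ≤ (4 * L) * (24 * (k * (n * d)) + (3 * k) * (1138 * (n * d))) :=
          Nat.mul_le_mul (by omega) (add_le_add (by omega) (Nat.mul_le_mul (by omega) g1))
      _ = 13752 * (k * (n * d * L)) := by ring
  have f2 : (n + 2) * (22 + (n + 2) * (22 + b * (150 + (k + 2) * 100))) ≤
      4314 * (k * (n ^ 2 * b)) := by
    have e9 : 1 ≤ n * (k * b) := Nat.mul_pos hn e6
    calc (n + 2) * (22 + (n + 2) * (22 + b * (150 + (k + 2) * 100)))
        ≤ (3 * n) * (22 * (n * (k * b)) + (3 * n) * (22 * (k * b) + b * (450 * k))) :=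
          Nat.mul_le_mul (by omega) (add_le_add (by omega) (Nat.mul_le_mul (by omega)
            (add_le_add (by omega) (Nat.mul_le_mul_left _ (by omega)))))
      _ = 4314 * (k * (n ^ 2 * b)) := by ring
  have f3 : (n + 1) * (100 + (n + 2) * 200) ≤ 1400 * n ^ 2 := by
    calc (n + 1) * (100 + (n + 2) * 200) ≤ (2 * n) * (700 * n) :=
          Nat.mul_le_mul (by omega) (by omega)
      _ = 1400 * n ^ 2 := by ring
  rw [mul_add k]
  omega

/-- From `(1 + δ)³ < 27/8 < 4 ≤ d²`. It keeps the iterated logarithm in the time bound away from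
`0`, so that constants can be absorbed into it. -/
lemma three_halves_le_logb {d : ℕ} {δ : ℝ} (hd : 2 ≤ d) (hδ : 0 < δ) (hδ' : δ < 1 / 2) :
    3 / 2 ≤ Real.logb (1 + δ) d := by
  have hd' : (2 : ℝ) ≤ d := by exact_mod_cast hd
  have h1 : 0 < Real.log (1 + δ) := Real.log_pos (by linarith)
  rw [Real.logb, le_div_iff₀ h1]
  have h2 : Real.log ((1 + δ) ^ 3) ≤ Real.log (d ^ 2) := by
    refine Real.log_le_log (by positivity) ?_
    have : (1 + δ) ^ 3 ≤ (3 / 2) ^ 3 := pow_le_pow_left₀ (by linarith) (by linarith) 3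
    nlinarith
  rw [Real.log_pow, Real.log_pow] at h2
  push_cast at h2
  linarith

/-- Since `n d ≥ 2`, the factor `2` inside the logarithm at most doubles it. The rounding adds at
most `1 ≤ log (n d) / δ²`. -/
lemma sketchDim_le {c : ℝ} {n d : ℕ} {δ : ℝ} (hc : 0 ≤ c) (hn : 1 ≤ n) (hd : 2 ≤ d) (hδ : 0 < δ)
    (hδ' : δ < 1 / 2) :
    (sketchDim c n d δ : ℝ) ≤ (2 * c + 1) * (Real.log (n * d) / δ ^ 2) := by
  have hnd : (2 : ℝ) ≤ n * d := by
    have : 1 * 2 ≤ n * d := Nat.mul_le_mul hn hd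
    exact_mod_cast this
  have hlog2 : 0.69 < Real.log 2 := by linarith [Real.log_two_gt_d9]
  have hlog : Real.log 2 ≤ Real.log (n * d) := Real.log_le_log (by norm_num) hnd
  have h1 : Real.log (2 * n * d) ≤ 2 * Real.log (n * d) := by
    rw [mul_assoc, Real.log_mul (by norm_num) (by linarith)]
    linarith
  have h0 : 0 ≤ Real.log (2 * n * d) := Real.log_nonneg (by nlinarith)
  have h2 : 1 ≤ Real.log (n * d) / δ ^ 2 := by
    rw [le_div_iff₀ (by positivity)]
    nlinarith
  have h3 : c * Real.log (2 * n * d) / δ ^ 2 ≤ 2 * c * (Real.log (n * d) / δ ^ 2) := by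
    rw [← mul_div_assoc]
    gcongr ?_ / _
    nlinarith
  have h4 := (Nat.ceil_lt_add_one (a := c * Real.log (2 * n * d) / δ ^ 2) (by positivity)).le
  rw [sketchDim]
  linarith

/-- From `L ≤ ℓ + 1 ≤ 2 ℓ`, the left side is at most `5 + log ℓ / log 2`. With `log ℓ ≥ 1/3` the
constant is at most `15 log ℓ`, and `1 / log 2 < 2`. -/
lemma log_lastIdx_le {d : ℕ} {δ : ℝ} (hd : 2 ≤ d) (hδ : 0 < δ) (hδ' : δ < 1 / 2) :
    ((Nat.log 2 (lastIdx d δ) + 4 : ℕ) : ℝ) ≤ 17 * Real.log (Real.logb (1 + δ) d) := by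
  have hl := three_halves_le_logb hd hδ hδ'
  set ℓ := Real.logb (1 + δ) d with hℓ
  have hlog2 : 0.69 < Real.log 2 := by linarith [Real.log_two_gt_d9]
  have hlog2' : Real.log 2 < 0.7 := by linarith [Real.log_two_lt_d9]
  have hpos : lastIdx d δ ≠ 0 := (Nat.ceil_pos.2 (by linarith)).ne'
  have h1 : (2 : ℝ) ^ Nat.log 2 (lastIdx d δ) ≤ 2 * ℓ := by
    have h2 : ((2 ^ Nat.log 2 (lastIdx d δ) : ℕ) : ℝ) ≤ lastIdx d δ := by
      exact_mod_cast Nat.pow_log_le_self 2 hpos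
    have h3 : (lastIdx d δ : ℝ) ≤ ℓ + 1 := (Nat.ceil_lt_add_one (by linarith)).le
    push_cast at h2
    linarith
  have h2 : (Nat.log 2 (lastIdx d δ) : ℝ) * Real.log 2 ≤ Real.log 2 + Real.log ℓ := by
    rw [← Real.log_pow, ← Real.log_mul (by norm_num) (by linarith)]
    exact Real.log_le_log (by positivity) h1
  have h3 : 1 / 3 ≤ Real.log ℓ := by
    have h4 := Real.one_sub_inv_le_log_of_pos (x := ℓ) (by linarith)
    have h5 : ℓ⁻¹ ≤ (3 / 2 : ℝ)⁻¹ := inv_anti₀ (by norm_num) hl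
    norm_num at h5
    linarith
  push_cast
  nlinarith

lemma mstTime_le_timeBound {c : ℝ} {n d : ℕ} {δ : ℝ} (hc : 0 < c) (hn : 1 ≤ n) (hd : 2 ≤ d)
    (hδ : 0 < δ) (hδ' : δ < 1 / 2) :
    (mstTime n d (sketchDim c n d δ) (lastIdx d δ) : ℝ) ≤
      340000 * (2 * c + 1) * timeBound n d δ := by
  have hl := three_halves_le_logb hd hδ hδ'
  have hk1 : 1 ≤ sketchDim c n d δ := by
    refine Nat.one_le_iff_ne_zero.2 (Nat.ceil_pos.2 ?_).ne'
    have : 0 < Real.log (2 * n * d) :=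
      Real.log_pos (by linarith [two_le_inputSize hn (show 1 ≤ d by omega)])
    positivity
  have hL1 : 1 ≤ lastIdx d δ :=
    Nat.one_le_iff_ne_zero.2 (Nat.ceil_pos.2 (by linarith)).ne'
  have hL : (lastIdx d δ : ℝ) ≤ 17 * Real.logb (1 + δ) d := by
    have := (Nat.ceil_lt_add_one (a := Real.logb (1 + δ) d) (by linarith)).le
    rw [lastIdx]
    linarith
  have hk := sketchDim_le hc.le hn hd hδ hδ'
  have hb := log_lastIdx_le hd hδ hδ'
  have hT := mstTime_le hn (show 1 ≤ d by omega) hk1 hL1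
  have hT' : (mstTime n d (sketchDim c n d δ) (lastIdx d δ) : ℝ) ≤
      20000 * ((sketchDim c n d δ : ℝ) * (n * d * (lastIdx d δ : ℝ) +
        n ^ 2 * ((Nat.log 2 (lastIdx d δ) + 4 : ℕ) : ℝ))) := by exact_mod_cast hT
  refine hT'.trans ?_
  calc 20000 * ((sketchDim c n d δ : ℝ) * (n * d * (lastIdx d δ : ℝ) +
        n ^ 2 * ((Nat.log 2 (lastIdx d δ) + 4 : ℕ) : ℝ)))
      ≤ 20000 * (((2 * c + 1) * (Real.log (n * d) / δ ^ 2)) *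
        (n * d * (17 * Real.logb (1 + δ) d) +
          n ^ 2 * (17 * Real.log (Real.logb (1 + δ) d)))) := by
        have h0 : (0 : ℝ) ≤ sketchDim c n d δ := Nat.cast_nonneg _
        refine mul_le_mul_of_nonneg_left (mul_le_mul hk ?_ (by positivity) (h0.trans hk))
          (by norm_num)
        gcongr
    _ = 340000 * (2 * c + 1) * timeBound n d δ := by rw [timeBound]; ring

end HamMST

theorem mainTheorem8 (α : ℝ) (hα : 1 ≤ α) :
    ∃ c : ℝ, 0 < c ∧
      -- the quality of the tree that Prim's algorithm finds for the approximate distances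
      (∀ (n d : ℕ) (δ : ℝ) (p : Fin n → Fin d → Bool), 1 ≤ n → 1 ≤ d → 0 < δ → δ < 1 / 2 →
        HamMST.matricesLaw (HamMST.sketchDim c n d δ) d δ
            {F | ¬ ∀ T : SimpleGraph (Fin n), HamMST.IsPrimTree (HamMST.approxWeight F p) T →
              HamMST.IsApproxMST δ p T}
          ≤ ENNReal.ofReal (1 / (2 * n * d : ℝ) ^ α)) ∧
      -- the time for constructing this tree
      (∃ (P : HamMST.Prog) (C : ℝ), 0 < C ∧
        ∀ (n d : ℕ) (δ : ℝ) (p : Fin n → Fin d → Bool), 1 ≤ n → 2 ≤ d → 0 < δ → δ < 1 / 2 →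
          ∃ (F : HamMST.Seed → HamMST.Matrices (HamMST.sketchDim c n d δ) d δ)
            (out : HamMST.Seed → HamMST.State) (τ : HamMST.Seed → ℕ),
            (Measurable F ∧
              HamMST.seedLaw.map F = HamMST.matricesLaw (HamMST.sketchDim c n d δ) d δ) ∧
            (∀ ω : HamMST.Seed, HamMST.Exec ω P (HamMST.inputState δ p) (out ω) (τ ω) ∧
              (τ ω : ℝ) ≤ C * HamMST.timeBound n d δ ∧
              (HamMST.outputGraph n (out ω)).IsTree) ∧
            HamMST.seedLaw
                {ω | ¬ (HamMST.IsPrimTree (HamMST.approxWeight (F ω) p)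
                    (HamMST.outputGraph n (out ω)) ∧
                  HamMST.IsApproxMST δ p (HamMST.outputGraph n (out ω)))}
              ≤ ENNReal.ofReal (1 / (2 * n * d : ℝ) ^ α)) := by

  -- `K` is taken as a natural number so that `c = 1800 K` can be a literal of the program.
  set K : ℕ := ⌈α⌉₊ + 8 with hK
  have hαK : α + 8 ≤ K := by
    rw [hK]; push_cast; linarith [Nat.le_ceil α]
  have hc : (0 : ℝ) < 1800 * (K : ℝ) := by linarith
  have hcast : ((1800 * K : ℕ) : ℝ) = 1800 * (K : ℝ) := by push_cast; rfl
  have hgood := fun (n d : ℕ) (δ : ℝ) (p : Fin n → Fin d → Bool) (hn : 1 ≤ n) (hd : 1 ≤ d)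
    (hδ : 0 < δ) (hδ' : δ < 1 / 2) =>
    HamMST.matricesLaw_not_forall_faithful_le hn hd hδ hδ' (by linarith) hαK p
  refine ⟨1800 * (K : ℝ), hc, ?_, HamMST.progMST (1800 * K), 340000 * (2 * (1800 * K) + 1),
    by positivity, ?_⟩
  · intro n d δ p hn hd hδ hδ'
    refine le_trans (measure_mono ?_) (hgood n d δ p hn hd hδ hδ')
    intro F hF hgoodF
    exact hF fun T hT => HamMST.isApproxMST_of_isPrimTree hd hδ hgoodF hT
  · intro n d δ p hn hd hδ hδ'
    have hd1 : 1 ≤ d := by omega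
    set k := HamMST.sketchDim (1800 * (K : ℝ)) n d δ with hk
    have hruns := fun ω => HamMST.runs_progMST ω (1800 * K) hn hd1 hδ p
    rw [hcast, ← hk] at hruns
    choose out τ hexec hτ htree hprim using hruns
    refine ⟨HamMST.seedMatrices k d δ, out, τ, ⟨HamMST.measurable_seedMatrices k d δ,
      HamMST.seedLaw_map_seedMatrices k d hδ⟩, fun ω => ⟨hexec ω, ?_, htree ω⟩, ?_⟩
    · exact le_trans (Nat.cast_le.2 (hτ ω)) (HamMST.mstTime_le_timeBound hc hn hd hδ hδ')
    · refine le_trans ?_ (hgood n d δ p hn hd1 hδ hδ')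
      -- The bound for the law of the matrices is pulled back to the coins. A failing run must come
      -- from matrices outside the good event.
      rw [← hk, ← HamMST.seedLaw_map_seedMatrices k d hδ,
        Measure.map_apply (HamMST.measurable_seedMatrices k d δ) (Set.toFinite _).measurableSet]
      refine measure_mono fun ω hω hgoodω => hω ?_
      exact ⟨hprim ω hgoodω, HamMST.isApproxMST_of_isPrimTree hd1 hδ hgoodω (hprim ω hgoodω)⟩
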